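/- Let $B^4$ be the open unit ball of $\mathbb R^4$, let $M(m)$ be the space of real $m\times m$ matrices and $so(m)$ the subspace of antisymmetric ones. Let $N\subset\mathbb R^m$ be a closed (compact, without boundary) smooth embedded submanifold and let $u\in W^{2,2}(B^4,N)$, that is, $u\in W^{2,2}(B^4,\mathbb R^m)$ and $u(x)\in N$ for almost every $x\in B^4$. Suppose that $u$ is a critical point in $W^{2,2}(B^4,N)$ of the extrinsic energy $$\mathcal B_{ext}(v)=\int_{B^4}|\Delta v|^2\,dx$$ or of the intrinsic energy $$\mathcal B_{int}(v)=\int_{B^4}|(\Delta v)^T|^2\,dx,$$ where $(\Delta v)^T(x)$ is the orthogonal projection of $\Delta v(x)$ to the tangent space $T_{v(x)}N$. Here $u$ is called a critical point of $\mathcal B$ if $\frac{d}{dt}\big|_{t=0}\mathcal B(\pi_N(u+t\varphi))=0$ for every $\varphi\in C_c^\infty(B^4,\mathbb R^m)$, where $\pi_N$ is the nearest point projection to $N$. Then there are $V\in W^{1,2}(B^4,M(m)\otimes\wedge^1\mathbb R^4)$, $w\in L^2(B^4,M(m))$ and $W\in W^{-1,2}(B^4,M(m)\otimes\wedge^1\mathbb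 R^4)$ such that $$\Delta^2u=\Delta(V\cdot\nabla u)+\operatorname{div}(w\,\nabla u)+W\cdot\nabla u$$ holds in $B^4$ in the sense of distributions, and such that $W=\nabla\omega+F$ for some $\omega\in L^2(B^4,so(m))$ and some $F\in L^2\cdot W^{1,2}(B^4,M(m)\otimes\wedge^1\mathbb R^4)$. Here $W^{-1,2}$ is the dual space of $W^{1,2}_0$; the distribution $W\cdot\nabla u$ has components $\varphi\mapsto\sum_{j,k}\langle W_k^{ij},\varphi\,\partial_ku^j\rangle$ for $\varphi\in C_c^\infty(B^4)$; and $L^2\cdot W^{1,2}$ is the space of finite linear combinations of products of an $L^2$ map and a $W^{1,2}$ map. -/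

import Mathlib

open MeasureTheory Filter Topology
open scoped ContDiff Laplacian

noncomputable section

namespace Biharmonic

/-- The Euclidean space of dimension `m`. -/
abbrev E (m : ℕ) : Type := EuclideanSpace ℝ (Fin m)

/-- The open unit ball of the four-dimensional Euclidean space. -/
def B4 : Set (E 4) := Metric.ball 0 1

/-- Lebesgue measure on the unit ball. -/
def muB : Measure (E 4) := volume.restrict B4

/-- The `k`-th vector of the standard basis. -/
def e (k : Fin 4) : E 4 := EuclideanSpace.single k 1

/-! ### Sobolev spaces on the ball -/

/-- Test functions: smooth functions with compact support in the open unit ball. -/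
structure IsTest {G : Type*} [NormedAddCommGroup G] [NormedSpace ℝ G] (φ : E 4 → G) : Prop where
  smooth : ContDiff ℝ ∞ φ
  compact : HasCompactSupport φ
  support : tsupport φ ⊆ B4

/-- The classical `k`-th partial derivative of a real function. -/
def partialD (k : Fin 4) (φ : E 4 → ℝ) (x : E 4) : ℝ := fderiv ℝ φ x (e k)

section Weak

variable {G : Type*} [NormedAddCommGroup G] [NormedSpace ℝ G]

/-- `g` is the weak `k`-th partial derivative of `f` on the ball. -/
structure HasWeakPartial (k : Fin 4) (f g : E 4 → G) : Prop where
  locInt : LocallyIntegrableOn f B4 volume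
  locInt_deriv : LocallyIntegrableOn g B4 volume
  eq : ∀ φ : E 4 → ℝ, IsTest φ →
    ∫ x, partialD k φ x • f x ∂muB = - ∫ x, φ x • g x ∂muB

/-- `g` is the weak (distributional) Laplacian of `f` on the ball. -/
structure HasWeakLaplacian (f g : E 4 → G) : Prop where
  locInt : LocallyIntegrableOn f B4 volume
  locInt_lap : LocallyIntegrableOn g B4 volume
  eq : ∀ φ : E 4 → ℝ, IsTest φ → ∫ x, (Δ φ) x • f x ∂muB = ∫ x, φ x • g x ∂muB

open Classical in
/-- The weak `k`-th partial derivative (unique up to null sets; `0` if there is none). -/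
def weakPartial (k : Fin 4) (f : E 4 → G) : E 4 → G :=
  if h : ∃ g, HasWeakPartial k f g then h.choose else 0

open Classical in
/-- The weak Laplacian (unique up to null sets; `0` if there is none). -/
def weakLaplacian (f : E 4 → G) : E 4 → G :=
  if h : ∃ g, HasWeakLaplacian f g then h.choose else 0

/-- The Lebesgue space `L²` of the ball. -/
def MemL2 (f : E 4 → G) : Prop := MemLp f 2 muB

/-- The Sobolev space `W^{1,2}` of the ball. -/
def MemW12 (f : E 4 → G) : Prop :=
  MemL2 f ∧ ∀ k, ∃ g, HasWeakPartial k f g ∧ MemL2 g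

/-- The Sobolev space `W^{2,2}` of the ball. -/
def MemW22 (f : E 4 → G) : Prop :=
  MemL2 f ∧ ∀ k, ∃ g, HasWeakPartial k f g ∧ MemW12 g

end Weak

/-- The `W^{1,2}` norm of a real function on the ball. -/
def normW12 (f : E 4 → ℝ) : ℝ :=
  (eLpNorm f 2 muB).toReal + ∑ k, (eLpNorm (weakPartial k f) 2 muB).toReal

/-- The space `W_0^{1,2}` of the ball: the closure of the test functions in `W^{1,2}`. -/
def MemW120 (f : E 4 → ℝ) : Prop :=
  MemW12 f ∧ ∀ ε : ℝ, 0 < ε → ∃ φ : E 4 → ℝ, IsTest φ ∧ normW12 (f - φ) < ε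

/-- The space `W^{-1,2}` of the ball, the dual space of `W_0^{1,2}`: `T` is linear and bounded on
`W_0^{1,2}` (its values on other functions are irrelevant). -/
structure MemWneg12 (T : (E 4 → ℝ) → ℝ) : Prop where
  map_add : ∀ f g, MemW120 f → MemW120 g → T (f + g) = T f + T g
  map_smul : ∀ (c : ℝ) f, MemW120 f → T (c • f) = c * T f
  bound : ∃ C : ℝ, ∀ f, MemW120 f → |T f| ≤ C * normW12 f

/-- The space `L² · W^{1,2}`: finite sums of products of an `L²` function and a `W^{1,2}`
function. -/
def MemL2W12 (f : E 4 → ℝ) : Prop :=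
  ∃ (r : ℕ) (a b : Fin r → E 4 → ℝ), (∀ l, MemL2 (a l)) ∧ (∀ l, MemW12 (b l)) ∧
    f =ᵐ[muB] fun x => ∑ l, a l x * b l x

/-! ### The target manifold and the energies -/

/-- `N` is a closed (compact, without boundary) smooth embedded `n`-dimensional submanifold of the
Euclidean space of dimension `m`: it is compact and locally the zero set of a smooth submersion
to a Euclidean space of dimension `m - n`. -/
structure IsClosedSubmanifold {m : ℕ} (n : ℕ) (N : Set (E m)) : Prop where
  compact : IsCompact N
  locally_zero_set : ∃ c : ℕ, n + c = m ∧ ∀ p ∈ N, ∃ (U : Set (E m)) (f : E m → E c),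
    IsOpen U ∧ p ∈ U ∧ ContDiffOn ℝ ∞ f U ∧
    (∀ y ∈ U, Function.Surjective (fderiv ℝ f y)) ∧ N ∩ U = {y ∈ U | f y = 0}

/-- The tangent space of `N` at `p`: the velocities at `p` of the curves in `N` through `p` (for a
submanifold these form a linear space, and the span adds nothing). -/
def tangentSpaceAt {m : ℕ} (N : Set (E m)) (p : E m) : Submodule ℝ (E m) :=
  Submodule.span ℝ {v | ∃ γ : ℝ → E m,
    ContDiffAt ℝ ∞ γ 0 ∧ γ 0 = p ∧ (∀ᶠ t in 𝓝 0, γ t ∈ N) ∧ deriv γ 0 = v}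

/-- The extrinsic energy `∫ |Δ v|²`. -/
def extEnergy {m : ℕ} (v : E 4 → E m) : ℝ := ∫ x, ‖weakLaplacian v x‖ ^ 2 ∂muB

/-- The intrinsic energy `∫ |(Δ v)^T|²`, where `(Δ v)^T` is the orthogonal projection of `Δ v` to
the tangent space of `N` at `v`. -/
def intEnergy {m : ℕ} (N : Set (E m)) (v : E 4 → E m) : ℝ :=
  ∫ x, ‖(tangentSpaceAt N (v x)).starProjection (weakLaplacian v x)‖ ^ 2 ∂muB

/-- The space `W^{2,2}` of maps from the ball to `N`. -/
def MemW22Into {m : ℕ} (N : Set (E m)) (u : E 4 → E m) : Prop :=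
  MemW22 u ∧ ∀ᵐ x ∂muB, u x ∈ N

/-- `p` is a point of `N` nearest to `y`. -/
def IsNearestPoint {m : ℕ} (N : Set (E m)) (y p : E m) : Prop :=
  p ∈ N ∧ ∀ q ∈ N, dist y p ≤ dist y q

/-- `u` is a critical point of the functional `J` among maps to `N`: for each smooth compactly
supported `φ` the derivative at `t = 0` of `J (π (u + t φ))` vanishes, where `π` is the
nearest point projection to `N` (for compact smooth `N` it is single-valued for small `t`). -/
def IsCriticalPoint {m : ℕ} (N : Set (E m)) (J : (E 4 → E m) → ℝ) (u : E 4 → E m) : Prop :=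
  ∀ φ : E 4 → E m, IsTest φ → ∀ v : ℝ → E 4 → E m,
    (∀ t, ∀ᵐ x ∂muB, IsNearestPoint N (u x + t • φ x) (v t x)) →
    HasDerivAt (fun t => J (v t)) 0 0

/-! ### The fourth order system -/

/-- The class of potentials: `V` is in `W^{1,2}`, `w` is in `L²`, and `W` is an element of
`W^{-1,2}` of the form `∇om + F` (as distributions) with `om` in `L²`, antisymmetric, and `F` in
`L² · W^{1,2}`. The index `k` is the one of the vector field, `i` and `j` are those of the matrix. -/
structure IsAdmissible {m : ℕ} (V : Fin 4 → E 4 → Matrix (Fin m) (Fin m) ℝ)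
    (w : E 4 → Matrix (Fin m) (Fin m) ℝ)
    (W : Fin 4 → Fin m → Fin m → (E 4 → ℝ) → ℝ) : Prop where
  memV : ∀ k i j, MemW12 fun x => V k x i j
  mem_w : ∀ i j, MemL2 fun x => w x i j
  memW : ∀ k i j, MemWneg12 (W k i j)
  decomp : ∃ (om : E 4 → Matrix (Fin m) (Fin m) ℝ) (F : Fin 4 → E 4 → Matrix (Fin m) (Fin m) ℝ),
    (∀ i j, MemL2 fun x => om x i j) ∧ (∀ᵐ x ∂muB, (om x).transpose = - om x) ∧
    (∀ k i j, MemL2W12 fun x => F k x i j) ∧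
    ∀ k i j, ∀ φ : E 4 → ℝ, IsTest φ →
      W k i j φ = - ∫ x, om x i j * partialD k φ x ∂muB + ∫ x, F k x i j * φ x ∂muB

/-- `u` is a solution of `Δ² u = Δ (V · ∇u) + div (w ∇u) + W · ∇u` in the sense of distributions.
The distribution `W · ∇u` sends `φ` to the value of `W` at `φ ∇u`, which is in `W_0^{1,2}`. -/
def IsSolution {m : ℕ} (V : Fin 4 → E 4 → Matrix (Fin m) (Fin m) ℝ)
    (w : E 4 → Matrix (Fin m) (Fin m) ℝ)
    (W : Fin 4 → Fin m → Fin m → (E 4 → ℝ) → ℝ) (u : E 4 → E m) : Prop :=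
  ∀ (i : Fin m) (φ : E 4 → ℝ), IsTest φ →
    ∫ x, u x i * (Δ (Δ φ)) x ∂muB =
      ∫ x, (∑ k, ∑ j, V k x i j * weakPartial k u x j) * (Δ φ) x ∂muB
      - ∫ x, ∑ k, (∑ j, w x i j * weakPartial k u x j) * partialD k φ x ∂muB
      + ∑ k, ∑ j, W k i j (fun x => φ x * weakPartial k u x j)

end Biharmonic

end

noncomputable section

set_option linter.unusedSectionVars false

namespace Biharmonic

/-! Let `Q` be the nearest point projection, cut off away from `N`, and put P = dQ(u), which almost
everywhere is the orthogonal projection to the tangent space at u. Write L = Δu, A_k = ∂_k P =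
D²Q(u)(∂_k u), R = ΔP and H = Σ A_k ∂_k u. Differentiating Q(u) = u once and twice gives P ∂_k u =
∂_k u and L = PL + H. So H is the normal part of L, and it already has the form V·∇u with V_k = A_k.

The first variation of Δ(Q(u + tφ)) is Δ(Pφ) = Rφ + PΔφ + 2 Σ A_k ∂_kφ, and criticality for the
extrinsic energy says ∫⟨L, Δ(Pφ)⟩ = 0. Here PL = L − H produces Δ²u − Δ(V·∇u). The terms with ∂_kφ
produce a divergence, linear in ∇u because A_k = D²Q(u)(∂_k u). What remains is RL, a product of two
factors that are only in L².

The structure comes from P² = P. Differentiated twice it reads R = RP + PR + 2 Σ A_k². With PL = L −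
H this gives RL = [R,P]L + 2RH − 2 Σ A_k² L. Since R and P are symmetric, ω = [R,P] is
antisymmetric, and −ωΔu = −div(ω∇u) + ∇ω·∇u: the first term is absorbed in w, the second is the main
part of W·∇u. The other terms contain an L² factor, a factor A_k in W^{1,2} and a factor ∇u, hence
form F·∇u. For the intrinsic energy L is replaced by L − H in the pairing with Δ(Pφ), and ∫⟨L,
(∂_{Pφ}P)H⟩ is added. These changes again involve H = Σ A_k ∂_k u and go to w and F, so a parameter
σ ∈ {0, 1} treats both energies at once. This computation is `euler_lagrange_algebra`.

The analysis rests on the embedding W^{1,2} ⊂ L⁴ in dimension four (`sobolev_four`). It puts ∇u in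
L⁴, hence A_k in W^{1,2} and R in L²; it allows differentiation of the energy under the integral
(`hasDerivAt_integral_quad`); and it makes W bounded on W_0^{1,2} (`memWneg12_of_memL2`). The
constraint identities are differentiated almost everywhere by the weak product and chain rules
(`hasWeakPartial_bilin`, `hasWeakPartial_comp`) and uniqueness of weak derivatives. The map `Q`
comes from `exists_projection`. -/

instance : IsFiniteMeasure muB := by
  refine ⟨?_⟩
  rw [muB, Measure.restrict_apply_univ]
  exact measure_ball_lt_top

lemma isOpen_B4 : IsOpen B4 := Metric.isOpen_ball

lemma measurableSet_B4 : MeasurableSet B4 := isOpen_B4.measurableSet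

/-! ### Test functions and elementary calculus of weak derivatives -/

section Basic

variable {G : Type*} [NormedAddCommGroup G] [NormedSpace ℝ G]

lemma IsTest.differentiable {φ : E 4 → G} (h : IsTest φ) : Differentiable ℝ φ :=
  h.smooth.differentiable (by simp)

lemma IsTest.continuous {φ : E 4 → G} (h : IsTest φ) : Continuous φ := h.smooth.continuous

lemma IsTest.bounded {φ : E 4 → G} (h : IsTest φ) : ∃ C, 0 ≤ C ∧ ∀ x, ‖φ x‖ ≤ C := by
  obtain ⟨C, hC⟩ := h.continuous.bounded_above_of_compact_support h.compact
  exact ⟨C, (norm_nonneg _).trans (hC 0), hC⟩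

lemma IsTest.of_support_subset {H : Type*} [NormedAddCommGroup H] [NormedSpace ℝ H] {φ : E 4 → H}
    {ψ : E 4 → G} (h : IsTest φ)
    (hs : ContDiff ℝ ∞ ψ) (hψ : Function.support ψ ⊆ tsupport φ) : IsTest ψ := by
  have h1 : tsupport ψ ⊆ tsupport φ := closure_minimal hψ (isClosed_tsupport φ)
  exact ⟨hs, h.compact.of_isClosed_subset (isClosed_tsupport _) h1, h1.trans h.support⟩

lemma support_fderiv_apply_subset {φ : E 4 → G} (v : E 4) :
    Function.support (fun x => fderiv ℝ φ x v) ⊆ tsupport φ := by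
  intro x hx
  refine support_fderiv_subset ℝ (f := φ) ?_
  intro h
  exact hx (by simp [h])

lemma IsTest.fderiv_apply {φ : E 4 → G} (h : IsTest φ) (v : E 4) :
    IsTest (fun x => fderiv ℝ φ x v) :=
  h.of_support_subset ((h.smooth.fderiv_right (m := ∞) (by simp)).clm_apply contDiff_const)
    (support_fderiv_apply_subset v)

lemma IsTest.partialD {φ : E 4 → ℝ} (h : IsTest φ) (k : Fin 4) : IsTest (partialD k φ) :=
  h.fderiv_apply (e k)

lemma laplacian_eq_sum {φ : E 4 → ℝ} (h : ContDiff ℝ 2 φ) (x : E 4) :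
    (Δ φ) x = ∑ k, partialD k (partialD k φ) x := by
  rw [InnerProductSpace.laplacian_eq_iteratedFDeriv_orthonormalBasis φ
    (EuclideanSpace.basisFun (Fin 4) ℝ)]
  refine Finset.sum_congr rfl fun k _ => ?_
  rw [iteratedFDeriv_two_apply]
  have h2 : DifferentiableAt ℝ (fderiv ℝ φ) x :=
    ((h.fderiv_right (m := 1) (by norm_num)).differentiable (by simp)) x
  unfold partialD
  rw [fderiv_clm_apply h2 (differentiableAt_const _)]
  simp [e]

lemma IsTest.laplacian {φ : E 4 → ℝ} (h : IsTest φ) : IsTest (Δ φ) := by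
  have h2 : Δ φ = fun x => ∑ k, Biharmonic.partialD k (Biharmonic.partialD k φ) x :=
    funext fun x => laplacian_eq_sum (contDiff_infty.1 h.smooth 2) x
  refine h.of_support_subset ?_ ?_
  · rw [h2]
    exact ContDiff.sum fun k _ => ((h.partialD k).partialD k).smooth
  · rw [h2]
    intro x hx
    by_contra hn
    refine hx (Finset.sum_eq_zero fun k _ => ?_)
    by_contra hk
    have : x ∈ tsupport (Biharmonic.partialD k φ) := support_fderiv_apply_subset (e k) hk
    exact hn (closure_minimal (support_fderiv_apply_subset (φ := φ) (e k)) (isClosed_tsupport _)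
      this)

lemma IsTest.integrable_smul {φ : E 4 → ℝ} (h : IsTest φ) {f : E 4 → G}
    (hf : LocallyIntegrableOn f B4 volume) : Integrable (fun x => φ x • f x) muB := by
  have h1 : IntegrableOn f (tsupport φ) volume := hf.integrableOn_compact_subset h.support h.compact
  have h2 : IntegrableOn (fun x => φ x • f x) (tsupport φ) volume :=
    h1.continuousOn_smul h.continuous.continuousOn h.compact
  have h3 : Integrable (fun x => φ x • f x) volume := by
    rw [← integrableOn_iff_integrable_of_support_subset (s := tsupport φ)]
    · exact h2
    · intro x hx
      refine subset_tsupport φ ?_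
      intro h0
      exact hx (by simp [h0])
  exact h3.restrict

lemma integral_muB_of_support {f : E 4 → G} (h : Function.support f ⊆ B4) :
    ∫ x, f x ∂muB = ∫ x, f x :=
  setIntegral_eq_integral_of_forall_compl_eq_zero fun x hx => by
    by_contra h0
    exact hx (h h0)

lemma IsTest.support_smul {φ : E 4 → ℝ} (h : IsTest φ) (f : E 4 → G) :
    Function.support (fun x => φ x • f x) ⊆ B4 := by
  intro x hx
  refine h.support (subset_tsupport φ ?_)
  intro h0
  exact hx (by simp [h0])

lemma locallyIntegrableOn_congr {f g : E 4 → G} (h : f =ᵐ[muB] g)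
    (hf : LocallyIntegrableOn f B4 volume) : LocallyIntegrableOn g B4 volume := by
  intro x hx
  obtain ⟨t, ht, hft⟩ := hf x hx
  refine ⟨t ∩ B4, inter_mem ht self_mem_nhdsWithin, ?_⟩
  refine (hft.mono_set Set.inter_subset_left).congr ?_
  exact ae_restrict_of_ae_restrict_of_subset Set.inter_subset_right h

lemma MemL2.locallyIntegrableOn {f : E 4 → G} (h : MemL2 f) : LocallyIntegrableOn f B4 volume :=
  IntegrableOn.locallyIntegrableOn (show IntegrableOn f B4 volume from
    MemLp.integrable (μ := muB) (q := 2) (by norm_num) h)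

/-- The fundamental lemma of the calculus of variations. The uniqueness of weak derivatives that it
gives is the later tool for differentiating constraints: compute the weak derivative of both sides
of an a.e. identity and compare. -/
lemma ae_eq_of_integral_test [CompleteSpace G] {f g : E 4 → G}
    (hf : LocallyIntegrableOn f B4 volume)
    (hg : LocallyIntegrableOn g B4 volume)
    (h : ∀ φ : E 4 → ℝ, IsTest φ → ∫ x, φ x • f x ∂muB = ∫ x, φ x • g x ∂muB) : f =ᵐ[muB] g := by
  have h1 : ∀ᵐ x, x ∈ B4 → (f - g) x = 0 := by
    refine isOpen_B4.ae_eq_zero_of_integral_contDiff_smul_eq_zero (hf.sub hg) ?_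
    intro φ h1 h2 h3
    have ht : IsTest φ := ⟨h1, h2, h3⟩
    rw [← integral_muB_of_support (ht.support_smul _)]
    have := h φ ht
    simp only [Pi.sub_apply, smul_sub]
    rw [integral_sub (ht.integrable_smul hf) (ht.integrable_smul hg), this, sub_self]
  rw [muB]
  refine (ae_restrict_iff' measurableSet_B4).2 ?_
  filter_upwards [h1] with x hx hxB
  exact sub_eq_zero.1 (hx hxB)

lemma HasWeakPartial.congr {k : Fin 4} {f g f' g' : E 4 → G} (h : HasWeakPartial k f g)
    (hf : f =ᵐ[muB] f') (hg : g =ᵐ[muB] g') : HasWeakPartial k f' g' := by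
  refine ⟨locallyIntegrableOn_congr hf h.1, locallyIntegrableOn_congr hg h.2, fun φ hφ => ?_⟩
  have h1 : ∫ x, Biharmonic.partialD k φ x • f' x ∂muB
      = ∫ x, Biharmonic.partialD k φ x • f x ∂muB :=
    integral_congr_ae (by filter_upwards [hf] with x hx; rw [hx])
  have h2 : ∫ x, φ x • g' x ∂muB = ∫ x, φ x • g x ∂muB :=
    integral_congr_ae (by filter_upwards [hg] with x hx; rw [hx])
  rw [h1, h2, h.eq φ hφ]

lemma HasWeakPartial.unique [CompleteSpace G] {k : Fin 4} {f g g' : E 4 → G}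
    (h : HasWeakPartial k f g) (h' : HasWeakPartial k f g') : g =ᵐ[muB] g' :=
  ae_eq_of_integral_test h.2 h'.2 fun φ hφ => by
    rw [← neg_inj, ← h.eq φ hφ, ← h'.eq φ hφ]

lemma HasWeakPartial.weakPartial {k : Fin 4} {f g : E 4 → G} (h : HasWeakPartial k f g) :
    HasWeakPartial k f (weakPartial k f) := by
  have hex : ∃ g, HasWeakPartial k f g := ⟨g, h⟩
  unfold Biharmonic.weakPartial
  rw [dif_pos hex]
  exact hex.choose_spec

lemma HasWeakPartial.weakPartial_ae [CompleteSpace G] {k : Fin 4} {f g : E 4 → G}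
    (h : HasWeakPartial k f g) : Biharmonic.weakPartial k f =ᵐ[muB] g :=
  h.weakPartial.unique h

lemma HasWeakLaplacian.congr {f g f' g' : E 4 → G} (h : HasWeakLaplacian f g)
    (hf : f =ᵐ[muB] f') (hg : g =ᵐ[muB] g') : HasWeakLaplacian f' g' := by
  refine ⟨locallyIntegrableOn_congr hf h.1, locallyIntegrableOn_congr hg h.2, fun φ hφ => ?_⟩
  have h1 : ∫ x, (Δ φ) x • f' x ∂muB = ∫ x, (Δ φ) x • f x ∂muB :=
    integral_congr_ae (by filter_upwards [hf] with x hx; rw [hx])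
  have h2 : ∫ x, φ x • g' x ∂muB = ∫ x, φ x • g x ∂muB :=
    integral_congr_ae (by filter_upwards [hg] with x hx; rw [hx])
  rw [h1, h2, h.eq φ hφ]

lemma HasWeakLaplacian.unique [CompleteSpace G] {f g g' : E 4 → G}
    (h : HasWeakLaplacian f g) (h' : HasWeakLaplacian f g') : g =ᵐ[muB] g' :=
  ae_eq_of_integral_test h.2 h'.2 fun φ hφ => by
    rw [← h.eq φ hφ, ← h'.eq φ hφ]

lemma HasWeakLaplacian.weakLaplacian_ae [CompleteSpace G] {f g : E 4 → G}
    (h : HasWeakLaplacian f g) : weakLaplacian f =ᵐ[muB] g := by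
  have hex : ∃ g, HasWeakLaplacian f g := ⟨g, h⟩
  refine HasWeakLaplacian.unique (f := f) ?_ h
  unfold Biharmonic.weakLaplacian
  rw [dif_pos hex]
  exact hex.choose_spec

lemma HasWeakPartial.add {k : Fin 4} {f g f' g' : E 4 → G} (h : HasWeakPartial k f g)
    (h' : HasWeakPartial k f' g') : HasWeakPartial k (fun x => f x + f' x)
      (fun x => g x + g' x) := by
  refine ⟨h.1.add h'.1, h.2.add h'.2, fun φ hφ => ?_⟩
  simp only [smul_add]
  rw [integral_add ((hφ.partialD k).integrable_smul h.1) ((hφ.partialD k).integrable_smul h'.1),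
    integral_add (hφ.integrable_smul h.2) (hφ.integrable_smul h'.2), h.eq φ hφ, h'.eq φ hφ]
  abel

lemma HasWeakPartial.clm {G' : Type*} [NormedAddCommGroup G'] [NormedSpace ℝ G']
    [CompleteSpace G] [CompleteSpace G'] {k : Fin 4} {f g : E 4 → G} (h : HasWeakPartial k f g)
    (L : G →L[ℝ] G') : HasWeakPartial k (fun x => L (f x)) (fun x => L (g x)) := by
  have hL : ∀ {f : E 4 → G}, LocallyIntegrableOn f B4 volume →
      LocallyIntegrableOn (fun x => L (f x)) B4 volume := by
    intro f hf x hx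
    obtain ⟨t, ht, hft⟩ := hf x hx
    exact ⟨t, ht, L.integrable_comp hft⟩
  refine ⟨hL h.1, hL h.2, fun φ hφ => ?_⟩
  simp only [← map_smul]
  rw [L.integral_comp_comm ((hφ.partialD k).integrable_smul h.1),
    L.integral_comp_comm (hφ.integrable_smul h.2), h.eq φ hφ, map_neg]

lemma HasWeakPartial.const_smul [CompleteSpace G] {k : Fin 4} {f g : E 4 → G}
    (h : HasWeakPartial k f g)
    (c : ℝ) : HasWeakPartial k (fun x => c • f x) (fun x => c • g x) :=
  h.clm (c • ContinuousLinearMap.id ℝ G)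

lemma HasWeakPartial.coord {m : ℕ} {k : Fin 4} {f g : E 4 → E m} (h : HasWeakPartial k f g)
    (i : Fin m) : HasWeakPartial k (fun x => f x i) (fun x => g x i) :=
  h.clm (EuclideanSpace.proj i : E m →L[ℝ] ℝ)

lemma sum_coord_smul {m : ℕ} (v : E m) :
    ∑ i, v i • (EuclideanSpace.single i (1 : ℝ) : E m) = v := by
  ext j
  simp [Finset.sum_apply, Pi.single_apply]

lemma integral_smul_fderiv_test {φ : E 4 → ℝ} (hφ : IsTest φ) {f : E 4 → G}
    (hf : ContDiff ℝ 1 f) (v : E 4) :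
    ∫ x, fderiv ℝ φ x v • f x = - ∫ x, φ x • fderiv ℝ f x v := by
  have hfd : Continuous (fun x => fderiv ℝ f x v) :=
    (hf.continuous_fderiv (by simp)).clm_apply continuous_const
  have key := integral_smul_fderiv_eq_neg_fderiv_smul_of_integrable (μ := (volume : Measure (E 4)))
    (f := φ) (g := f) (v := v) ?_ ?_ ?_ (fun x _ => hφ.differentiable x)
    (fun x _ => (hf.differentiable (by simp)) x)
  · rw [key, neg_neg]
  · exact ((hφ.fderiv_apply v).continuous.smul hf.continuous).integrable_of_hasCompactSupport
      (hφ.fderiv_apply v).compact.smul_right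
  · exact (hφ.continuous.smul hfd).integrable_of_hasCompactSupport hφ.compact.smul_right
  · exact (hφ.continuous.smul hf.continuous).integrable_of_hasCompactSupport
      hφ.compact.smul_right

lemma hasWeakPartial_of_contDiff {f : E 4 → G} (hf : ContDiff ℝ 1 f) (k : Fin 4) :
    HasWeakPartial k f (fun x => fderiv ℝ f x (e k)) := by
  have hfd : Continuous (fun x => fderiv ℝ f x (e k)) :=
    (hf.continuous_fderiv (by simp)).clm_apply continuous_const
  refine ⟨hf.continuous.locallyIntegrable.locallyIntegrableOn _,
    hfd.locallyIntegrable.locallyIntegrableOn _, fun φ hφ => ?_⟩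
  rw [integral_muB_of_support ((hφ.partialD k).support_smul _),
    integral_muB_of_support (hφ.support_smul _)]
  exact integral_smul_fderiv_test hφ hf (e k)

lemma locallyIntegrableOn_sum {ι : Type*} (s : Finset ι) {f : ι → E 4 → G}
    (h : ∀ i ∈ s, LocallyIntegrableOn (f i) B4 volume) :
    LocallyIntegrableOn (fun x => ∑ i ∈ s, f i x) B4 volume := by
  classical
  induction s using Finset.induction_on with
  | empty => simpa using (locallyIntegrable_const (0 : G)).locallyIntegrableOn B4
  | insert a s ha ih =>
    simp only [Finset.sum_insert ha]
    exact (h a (Finset.mem_insert_self a s)).add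
      (ih fun i hi => h i (Finset.mem_insert_of_mem hi))

lemma hasWeakLaplacian_of_partials {f : E 4 → G} {g h : Fin 4 → E 4 → G}
    (h1 : ∀ k, HasWeakPartial k f (g k)) (h2 : ∀ k, HasWeakPartial k (g k) (h k)) :
    HasWeakLaplacian f (fun x => ∑ k, h k x) := by
  refine ⟨(h1 0).1, locallyIntegrableOn_sum _ fun k _ => (h2 k).2, fun φ hφ => ?_⟩
  have h3 : ∀ x, (Δ φ) x = ∑ k, partialD k (partialD k φ) x :=
    fun x => laplacian_eq_sum (contDiff_infty.1 hφ.smooth 2) x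
  simp only [h3, Finset.sum_smul, Finset.smul_sum]
  rw [integral_finsetSum _ fun k _ => ((hφ.partialD k).partialD k).integrable_smul (h1 k).1,
    integral_finsetSum _ fun k _ => hφ.integrable_smul (h2 k).2]
  refine Finset.sum_congr rfl fun k _ => ?_
  rw [(h1 k).eq _ (hφ.partialD k), (h2 k).eq _ hφ, neg_neg]

lemma locallyIntegrableOn_smul_of_continuous {φ : E 4 → ℝ} (hφ : Continuous φ) {f : E 4 → G}
    (hf : LocallyIntegrableOn f B4 volume) :
    LocallyIntegrableOn (fun x => φ x • f x) B4 volume :=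
  hf.continuousOn_smul isOpen_B4.isLocallyClosed hφ.continuousOn

lemma IsTest.mul {φ ψ : E 4 → ℝ} (hφ : IsTest φ) (hψ : ContDiff ℝ ∞ ψ) :
    IsTest (fun x => φ x * ψ x) :=
  hφ.of_support_subset (hφ.smooth.mul hψ) fun x hx => subset_tsupport φ fun h0 => hx (by simp [h0])

lemma partialD_mul {φ ψ : E 4 → ℝ} {x : E 4} (hφ : DifferentiableAt ℝ φ x)
    (hψ : DifferentiableAt ℝ ψ x) (k : Fin 4) :
    partialD k (fun y => φ y * ψ y) x = partialD k φ x * ψ x + φ x * partialD k ψ x := by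
  unfold partialD
  rw [fderiv_fun_mul hφ hψ]
  simp
  ring

/-- The product of a test function with ψ is again a test function, so the definition of the weak
derivative of f can be applied to it directly. Needed for the functions ϕ ∂_k u on which W is
evaluated. -/
lemma HasWeakPartial.test_smul {k : Fin 4} {f g : E 4 → G} (h : HasWeakPartial k f g)
    {ψ : E 4 → ℝ} (hψ : ContDiff ℝ ∞ ψ) :
    HasWeakPartial k (fun x => ψ x • f x) (fun x => partialD k ψ x • f x + ψ x • g x) := by
  have hd : Continuous (Biharmonic.partialD k ψ) :=
    (hψ.continuous_fderiv (by simp)).clm_apply continuous_const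
  have i1 := locallyIntegrableOn_smul_of_continuous hψ.continuous h.1
  have i2 := locallyIntegrableOn_smul_of_continuous hd h.1
  have i3 := locallyIntegrableOn_smul_of_continuous hψ.continuous h.2
  refine ⟨i1, i2.add i3, fun φ hφ => ?_⟩
  have key := h.eq _ (hφ.mul hψ)
  have hdiff : Differentiable ℝ ψ := hψ.differentiable (by simp)
  simp only [partialD_mul (hφ.differentiable _) (hdiff _), add_smul, mul_smul] at key
  rw [integral_add ((hφ.partialD k).integrable_smul i1) (hφ.integrable_smul i2)] at key
  simp only [smul_add]
  rw [integral_add (hφ.integrable_smul i2) (hφ.integrable_smul i3), neg_add, ← key]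
  abel

end Basic

/-! ### Mollification and smooth approximation in L² -/

section Mollify

open scoped ENNReal Convolution
open ContinuousLinearMap (lsmul)

variable {G : Type*} [NormedAddCommGroup G] [NormedSpace ℝ G] [CompleteSpace G]

/-- Precomposition with a measure preserving map acts continuously on L² also as a function of the
map, in the compact-open topology, and translations depend continuously on the vector. -/
lemma tendsto_eLpNorm_translate {F : E 4 → G} (hF : MemLp F 2 volume) :
    Tendsto (fun t : E 4 => eLpNorm (fun x => F (x - t) - F x) 2 volume) (𝓝 0) (𝓝 0) := by
  have : Fact ((1 : ℝ≥0∞) ≤ 2) := ⟨by norm_num⟩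
  let g : E 4 → C(E 4, E 4) := fun t => ⟨fun x => x - t, by fun_prop⟩
  have hg : Continuous g := by
    refine ContinuousMap.continuous_of_continuous_uncurry _ ?_
    exact (continuous_snd.sub continuous_fst)
  have hmp : ∀ t, MeasurePreserving (g t) (volume : Measure (E 4)) volume :=
    fun t => measurePreserving_sub_right volume t
  have h0 : Tendsto (fun t => Lp.compMeasurePreserving (g t) (hmp t) (hF.toLp F)) (𝓝 0)
      (𝓝 (Lp.compMeasurePreserving (g 0) (hmp 0) (hF.toLp F))) :=
    Filter.Tendsto.compMeasurePreservingLp tendsto_const_nhds (hg.tendsto 0) _ _ (by norm_num)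
  have h1 : Lp.compMeasurePreserving (g 0) (hmp 0) (hF.toLp F) = hF.toLp F := by
    rw [Lp.toLp_compMeasurePreserving]
    congr 1
    ext x
    simp [g]
  rw [h1, tendsto_iff_edist_tendsto_0] at h0
  refine h0.congr fun t => ?_
  rw [Lp.toLp_compMeasurePreserving, Lp.edist_toLp_toLp]
  rfl

lemma lintegral_sq_le_of_prob {σ : Measure (E 4)} [IsProbabilityMeasure σ] {h : E 4 → ℝ≥0∞}
    (hh : AEMeasurable h σ) : (∫⁻ t, h t ∂σ) ^ 2 ≤ ∫⁻ t, h t ^ 2 ∂σ := by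
  have h1 := ENNReal.lintegral_mul_le_Lp_mul_Lq σ Real.HolderConjugate.two_two hh
    (aemeasurable_const (b := (1 : ℝ≥0∞)))
  simp only [Pi.mul_apply, mul_one, ENNReal.one_rpow, lintegral_const, measure_univ] at h1
  calc (∫⁻ t, h t ∂σ) ^ 2 ≤ ((∫⁻ t, h t ^ (2 : ℝ) ∂σ) ^ (1 / 2 : ℝ)) ^ 2 := by gcongr
    _ = ∫⁻ t, h t ^ 2 ∂σ := by
      rw [← ENNReal.rpow_natCast, ← ENNReal.rpow_mul]
      norm_num

lemma eLpNorm_two_sq {α : Type*} [MeasurableSpace α] {μ : Measure α} {F : Type*}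
    [NormedAddCommGroup F] (f : α → F) :
    eLpNorm f 2 μ ^ 2 = ∫⁻ x, ‖f x‖ₑ ^ 2 ∂μ := by
  rw [eLpNorm_eq_lintegral_rpow_enorm_toReal (by norm_num) (by norm_num), ← ENNReal.rpow_natCast,
    ← ENNReal.rpow_mul]
  norm_num

/-- The difference is the average of F(x − t) − F(x) for the probability measure whose density is
the bump. Cauchy–Schwarz moves the square inside the average, and Tonelli leaves an average of
squared translation errors. -/
lemma eLpNorm_mollify_sub_le {F : E 4 → G} (hF : MemLp F 2 volume) {ε : ℝ≥0∞} {δ : ℝ}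
    (hδ : ∀ t : E 4, ‖t‖ < δ → eLpNorm (fun x => F (x - t) - F x) 2 volume ≤ ε)
    (ρ : ContDiffBump (0 : E 4)) (hρ : ρ.rOut ≤ δ) :
    eLpNorm (fun x => (ρ.normed volume ⋆[lsmul ℝ ℝ, volume] F) x - F x) 2 volume ≤ ε := by
  -- Tonelli needs joint measurability of (x, t) ↦ F(x − t), which holds for a strongly measurable
  -- representative; changing F on a null set affects none of the norms.
  wlog hs : StronglyMeasurable F generalizing F
  · have hae : F =ᵐ[volume] hF.1.mk F := hF.1.ae_eq_mk
    have hF' : MemLp (hF.1.mk F) 2 volume := hF.ae_eq hae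
    have h2 := this hF' (fun t ht => ?_) hF.1.stronglyMeasurable_mk
    · refine le_trans (le_of_eq (eLpNorm_congr_ae ?_)) h2
      filter_upwards [hae] with x hx
      rw [hx, convolution_congr _ (Filter.EventuallyEq.rfl) hae]
    · refine le_trans (le_of_eq (eLpNorm_congr_ae ?_)) (hδ t ht)
      have h3 := (measurePreserving_sub_right (volume : Measure (E 4)) t).quasiMeasurePreserving.ae
        hae
      filter_upwards [hae, h3] with x hx hx'
      rw [hx, hx']
  set r : E 4 → ℝ≥0∞ := fun t => ENNReal.ofReal (ρ.normed volume t) with hr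
  have hrm : Measurable r := (ρ.continuous_normed.measurable).ennreal_ofReal
  set σ : Measure (E 4) := volume.withDensity r with hσ
  have : IsProbabilityMeasure σ := ⟨by
    rw [hσ, withDensity_apply _ MeasurableSet.univ, Measure.restrict_univ,
      ← ofReal_integral_eq_lintegral_ofReal ρ.integrable_normed
        (Eventually.of_forall ρ.nonneg_normed), ρ.integral_normed, ENNReal.ofReal_one]⟩
  have hloc : LocallyIntegrable F volume := hF.locallyIntegrable (by norm_num)
  have hex : ConvolutionExists (ρ.normed volume) F (lsmul ℝ ℝ) volume :=
    ρ.hasCompactSupport_normed.convolutionExists_left _ ρ.continuous_normed hloc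
  have hpt : ∀ x, ‖(ρ.normed volume ⋆[lsmul ℝ ℝ, volume] F) x - F x‖ₑ ≤
      ∫⁻ t, ‖F (x - t) - F x‖ₑ ∂σ := by
    intro x
    have h1 : (ρ.normed volume ⋆[lsmul ℝ ℝ, volume] F) x - F x =
        ∫ t, ρ.normed volume t • (F (x - t) - F x) := by
      simp only [smul_sub]
      have hx : Integrable (fun t => ρ.normed volume t • F (x - t)) volume := hex x
      rw [integral_sub hx (ρ.integrable_normed.smul_const _), integral_smul_const,
        ρ.integral_normed, one_smul]
      rfl
    rw [h1]
    refine (enorm_integral_le_lintegral_enorm _).trans (le_of_eq ?_)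
    rw [hσ, lintegral_withDensity_eq_lintegral_mul _ hrm]
    · refine lintegral_congr fun t => ?_
      rw [enorm_smul, Pi.mul_apply, Real.enorm_of_nonneg (ρ.nonneg_normed t)]
    · exact ((hs.comp_measurable (measurable_const.sub measurable_id)).sub
        stronglyMeasurable_const).enorm
  have hm2 : Measurable (fun p : E 4 × E 4 => ‖F (p.1 - p.2) - F p.1‖ₑ ^ 2) :=
    (((hs.comp_measurable (measurable_fst.sub measurable_snd)).sub
        (hs.comp_measurable measurable_fst)).enorm).pow_const 2
  have hae : ∀ᵐ t ∂σ, ‖t‖ < δ := by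
    rw [hσ, ae_withDensity_iff hrm]
    refine Eventually.of_forall fun t ht => ?_
    have h3 : t ∈ Function.support (ρ.normed (volume : Measure (E 4))) := by
      intro h0
      exact ht (by simp [hr, h0])
    rw [ρ.support_normed_eq, mem_ball_zero_iff] at h3
    exact h3.trans_le hρ
  rw [← ENNReal.pow_le_pow_left_iff (two_ne_zero), eLpNorm_two_sq]
  calc ∫⁻ x, ‖(ρ.normed volume ⋆[lsmul ℝ ℝ, volume] F) x - F x‖ₑ ^ 2
      ≤ ∫⁻ x, (∫⁻ t, ‖F (x - t) - F x‖ₑ ^ 2 ∂σ) ∂volume := by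
        refine lintegral_mono fun x => ?_
        refine le_trans (pow_le_pow_left' (hpt x) 2) (lintegral_sq_le_of_prob ?_)
        exact ((hs.comp_measurable (measurable_const.sub measurable_id)).sub
          stronglyMeasurable_const).enorm.aemeasurable
    _ = ∫⁻ t, (∫⁻ x, ‖F (x - t) - F x‖ₑ ^ 2) ∂σ := lintegral_lintegral_swap hm2.aemeasurable
    _ ≤ ∫⁻ t, ε ^ 2 ∂σ := by
        refine lintegral_mono_ae ?_
        filter_upwards [hae] with t ht
        rw [← eLpNorm_two_sq]
        exact pow_le_pow_left' (hδ t ht) 2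
    _ = ε ^ 2 := by simp

/-- Extension by zero may create a singular derivative on the sphere, so x has to be further from it
than the radius of the bump. Then s ↦ ρ(x − s) is a test function, and the weak derivative of f can
be tested against it. -/
lemma fderiv_mollify {f g : E 4 → G} {k : Fin 4} (h : HasWeakPartial k f g) (hf : MemL2 f)
    (ρ : ContDiffBump (0 : E 4)) {x : E 4} (hx : ‖x‖ + ρ.rOut < 1) :
    fderiv ℝ (ρ.normed volume ⋆[lsmul ℝ ℝ, volume] B4.indicator f) x (e k) =
      (ρ.normed volume ⋆[lsmul ℝ ℝ, volume] B4.indicator g) x := by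
  set φ := ρ.normed (volume : Measure (E 4)) with hφ
  have hsm : ContDiff ℝ ∞ φ := ρ.contDiff_normed
  have hc : HasCompactSupport φ := ρ.hasCompactSupport_normed
  have hF : MemLp (B4.indicator f) 2 volume := (memLp_indicator_iff_restrict measurableSet_B4).2 hf
  have hloc : LocallyIntegrable (B4.indicator f) volume := hF.locallyIntegrable (by norm_num)
  have hpre : (fderiv ℝ φ ⋆[(lsmul ℝ ℝ).precompL (E 4), volume] B4.indicator f) x (e k) =
      ((fun t => fderiv ℝ φ t (e k)) ⋆[lsmul ℝ ℝ, volume] B4.indicator f) x := by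
    have hex : ConvolutionExistsAt (fderiv ℝ φ) (B4.indicator f) x
        ((lsmul ℝ ℝ : ℝ →L[ℝ] G →L[ℝ] G).precompL (E 4)) volume :=
      (hc.fderiv ℝ).convolutionExists_left _ (hsm.continuous_fderiv (by simp)) hloc x
    simp only [convolution_def]
    rw [ContinuousLinearMap.integral_apply hex]
    rfl
  rw [(hc.hasFDerivAt_convolution_left (lsmul ℝ ℝ) (contDiff_infty.1 hsm 1) hloc x).fderiv, hpre]
  set ψ : E 4 → ℝ := fun s => φ (x - s) with hψ
  have hd : ∀ s, partialD k ψ s = - fderiv ℝ φ (x - s) (e k) := by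
    intro s
    have h1 : HasFDerivAt ψ ((fderiv ℝ φ (x - s)).comp (-ContinuousLinearMap.id ℝ (E 4))) s :=
      ((hsm.differentiable (by simp)) (x - s)).hasFDerivAt.comp s ((hasFDerivAt_id s).const_sub x)
    unfold partialD
    rw [h1.fderiv]
    simp
  have hsupp : tsupport ψ ⊆ Metric.closedBall x ρ.rOut := by
    refine closure_minimal ?_ Metric.isClosed_closedBall
    intro s hs
    have h2 : x - s ∈ Function.support φ := hs
    rw [hφ, ρ.support_normed_eq, mem_ball_zero_iff] at h2
    rw [Metric.mem_closedBall, dist_comm, dist_eq_norm]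
    exact h2.le
  have hψt : IsTest ψ := by
    refine ⟨hsm.comp (contDiff_const.sub contDiff_id), ?_, ?_⟩
    · exact (isCompact_closedBall x ρ.rOut).of_isClosed_subset (isClosed_tsupport _) hsupp
    · intro s hs
      have h3 := hsupp hs
      rw [Metric.mem_closedBall, dist_eq_norm] at h3
      rw [B4, mem_ball_zero_iff]
      calc ‖s‖ = ‖(s - x) + x‖ := by simp
        _ ≤ ‖s - x‖ + ‖x‖ := norm_add_le _ _
        _ < 1 := by linarith
  have hI : ∀ (w : E 4 → ℝ) (q : E 4 → G), ∫ s, w s • (B4.indicator q) s = ∫ s, w s • q s ∂muB := by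
    intro w q
    rw [muB, ← integral_indicator measurableSet_B4]
    refine integral_congr_ae (Eventually.of_forall fun s => ?_)
    by_cases hs : s ∈ B4 <;> simp [hs]
  have key := h.eq ψ hψt
  simp only [hd, neg_smul, integral_neg, neg_inj] at key
  rw [convolution_lsmul_swap, convolution_lsmul_swap, hI, hI]
  exact key

/-- Convergence is only claimed on a smaller ball, where mollification commutes with the
derivatives. This suffices for testing, since a compact support stays away from the sphere. -/
lemma exists_smooth_approx {f : E 4 → G} {g : Fin 4 → E 4 → G} (hf : MemL2 f)
    (h : ∀ k, HasWeakPartial k f (g k)) (hg : ∀ k, MemL2 (g k)) {r : ℝ} (hr : r < 1) :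
    ∃ F : ℕ → E 4 → G, (∀ n, ContDiff ℝ ∞ (F n)) ∧
      Tendsto (fun n => eLpNorm (fun x => F n x - f x) 2 (volume.restrict (Metric.ball 0 r))) atTop
        (𝓝 0) ∧
      ∀ k, Tendsto (fun n => eLpNorm (fun x => fderiv ℝ (F n) x (e k) - g k x) 2
        (volume.restrict (Metric.ball 0 r))) atTop (𝓝 0) := by
  have hsub : Metric.ball (0 : E 4) r ⊆ B4 := Metric.ball_subset_ball hr.le
  let ρ : ℕ → ContDiffBump (0 : E 4) := fun n =>
    ⟨1 / (2 * ((n : ℝ) + 1)), 1 / ((n : ℝ) + 1), by positivity, by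
      rw [div_lt_div_iff₀ (by positivity) (by positivity)]
      nlinarith [(Nat.cast_nonneg n : (0 : ℝ) ≤ n)]⟩
  have hρ : Tendsto (fun n => (ρ n).rOut) atTop (𝓝 0) := tendsto_one_div_add_atTop_nhds_zero_nat
  have hind : ∀ q : E 4 → G, MemL2 q → MemLp (B4.indicator q) 2 volume :=
    fun q hq => (memLp_indicator_iff_restrict measurableSet_B4).2 hq
  have conv : ∀ q : E 4 → G, MemL2 q → Tendsto (fun n => eLpNorm (fun x =>
      ((ρ n).normed volume ⋆[lsmul ℝ ℝ, volume] B4.indicator q) x - q x) 2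
      (volume.restrict (Metric.ball 0 r))) atTop (𝓝 0) := by
    intro q hq
    rw [ENNReal.tendsto_nhds_zero]
    intro ε hε
    have h1 := (ENNReal.tendsto_nhds_zero.1 (tendsto_eLpNorm_translate (hind q hq))) ε hε
    obtain ⟨δ, hδ, h2⟩ := Metric.eventually_nhds_iff.1 h1
    filter_upwards [hρ.eventually (ge_mem_nhds hδ)] with n hn
    refine le_trans ?_ (eLpNorm_mollify_sub_le (hind q hq) (δ := δ)
      (fun t ht => h2 (by simpa using ht)) (ρ n) hn)
    refine le_trans (le_of_eq ?_) (eLpNorm_mono_measure _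
      (Measure.restrict_le_self (s := Metric.ball 0 r)))
    refine eLpNorm_congr_ae ?_
    filter_upwards [ae_restrict_mem Metric.isOpen_ball.measurableSet] with x hx
    rw [Set.indicator_of_mem (hsub hx)]
  refine ⟨fun n => (ρ n).normed volume ⋆[lsmul ℝ ℝ, volume] B4.indicator f, fun n => ?_,
    conv f hf, fun k => ?_⟩
  · exact (ρ n).hasCompactSupport_normed.contDiff_convolution_left _ (ρ n).contDiff_normed
      ((hind f hf).locallyIntegrable (by norm_num))
  · refine (conv (g k) (hg k)).congr' ?_
    filter_upwards [hρ.eventually (gt_mem_nhds (sub_pos.2 hr))] with n hn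
    refine eLpNorm_congr_ae ?_
    filter_upwards [ae_restrict_mem Metric.isOpen_ball.measurableSet] with x hx
    rw [fderiv_mollify (h k) hf]
    rw [mem_ball_zero_iff] at hx
    linarith

end Mollify

/-! ### Product and chain rules for weak derivatives -/

section ProductRule

open scoped ENNReal NNReal

variable {F₁ F₂ F₃ : Type*} [NormedAddCommGroup F₁] [NormedSpace ℝ F₁]
  [NormedAddCommGroup F₂] [NormedSpace ℝ F₂] [NormedAddCommGroup F₃] [NormedSpace ℝ F₃]

lemma eLpNorm_bilin_le {α : Type*} [MeasurableSpace α] {μ : Measure α}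
    (B : F₁ →L[ℝ] F₂ →L[ℝ] F₃) {p q r : ℝ≥0∞} [ENNReal.HolderTriple p q r] {a : α → F₁}
    {b : α → F₂}
    (ha : AEStronglyMeasurable a μ) (hb : AEStronglyMeasurable b μ) :
    eLpNorm (fun x => B (a x) (b x)) r μ ≤ ‖B‖₊ * eLpNorm a p μ * eLpNorm b q μ :=
  eLpNorm_le_eLpNorm_mul_eLpNorm_of_nnnorm ha hb (fun x y => B x y) ‖B‖₊
    (Eventually.of_forall fun x => B.le_opNorm₂ (a x) (b x))

lemma aesm_bilin {α : Type*} [MeasurableSpace α] {μ : Measure α}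
    (B : F₁ →L[ℝ] F₂ →L[ℝ] F₃) {a : α → F₁} {b : α → F₂}
    (ha : AEStronglyMeasurable a μ) (hb : AEStronglyMeasurable b μ) :
    AEStronglyMeasurable (fun x => B (a x) (b x)) μ :=
  B.aestronglyMeasurable_comp₂ ha hb

lemma memLp_bilin {α : Type*} [MeasurableSpace α] {μ : Measure α}
    (B : F₁ →L[ℝ] F₂ →L[ℝ] F₃) {p q r : ℝ≥0∞} [ENNReal.HolderTriple p q r] {a : α → F₁}
    {b : α → F₂} (ha : MemLp a p μ) (hb : MemLp b q μ) : MemLp (fun x => B (a x) (b x)) r μ :=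
  ⟨aesm_bilin B ha.1 hb.1, (eLpNorm_bilin_le B (p := p) (q := q) ha.1 hb.1).trans_lt
    (ENNReal.mul_lt_top (ENNReal.mul_lt_top ENNReal.coe_lt_top ha.2) hb.2)⟩

lemma integrable_bilin {α : Type*} [MeasurableSpace α] {μ : Measure α}
    (B : F₁ →L[ℝ] F₂ →L[ℝ] F₃) {a : α → F₁} {b : α → F₂} (ha : MemLp a 2 μ) (hb : MemLp b 2 μ) :
    Integrable (fun x => B (a x) (b x)) μ :=
  memLp_one_iff_integrable.1 (memLp_bilin B ha hb)

lemma eventually_memLp_of_tendsto {α : Type*} [MeasurableSpace α] {μ : Measure α} {c : ℕ → α → F₁}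
    {c₀ : α → F₁} (hc : ∀ n, AEStronglyMeasurable (c n) μ) (hc₀ : MemLp c₀ 2 μ)
    (ht : Tendsto (fun n => eLpNorm (fun x => c n x - c₀ x) 2 μ) atTop (𝓝 0)) :
    ∀ᶠ n in atTop, MemLp (c n) 2 μ := by
  filter_upwards [ht.eventually (gt_mem_nhds (ENNReal.zero_lt_top))] with n hn
  have h1 : MemLp (fun x => c n x - c₀ x) 2 μ := ⟨(hc n).sub hc₀.1, hn⟩
  have h2 : MemLp (fun x => (c n x - c₀ x) + c₀ x) 2 μ := h1.add hc₀
  simpa only [sub_add_cancel] using h2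

/-- With δa = a_n − a and δb = b_n − b, the error is B(δa, δb) + B(a, δb) + B(δa, b), and each term
tends to zero in L¹ by Hölder. -/
lemma tendsto_integral_bilin {α : Type*} [MeasurableSpace α] {μ : Measure α}
    (B : F₁ →L[ℝ] F₂ →L[ℝ] F₃) {a : ℕ → α → F₁} {b : ℕ → α → F₂} {a₀ : α → F₁} {b₀ : α → F₂}
    (ha : ∀ n, AEStronglyMeasurable (a n) μ) (hb : ∀ n, AEStronglyMeasurable (b n) μ)
    (ha₀ : MemLp a₀ 2 μ) (hb₀ : MemLp b₀ 2 μ)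
    (hta : Tendsto (fun n => eLpNorm (fun x => a n x - a₀ x) 2 μ) atTop (𝓝 0))
    (htb : Tendsto (fun n => eLpNorm (fun x => b n x - b₀ x) 2 μ) atTop (𝓝 0)) :
    Tendsto (fun n => ∫ x, B (a n x) (b n x) ∂μ) atTop (𝓝 (∫ x, B (a₀ x) (b₀ x) ∂μ)) := by
  refine tendsto_integral_of_L1 _ (integrable_bilin B ha₀ hb₀).1 ?_ ?_
  · filter_upwards [eventually_memLp_of_tendsto ha ha₀ hta,
      eventually_memLp_of_tendsto hb hb₀ htb] with n h1 h2
    exact integrable_bilin B h1 h2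
  · have hbd : ∀ n, ∫⁻ x, ‖B (a n x) (b n x) - B (a₀ x) (b₀ x)‖ₑ ∂μ ≤
        ‖B‖₊ * eLpNorm (fun x => a n x - a₀ x) 2 μ * eLpNorm (fun x => b n x - b₀ x) 2 μ +
        ‖B‖₊ * eLpNorm a₀ 2 μ * eLpNorm (fun x => b n x - b₀ x) 2 μ +
        ‖B‖₊ * eLpNorm (fun x => a n x - a₀ x) 2 μ * eLpNorm b₀ 2 μ := by
      intro n
      have m1 := (ha n).sub ha₀.1
      have m2 := (hb n).sub hb₀.1
      have e1 : (fun x => B (a n x) (b n x) - B (a₀ x) (b₀ x)) =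
          (fun x => B (a n x - a₀ x) (b n x - b₀ x)) + (fun x => B (a₀ x) (b n x - b₀ x)) +
          (fun x => B (a n x - a₀ x) (b₀ x)) := by
        funext x
        simp only [Pi.add_apply, map_sub, sub_apply]
        abel
      rw [← eLpNorm_one_eq_lintegral_enorm, e1]
      refine (eLpNorm_add_le ((aesm_bilin B m1 m2).add (aesm_bilin B ha₀.1 m2))
        (aesm_bilin B m1 hb₀.1) le_rfl).trans ?_
      refine add_le_add ((eLpNorm_add_le (aesm_bilin B m1 m2) (aesm_bilin B ha₀.1 m2)
        le_rfl).trans ?_) (eLpNorm_bilin_le B m1 hb₀.1)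
      exact add_le_add (eLpNorm_bilin_le B m1 m2) (eLpNorm_bilin_le B ha₀.1 m2)
    refine tendsto_of_tendsto_of_tendsto_of_le_of_le tendsto_const_nhds ?_ (fun _ => zero_le) hbd
    have t1 : Tendsto (fun n => (‖B‖₊ : ℝ≥0∞) * eLpNorm (fun x => a n x - a₀ x) 2 μ) atTop
        (𝓝 0) := by
      simpa using ENNReal.Tendsto.const_mul hta (Or.inr ENNReal.coe_ne_top)
    have t2 := ENNReal.Tendsto.mul t1 (Or.inr ENNReal.zero_ne_top) htb (Or.inr ENNReal.zero_ne_top)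
    have t3 := ENNReal.Tendsto.const_mul htb (a := ‖B‖₊ * eLpNorm a₀ 2 μ)
      (Or.inr (ENNReal.mul_ne_top ENNReal.coe_ne_top ha₀.2.ne))
    have t4 := ENNReal.Tendsto.mul_const t1 (b := eLpNorm b₀ 2 μ) (Or.inr hb₀.2.ne)
    simpa using (t2.add t3).add t4

lemma tendsto_eLpNorm_bdd_smul {α : Type*} [MeasurableSpace α] {μ : Measure α} {φ : α → ℝ} {C : ℝ}
    (hC : ∀ x, ‖φ x‖ ≤ C) {a : ℕ → α → F₁} {a₀ : α → F₁}
    (hta : Tendsto (fun n => eLpNorm (fun x => a n x - a₀ x) 2 μ) atTop (𝓝 0)) :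
    Tendsto (fun n => eLpNorm (fun x => φ x • a n x - φ x • a₀ x) 2 μ) atTop (𝓝 0) := by
  have h1 : Tendsto (fun n => ENNReal.ofReal C * eLpNorm (fun x => a n x - a₀ x) 2 μ) atTop
      (𝓝 0) := by
    simpa using ENNReal.Tendsto.const_mul hta (Or.inr ENNReal.ofReal_ne_top)
  refine tendsto_of_tendsto_of_tendsto_of_le_of_le tendsto_const_nhds h1 (fun _ => zero_le)
    fun n => ?_
  refine eLpNorm_le_mul_eLpNorm_of_ae_le_mul (Eventually.of_forall fun x => ?_) 2
  rw [← smul_sub, norm_smul]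
  exact mul_le_mul_of_nonneg_right (hC x) (norm_nonneg _)

lemma IsTest.exists_ball {G : Type*} [NormedAddCommGroup G] [NormedSpace ℝ G] {φ : E 4 → G}
    (h : IsTest φ) : ∃ r < 1, tsupport φ ⊆ Metric.ball 0 r := by
  rcases (tsupport φ).eq_empty_or_nonempty with h0 | h0
  · exact ⟨0, one_pos, by simp [h0]⟩
  · obtain ⟨x, hx, hmax⟩ := h.compact.isCompact.exists_isMaxOn h0 continuous_norm.continuousOn
    have h1 : ‖x‖ < 1 := mem_ball_zero_iff.1 (h.support hx)
    refine ⟨(‖x‖ + 1) / 2, by linarith, fun y hy => ?_⟩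
    rw [mem_ball_zero_iff]
    have : ‖y‖ ≤ ‖x‖ := hmax hy
    linarith

lemma integral_muB_eq_ball {G : Type*} [NormedAddCommGroup G] [NormedSpace ℝ G] {r : ℝ}
    (hr : r < 1) {f : E 4 → G}
    (h : Function.support f ⊆ Metric.ball 0 r) :
    ∫ x, f x ∂muB = ∫ x, f x ∂(volume.restrict (Metric.ball 0 r)) := by
  rw [integral_muB_of_support (h.trans (Metric.ball_subset_ball hr.le))]
  refine (setIntegral_eq_integral_of_forall_compl_eq_zero fun x hx => ?_).symm
  by_contra h0
  exact hx (h h0)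

lemma support_smul_subset_ball {G : Type*} [NormedAddCommGroup G] [NormedSpace ℝ G] {r : ℝ}
    {φ : E 4 → ℝ} (h : tsupport φ ⊆ Metric.ball 0 r) (f : E 4 → G) :
    Function.support (fun x => φ x • f x) ⊆ Metric.ball 0 r := by
  intro x hx
  exact h (subset_tsupport φ fun h0 => hx (by simp [h0]))

lemma tsupport_partialD_subset {φ : E 4 → ℝ} (k : Fin 4) :
    tsupport (partialD k φ) ⊆ tsupport φ :=
  closure_minimal (support_fderiv_apply_subset _) (isClosed_tsupport _)

lemma MemL2.restrict_ball {G : Type*} [NormedAddCommGroup G] {f : E 4 → G}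
    (hf : MemL2 f) {r : ℝ} (hr : r < 1) : MemLp f 2 (volume.restrict (Metric.ball 0 r)) :=
  hf.mono_measure (Measure.restrict_mono (Metric.ball_subset_ball hr.le) le_rfl)

lemma MemLp.bdd_smul {α : Type*} [MeasurableSpace α] {μ : Measure α} {φ : α → ℝ} {C : ℝ}
    {p : ℝ≥0∞} (hφ : AEStronglyMeasurable φ μ) (hC : ∀ x, ‖φ x‖ ≤ C) {a : α → F₁}
    (ha : MemLp a p μ) : MemLp (fun x => φ x • a x) p μ := by
  refine ha.of_le_mul (c := C) (hφ.smul ha.1) (Eventually.of_forall fun x => ?_)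
  rw [norm_smul]
  exact mul_le_mul_of_nonneg_right (hC x) (norm_nonneg _)

/-- The product rule for weak derivatives of square integrable functions. -/
lemma hasWeakPartial_bilin [CompleteSpace F₁] [CompleteSpace F₂] [CompleteSpace F₃]
    (B : F₁ →L[ℝ] F₂ →L[ℝ] F₃) {a : E 4 → F₁} {b : E 4 → F₂}
    {a' : Fin 4 → E 4 → F₁} {b' : Fin 4 → E 4 → F₂}
    (ha : MemL2 a) (hb : MemL2 b) (ha' : ∀ k, MemL2 (a' k)) (hb' : ∀ k, MemL2 (b' k))
    (hwa : ∀ k, HasWeakPartial k a (a' k)) (hwb : ∀ k, HasWeakPartial k b (b' k)) (k : Fin 4) :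
    HasWeakPartial k (fun x => B (a x) (b x)) (fun x => B (a' k x) (b x) + B (a x) (b' k x)) := by
  have loc : ∀ {f : E 4 → F₃}, Integrable f muB → LocallyIntegrableOn f B4 volume :=
    fun hf => IntegrableOn.locallyIntegrableOn hf
  refine ⟨loc (integrable_bilin B ha hb),
    loc ((integrable_bilin B (ha' k) hb).add (integrable_bilin B ha (hb' k))), fun φ hφ => ?_⟩
  obtain ⟨r, hr, hsupp⟩ := hφ.exists_ball
  have hsuppd : tsupport (partialD k φ) ⊆ Metric.ball 0 r := (tsupport_partialD_subset k).trans hsupp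
  -- Both factors are approximated on a ball that contains the support of φ. The classical rule
  -- holds for the approximations, and attaching φ or its derivative to the first factor makes each
  -- of the three integrals a pairing of two L²-convergent sequences.
  obtain ⟨A, hA1, hA2, hA3⟩ := exists_smooth_approx ha hwa ha' hr
  obtain ⟨D, hD1, hD2, hD3⟩ := exists_smooth_approx hb hwb hb' hr
  obtain ⟨C, -, hC⟩ := hφ.bounded
  obtain ⟨C', -, hC'⟩ := (hφ.partialD k).bounded
  set μ := (volume : Measure (E 4)).restrict (Metric.ball 0 r) with hμ
  have hAc : ∀ n, Continuous (A n) := fun n => (hA1 n).continuous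
  have hDc : ∀ n, Continuous (D n) := fun n => (hD1 n).continuous
  have hAd : ∀ n, Continuous (fun x => fderiv ℝ (A n) x (e k)) := fun n =>
    ((hA1 n).continuous_fderiv (by simp)).clm_apply continuous_const
  have hDd : ∀ n, Continuous (fun x => fderiv ℝ (D n) x (e k)) := fun n =>
    ((hD1 n).continuous_fderiv (by simp)).clm_apply continuous_const
  have t1 : Tendsto (fun n => ∫ x, B (partialD k φ x • A n x) (D n x) ∂μ) atTop
      (𝓝 (∫ x, B (partialD k φ x • a x) (b x) ∂μ)) :=
    tendsto_integral_bilin B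
      (fun n => ((hφ.partialD k).continuous.smul (hAc n)).aestronglyMeasurable)
      (fun n => (hDc n).aestronglyMeasurable)
      (MemLp.bdd_smul (hφ.partialD k).continuous.aestronglyMeasurable hC' (ha.restrict_ball hr))
      (hb.restrict_ball hr) (tendsto_eLpNorm_bdd_smul hC' hA2) hD2
  have t2 : Tendsto (fun n => ∫ x, B (φ x • fderiv ℝ (A n) x (e k)) (D n x) ∂μ) atTop
      (𝓝 (∫ x, B (φ x • a' k x) (b x) ∂μ)) :=
    tendsto_integral_bilin B
      (fun n => (hφ.continuous.smul (hAd n)).aestronglyMeasurable)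
      (fun n => (hDc n).aestronglyMeasurable)
      (MemLp.bdd_smul hφ.continuous.aestronglyMeasurable hC ((ha' k).restrict_ball hr))
      (hb.restrict_ball hr) (tendsto_eLpNorm_bdd_smul hC (hA3 k)) hD2
  have t3 : Tendsto (fun n => ∫ x, B (φ x • A n x) (fderiv ℝ (D n) x (e k)) ∂μ) atTop
      (𝓝 (∫ x, B (φ x • a x) (b' k x) ∂μ)) :=
    tendsto_integral_bilin B
      (fun n => (hφ.continuous.smul (hAc n)).aestronglyMeasurable)
      (fun n => (hDd n).aestronglyMeasurable)
      (MemLp.bdd_smul hφ.continuous.aestronglyMeasurable hC (ha.restrict_ball hr))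
      ((hb' k).restrict_ball hr) (tendsto_eLpNorm_bdd_smul hC hA2) (hD3 k)
  have hint : ∀ {p : E 4 → F₁} {q : E 4 → F₂}, MemL2 p → MemL2 q →
      Integrable (fun x => B (φ x • p x) (q x)) μ := fun hp hq =>
    integrable_bilin B (MemLp.bdd_smul hφ.continuous.aestronglyMeasurable hC (hp.restrict_ball hr))
      (hq.restrict_ball hr)
  have hcont : ∀ {p : E 4 → F₁} {q : E 4 → F₂}, Continuous p → Continuous q →
      Integrable (fun x => B (φ x • p x) (q x)) μ := by
    intro p q hp hq
    refine Integrable.restrict ?_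
    refine Continuous.integrable_of_hasCompactSupport
      (B.continuous₂.comp ((hφ.continuous.smul hp).prodMk hq)) ?_
    refine hφ.compact.mono fun x hx h0 => hx (by simp [h0])
  have hn : ∀ n, ∫ x, B (partialD k φ x • A n x) (D n x) ∂μ =
      - (∫ x, B (φ x • fderiv ℝ (A n) x (e k)) (D n x) ∂μ +
        ∫ x, B (φ x • A n x) (fderiv ℝ (D n) x (e k)) ∂μ) := by
    intro n
    have hsm : ContDiff ℝ 1 (fun x => B (A n x) (D n x)) :=
      (B.isBoundedBilinearMap.contDiff (n := 1)).comp
        ((contDiff_infty.1 (hA1 n) 1).prodMk (contDiff_infty.1 (hD1 n) 1))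
    have h1 := (hasWeakPartial_of_contDiff hsm k).eq φ hφ
    rw [integral_muB_eq_ball hr (support_smul_subset_ball hsuppd _),
      integral_muB_eq_ball hr (support_smul_subset_ball hsupp _)] at h1
    rw [← integral_add (hcont (hAd n) (hDc n)) (hcont (hAc n) (hDd n))]
    simp only [map_smul, smul_apply]
    rw [h1]
    congr 1
    refine integral_congr_ae (Eventually.of_forall fun x => ?_)
    have hA0 := ((hA1 n).differentiable (by simp)) x
    have hD0 := ((hD1 n).differentiable (by simp)) x
    have h2 : HasFDerivAt (fun x => B (A n x) (D n x)) _ x :=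
      B.hasFDerivAt_of_bilinear hA0.hasFDerivAt hD0.hasFDerivAt
    simp only []
    rw [h2.fderiv]
    simp [smul_add, add_comm]
  have t4 := (t2.add t3).neg
  simp only [← hn] at t4
  have h5 := tendsto_nhds_unique t1 t4
  rw [← integral_add (hint (ha' k) hb) (hint ha (hb' k))] at h5
  simp only [map_smul, smul_apply, ← smul_add] at h5
  rw [integral_muB_eq_ball hr (support_smul_subset_ball hsuppd _),
    integral_muB_eq_ball hr (support_smul_subset_ball hsupp _), h5]

lemma memL2_comp {w : F₁ → F₂} (hwc : Continuous w) (hws : HasCompactSupport w) {f : E 4 → F₁}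
    (hf : MemL2 f) : MemL2 (fun x => w (f x)) := by
  obtain ⟨C, hC⟩ := hwc.bounded_above_of_compact_support hws
  exact MemLp.of_bound (hwc.comp_aestronglyMeasurable hf.1) C (Eventually.of_forall fun x => hC _)

lemma tendsto_eLpNorm_comp {α : Type*} [MeasurableSpace α] {μ : Measure α} {w : F₁ → F₂}
    (hwc : ContDiff ℝ 1 w) (hws : HasCompactSupport w) {A : ℕ → α → F₁} {f : α → F₁}
    (hA : Tendsto (fun n => eLpNorm (fun x => A n x - f x) 2 μ) atTop (𝓝 0)) :
    Tendsto (fun n => eLpNorm (fun x => w (A n x) - w (f x)) 2 μ) atTop (𝓝 0) := by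
  obtain ⟨K, hK⟩ := hwc.lipschitzWith_of_hasCompactSupport hws (by norm_num)
  have h1 : Tendsto (fun n => ENNReal.ofReal K * eLpNorm (fun x => A n x - f x) 2 μ) atTop
      (𝓝 0) := by
    have h2 := ENNReal.Tendsto.const_mul hA (a := ENNReal.ofReal K) (Or.inr ENNReal.ofReal_ne_top)
    rwa [mul_zero] at h2
  refine tendsto_of_tendsto_of_tendsto_of_le_of_le tendsto_const_nhds h1 (fun _ => zero_le)
    fun n => ?_
  exact eLpNorm_le_mul_eLpNorm_of_ae_le_mul
    (Eventually.of_forall fun x => hK.norm_sub_le (A n x) (f x)) 2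

/-- The chain rule for weak derivatives and compactly supported functions of class `C²`. -/
lemma hasWeakPartial_comp [CompleteSpace F₁] [CompleteSpace F₂] {g : F₁ → F₂}
    (hg : ContDiff ℝ 2 g) (hgc : HasCompactSupport g)
    {f : E 4 → F₁} {f' : Fin 4 → E 4 → F₁}
    (hf : MemL2 f) (hf' : ∀ k, MemL2 (f' k)) (hw : ∀ k, HasWeakPartial k f (f' k)) (k : Fin 4) :
    HasWeakPartial k (fun x => g (f x)) (fun x => fderiv ℝ g (f x) (f' k x)) := by
  have hdg : ContDiff ℝ 1 (fderiv ℝ g) := hg.fderiv_right (by norm_num)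
  have hgm : MemL2 (fun x => g (f x)) := memL2_comp hg.continuous hgc hf
  have hdgm : MemL2 (fun x => fderiv ℝ g (f x)) := memL2_comp hdg.continuous (hgc.fderiv ℝ) hf
  let ev : (F₁ →L[ℝ] F₂) →L[ℝ] F₁ →L[ℝ] F₂ := ContinuousLinearMap.id ℝ (F₁ →L[ℝ] F₂)
  have hres : Integrable (fun x => fderiv ℝ g (f x) (f' k x)) muB :=
    integrable_bilin ev hdgm (hf' k)
  refine ⟨hgm.locallyIntegrableOn, IntegrableOn.locallyIntegrableOn hres, fun φ hφ => ?_⟩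
  obtain ⟨r, hr, hsupp⟩ := hφ.exists_ball
  have hsuppd : tsupport (partialD k φ) ⊆ Metric.ball 0 r := (tsupport_partialD_subset k).trans hsupp
  -- Both g and its derivative are Lipschitz, being C¹ with compact support. Hence g(A_n) and
  -- dg(A_n) converge in L², and dg(A_n) ∂_k A_n is again a pairing of two L²-convergent sequences.
  obtain ⟨A, hA1, hA2, hA3⟩ := exists_smooth_approx hf hw hf' hr
  obtain ⟨C, -, hC⟩ := hφ.bounded
  obtain ⟨C', -, hC'⟩ := (hφ.partialD k).bounded
  set μ := (volume : Measure (E 4)).restrict (Metric.ball 0 r) with hμ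
  have : IsFiniteMeasure μ := ⟨by rw [hμ, Measure.restrict_apply_univ]; exact measure_ball_lt_top⟩
  have hAd : ∀ n, Continuous (fun x => fderiv ℝ (A n) x (e k)) := fun n =>
    ((hA1 n).continuous_fderiv (by simp)).clm_apply continuous_const
  have t1 : Tendsto (fun n => ∫ x, partialD k φ x • g (A n x) ∂μ) atTop
      (𝓝 (∫ x, partialD k φ x • g (f x) ∂μ)) :=
    tendsto_integral_bilin (ContinuousLinearMap.lsmul ℝ ℝ : ℝ →L[ℝ] F₂ →L[ℝ] F₂)
      (fun _ => (hφ.partialD k).continuous.aestronglyMeasurable)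
      (fun n => (hg.continuous.comp (hA1 n).continuous).aestronglyMeasurable)
      (MemLp.of_bound (hφ.partialD k).continuous.aestronglyMeasurable C'
        (Eventually.of_forall hC'))
      (hgm.restrict_ball hr) (by simp) (tendsto_eLpNorm_comp (hg.of_le (by norm_num)) hgc hA2)
  have t2 : Tendsto (fun n => ∫ x, ev (fderiv ℝ g (A n x)) (φ x • fderiv ℝ (A n) x (e k)) ∂μ) atTop
      (𝓝 (∫ x, ev (fderiv ℝ g (f x)) (φ x • f' k x) ∂μ)) :=
    tendsto_integral_bilin ev
      (fun n => (hdg.continuous.comp (hA1 n).continuous).aestronglyMeasurable)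
      (fun n => (hφ.continuous.smul (hAd n)).aestronglyMeasurable)
      (hdgm.restrict_ball hr)
      (MemLp.bdd_smul hφ.continuous.aestronglyMeasurable hC ((hf' k).restrict_ball hr))
      (tendsto_eLpNorm_comp hdg (hgc.fderiv ℝ) hA2) (tendsto_eLpNorm_bdd_smul hC (hA3 k))
  have hn : ∀ n, ∫ x, partialD k φ x • g (A n x) ∂μ =
      - ∫ x, ev (fderiv ℝ g (A n x)) (φ x • fderiv ℝ (A n) x (e k)) ∂μ := by
    intro n
    have hsm : ContDiff ℝ 1 (fun x => g (A n x)) :=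
      (hg.of_le (by norm_num)).comp (contDiff_infty.1 (hA1 n) 1)
    have h1 := (hasWeakPartial_of_contDiff hsm k).eq φ hφ
    rw [integral_muB_eq_ball hr (support_smul_subset_ball hsuppd _),
      integral_muB_eq_ball hr (support_smul_subset_ball hsupp _)] at h1
    rw [h1]
    congr 1
    refine integral_congr_ae (Eventually.of_forall fun x => ?_)
    have hA0 := ((hA1 n).differentiable (by simp)) x
    have hg0 := (hg.differentiable (by norm_num)) (A n x)
    have h2 : HasFDerivAt (fun x => g (A n x)) _ x := hg0.hasFDerivAt.comp x hA0.hasFDerivAt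
    simp only []
    rw [h2.fderiv]
    simp [ev]
  have t4 := t2.neg
  simp only [← hn] at t4
  have h5 := tendsto_nhds_unique t1 t4
  rw [integral_muB_eq_ball hr (support_smul_subset_ball hsuppd _),
    integral_muB_eq_ball hr (support_smul_subset_ball hsupp fun x => fderiv ℝ g (f x) (f' k x)), h5]
  simp [ev, hμ]

end ProductRule

/-! ### The Sobolev embedding W^{1,2} ⊂ L⁴ on the ball -/

section Sobolev

open scoped ENNReal NNReal

/-- Linearly independent directions that point into the ball near the pole `s • e k`. -/
def inward (k : Fin 4) (s : ℝ) (j : Fin 4) : E 4 :=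
  (-s) • e k + if j = k then 0 else (1 / 4 : ℝ) • e j

lemma norm_e (k : Fin 4) : ‖e k‖ = 1 := by simp [e]

lemma inner_e (x : E 4) (k : Fin 4) : inner ℝ x (e k) = x k := by
  simp [e, EuclideanSpace.inner_single_right]

lemma norm_inward_le {k : Fin 4} {s : ℝ} (hs : |s| = 1) (j : Fin 4) : ‖inward k s j‖ ≤ 5 / 4 := by
  unfold inward
  refine (norm_add_le _ _).trans ?_
  have h1 : ‖(-s) • e k‖ = 1 := by rw [norm_smul, norm_neg, Real.norm_eq_abs, hs, norm_e, mul_one]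
  have h2 : ‖(if j = k then (0 : E 4) else (1 / 4 : ℝ) • e j)‖ ≤ 1 / 4 := by
    split_ifs
    · simp
    · rw [norm_smul, norm_e]; norm_num
  linarith

/-- In the cap the direction v satisfies ⟨x, v⟩ ≤ −‖x‖/2 + ‖x‖/4. If ‖x‖ ≥ 1/4, the gain t‖x‖/2 in
the squared norm outweighs the loss 25t²/16 for t ≤ 1/20; if ‖x‖ < 1/4, the segment is too short to
leave the ball of radius 1/2. -/
lemma add_inward_mem_ball {k : Fin 4} {s : ℝ} (hs : |s| = 1) (j : Fin 4) {r : ℝ} (hr : 1 / 2 ≤ r)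
    {x : E 4} (hx : x ∈ Metric.ball 0 r) (hxk : ‖x‖ / 2 ≤ s * x k) {t : ℝ} (ht0 : 0 ≤ t)
    (ht : t ≤ 1 / 20) : x + t • inward k s j ∈ Metric.ball 0 r := by
  rw [mem_ball_zero_iff] at hx ⊢
  have hv := norm_inward_le hs (k := k) j
  have hin : inner ℝ x (inward k s j) ≤ - ‖x‖ / 4 := by
    unfold inward
    rw [inner_add_right, inner_smul_right, inner_e]
    have h2 : inner ℝ x (if j = k then (0 : E 4) else (1 / 4 : ℝ) • e j) ≤ ‖x‖ / 4 := by
      split_ifs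
      · rw [inner_zero_right]
        positivity
      · rw [inner_smul_right, inner_e]
        have := (le_abs_self (x j)).trans (PiLp.norm_apply_le x j)
        linarith
    linarith
  rcases lt_or_ge ‖x‖ (1 / 4) with h | h
  · calc ‖x + t • inward k s j‖ ≤ ‖x‖ + ‖t • inward k s j‖ := norm_add_le _ _
      _ = ‖x‖ + t * ‖inward k s j‖ := by rw [norm_smul, Real.norm_of_nonneg ht0]
      _ < r := by nlinarith [norm_nonneg (inward k s j)]
  · refine lt_of_le_of_lt ?_ hx
    refine le_of_sq_le_sq ?_ (norm_nonneg _)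
    rw [norm_add_sq_real, inner_smul_right, norm_smul, Real.norm_of_nonneg ht0]
    have h3 : (t * ‖inward k s j‖) ^ 2 ≤ t ^ 2 * (25 / 16) := by
      rw [mul_pow]
      have : ‖inward k s j‖ ^ 2 ≤ (5 / 4) ^ 2 := pow_le_pow_left₀ (norm_nonneg _) hv 2
      nlinarith [sq_nonneg t]
    nlinarith [mul_nonneg ht0 (norm_nonneg x), mul_le_mul_of_nonneg_left hin ht0]

/-- The fundamental theorem of calculus compares g(x) with g at any point of the segment, and
averaging over the segment gives the bound. The derivative term carries the factor ‖v‖/20 ≤ 1/16, so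
it needs no constant. -/
lemma enorm_mul_le_lintegral_line {g : E 4 → ℝ} (hg : ContDiff ℝ 1 g) {x v : E 4} (hv : ‖v‖ ≤ 5 / 4)
    {r : ℝ} (hx : ∀ t : ℝ, 0 ≤ t → t ≤ 1 / 20 → x + t • v ∈ Metric.ball 0 r) :
    ENNReal.ofReal (1 / 20) * ‖g x‖ₑ ≤ ∫⁻ t : ℝ,
      (Metric.ball 0 r).indicator (fun y => ‖g y‖ₑ + ‖fderiv ℝ g y‖ₑ) (x + t • v) := by
  set I : Set ℝ := Set.Icc 0 (1 / 20) with hI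
  have hl : Continuous (fun t : ℝ => x + t • v) := by fun_prop
  have hgc : Continuous g := hg.continuous
  have hdc : Continuous (fderiv ℝ g) := hg.continuous_fderiv (by norm_num)
  have hvol : volume I = ENNReal.ofReal (1 / 20) := by rw [hI, Real.volume_Icc, sub_zero]
  have hpt : ∀ t ∈ I, ‖g x‖ₑ ≤ ‖g (x + t • v)‖ₑ + ∫⁻ s in I, ‖fderiv ℝ g (x + s • v) v‖ₑ := by
    intro t ht
    have hder : ∀ s ∈ Set.uIcc 0 t, HasDerivAt (fun s : ℝ => g (x + s • v))
        (fderiv ℝ g (x + s • v) v) s := by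
      intro s _
      have h1 : HasDerivAt (fun s : ℝ => x + s • v) v s := by
        simpa using ((hasDerivAt_id s).smul_const v).const_add x
      exact ((hg.differentiable (by norm_num)) _).hasFDerivAt.comp_hasDerivAt s h1
    have hcont : Continuous (fun s : ℝ => fderiv ℝ g (x + s • v) v) :=
      (hdc.comp hl).clm_apply continuous_const
    have h2 := intervalIntegral.integral_eq_sub_of_hasDerivAt hder (hcont.intervalIntegrable 0 t)
    simp only [zero_smul, add_zero] at h2
    have h3 : g x = g (x + t • v) - ∫ s in (0 : ℝ)..t, fderiv ℝ g (x + s • v) v := by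
      rw [h2]; ring
    rw [h3]
    refine enorm_sub_le.trans (add_le_add le_rfl ?_)
    rw [intervalIntegral.integral_of_le ht.1]
    refine (enorm_integral_le_lintegral_enorm _).trans (lintegral_mono_set ?_)
    intro s hs
    exact ⟨hs.1.le, hs.2.trans ht.2⟩
  calc ENNReal.ofReal (1 / 20) * ‖g x‖ₑ = ∫⁻ t in I, ‖g x‖ₑ := by
        rw [setLIntegral_const, hvol, mul_comm]
    _ ≤ ∫⁻ t in I, (‖g (x + t • v)‖ₑ + ∫⁻ s in I, ‖fderiv ℝ g (x + s • v) v‖ₑ) :=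
        setLIntegral_mono_ae' measurableSet_Icc (Eventually.of_forall hpt)
    _ = (∫⁻ t in I, ‖g (x + t • v)‖ₑ) + ENNReal.ofReal (1 / 20) *
          ∫⁻ s in I, ‖fderiv ℝ g (x + s • v) v‖ₑ := by
        rw [lintegral_add_right _ measurable_const, setLIntegral_const, hvol, mul_comm]
    _ ≤ (∫⁻ t in I, ‖g (x + t • v)‖ₑ) + ∫⁻ s in I, ‖fderiv ℝ g (x + s • v)‖ₑ := by
        gcongr
        rw [← lintegral_const_mul' _ _ ENNReal.ofReal_ne_top]
        refine lintegral_mono fun s => ?_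
        calc ENNReal.ofReal (1 / 20) * ‖fderiv ℝ g (x + s • v) v‖ₑ
            ≤ ENNReal.ofReal (1 / 20) * (‖fderiv ℝ g (x + s • v)‖ₑ * ENNReal.ofReal (5 / 4)) := by
              gcongr
              refine (ContinuousLinearMap.le_opENorm _ _).trans ?_
              gcongr
              rw [← ofReal_norm]
              exact ENNReal.ofReal_le_ofReal hv
          _ = ‖fderiv ℝ g (x + s • v)‖ₑ * ENNReal.ofReal (1 / 20 * (5 / 4)) := by
              rw [ENNReal.ofReal_mul (by norm_num)]; ring
          _ ≤ ‖fderiv ℝ g (x + s • v)‖ₑ * 1 := by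
              gcongr
              rw [ENNReal.ofReal_le_one]
              norm_num
          _ = _ := mul_one _
    _ = ∫⁻ t in I, (‖g (x + t • v)‖ₑ + ‖fderiv ℝ g (x + t • v)‖ₑ) := by
        rw [lintegral_add_right]
        exact (hdc.comp hl).enorm.measurable
    _ ≤ ∫⁻ t in I, (Metric.ball 0 r).indicator (fun y => ‖g y‖ₑ + ‖fderiv ℝ g y‖ₑ) (x + t • v) := by
        refine setLIntegral_mono_ae' measurableSet_Icc (Eventually.of_forall fun t ht => ?_)
        rw [Set.indicator_of_mem (hx t ht.1 ht.2)]
    _ ≤ _ := setLIntegral_le_lintegral _ _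

/-- The linear coordinates with axes in the directions `inward k s`. -/
def inwardMap (k : Fin 4) (s : ℝ) : (Fin 4 → ℝ) →ₗ[ℝ] E 4 := Fintype.linearCombination ℝ (inward k s)

lemma inwardMap_apply_ne {k : Fin 4} {s : ℝ} (y : Fin 4 → ℝ) {i : Fin 4} (hi : i ≠ k) :
    inwardMap k s y i = y i / 4 := by
  simp only [inwardMap, Fintype.linearCombination_apply, inward, e]
  rw [WithLp.ofLp_sum, Finset.sum_apply, Finset.sum_eq_single i]
  · simp [hi]; ring
  · intro j _ hj
    by_cases hjk : j = k
    · simp [hjk, hi]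
    · simp [hjk, hi, hj.symm]
  · simp

lemma inwardMap_injective {k : Fin 4} {s : ℝ} (hs : |s| = 1) :
    Function.Injective (inwardMap k s) := by
  rw [← LinearMap.ker_eq_bot, LinearMap.ker_eq_bot']
  intro y hy
  have h1 : ∀ i, i ≠ k → y i = 0 := by
    intro i hi
    have := inwardMap_apply_ne (s := s) y hi
    rw [hy] at this
    simp at this
    linarith
  have h2 : inwardMap k s y = y k • inward k s k := by
    rw [inwardMap, Fintype.linearCombination_apply, Finset.sum_eq_single k]
    · intro j _ hj
      rw [h1 j hj, zero_smul]
    · simp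
  have h3 : y k = 0 := by
    rw [hy] at h2
    have h4 : inward k s k ≠ 0 := by
      intro h
      have : ‖inward k s k‖ = 1 := by simp [inward, norm_smul, norm_e, hs]
      rw [h, norm_zero] at this
      exact zero_ne_one this
    exact (smul_eq_zero.1 h2.symm).resolve_right h4
  funext i
  by_cases hi : i = k
  · rw [hi, h3]; rfl
  · exact h1 i hi

/-- The linear coordinates with axes in the directions `inward k s`, as an equivalence. -/
def inwardEquiv (k : Fin 4) {s : ℝ} (hs : |s| = 1) : (Fin 4 → ℝ) ≃L[ℝ] E 4 :=
  (LinearEquiv.ofInjectiveOfFinrankEq (inwardMap k s) (inwardMap_injective hs)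
    (by simp)).toContinuousLinearEquiv

lemma inwardEquiv_apply (k : Fin 4) {s : ℝ} (hs : |s| = 1) (y : Fin 4 → ℝ) :
    inwardEquiv k hs y = ∑ j, y j • inward k s j := by
  rw [← Fintype.linearCombination_apply ℝ (inward k s) y]
  rfl

lemma inwardEquiv_update (k : Fin 4) {s : ℝ} (hs : |s| = 1) (y : Fin 4 → ℝ) (j : Fin 4) (t : ℝ) :
    inwardEquiv k hs (Function.update y j t) = inwardEquiv k hs y + (t - y j) • inward k s j := by
  have h1 : Function.update y j t = y + Pi.single j (t - y j) := by
    funext i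
    by_cases hi : i = j
    · subst hi; simp
    · simp [hi]
  rw [h1, map_add, inwardEquiv_apply k hs (Pi.single j (t - y j)), Finset.sum_eq_single j]
  · simp
  · intro i _ hi
    simp [hi]
  · simp

/-- The part of the ball of radius `r` around the pole `s • e k`. -/
def capSet (k : Fin 4) (s r : ℝ) : Set (E 4) := {x | x ∈ Metric.ball 0 r ∧ ‖x‖ / 2 ≤ s * x k}

lemma measurableSet_capSet (k : Fin 4) (s r : ℝ) : MeasurableSet (capSet k s r) := by
  refine MeasurableSet.inter Metric.isOpen_ball.measurableSet (IsClosed.measurableSet ?_)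
  exact isClosed_le (f := fun x : E 4 => ‖x‖ / 2) (g := fun x : E 4 => s * x k) (by fun_prop)
    (by fun_prop)

lemma exists_lintegral_comp_equiv (L : (Fin 4 → ℝ) ≃L[ℝ] E 4) : ∃ c : ℝ≥0∞, c ≠ 0 ∧ c ≠ ⊤ ∧
    ∀ F : E 4 → ℝ≥0∞, Measurable F → ∫⁻ y, F (L y) = c * ∫⁻ x, F x := by
  have : (Measure.map L (volume : Measure (Fin 4 → ℝ))).IsAddHaarMeasure :=
    L.isAddHaarMeasure_map volume
  refine ⟨Measure.addHaarScalarFactor (Measure.map L volume) (volume : Measure (E 4)), ?_,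
    ENNReal.coe_ne_top, fun F hF => ?_⟩
  · exact ENNReal.coe_ne_zero.2 (Measure.addHaarScalarFactor_pos_of_isAddHaarMeasure _ _).ne'
  · rw [← lintegral_map hF L.continuous.measurable]
    refine (congrArg (fun ν => ∫⁻ a, F a ∂ν) (Measure.isAddLeftInvariant_eq_smul
      (Measure.map L volume) (volume : Measure (E 4)))).trans ?_
    exact lintegral_smul_measure _ F

lemma rpow_le_mul_prod {a κ : ℝ≥0∞} {b : Fin 4 → ℝ≥0∞} (h0 : κ ≠ 0) (h1 : κ ≠ ⊤)
    (h : ∀ j, κ * a ≤ b j) :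
    a ^ (4 / 3 : ℝ) ≤ κ⁻¹ ^ (4 / 3 : ℝ) * ∏ j, b j ^ (1 / 3 : ℝ) := by
  have e : ∀ z : ℝ≥0∞, ∏ _j : Fin 4, z ^ (1 / 3 : ℝ) = z ^ (4 / 3 : ℝ) := by
    intro z
    rw [Finset.prod_const, Finset.card_univ, Fintype.card_fin, ← ENNReal.rpow_natCast,
      ← ENNReal.rpow_mul]
    norm_num
  rw [← e a, ← e κ⁻¹, ← Finset.prod_mul_distrib]
  refine Finset.prod_le_prod' fun j _ => ?_
  rw [← ENNReal.mul_rpow_of_nonneg _ _ (by norm_num)]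
  exact ENNReal.rpow_le_rpow ((ENNReal.mul_le_iff_le_inv h0 h1).1 (h j)) (by norm_num)

/-- Gagliardo's argument in skew coordinates: |g| is bounded by an integral along each of the four
coordinate lines, hence |g|^{4/3} by the product of the cube roots of these integrals, and the
grid-lines inequality integrates such a product. Because the segments stay inside the ball, no
extension operator is needed; the constant does not depend on r. -/
lemma lintegral_capSet_le (k : Fin 4) {s : ℝ} (hs : |s| = 1) : ∃ C : ℝ≥0∞, C ≠ ⊤ ∧
    ∀ r : ℝ, 1 / 2 ≤ r → ∀ g : E 4 → ℝ, ContDiff ℝ 1 g →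
      ∫⁻ x in capSet k s r, ‖g x‖ₑ ^ (4 / 3 : ℝ) ≤
        C * (∫⁻ x in Metric.ball 0 r, (‖g x‖ₑ + ‖fderiv ℝ g x‖ₑ)) ^ (4 / 3 : ℝ) := by
  obtain ⟨c, hc0, hc1, hcv⟩ := exists_lintegral_comp_equiv (inwardEquiv k hs)
  set κ : ℝ≥0∞ := ENNReal.ofReal (1 / 20) with hκ
  have hκ0 : κ ≠ 0 := by simp [hκ]
  have hκ1 : κ ≠ ⊤ := ENNReal.ofReal_ne_top
  have hκ2 : κ⁻¹ ^ (4 / 3 : ℝ) ≠ ⊤ :=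
    ENNReal.rpow_ne_top_of_nonneg (by norm_num) (ENNReal.inv_ne_top.2 hκ0)
  refine ⟨c⁻¹ * (κ⁻¹ ^ (4 / 3 : ℝ) * c ^ (4 / 3 : ℝ)), ENNReal.mul_ne_top (ENNReal.inv_ne_top.2 hc0)
    (ENNReal.mul_ne_top hκ2 (ENNReal.rpow_ne_top_of_nonneg (by norm_num) hc1)), ?_⟩
  intro r hr g hg
  have hgc : Continuous g := hg.continuous
  have hdc : Continuous (fderiv ℝ g) := hg.continuous_fderiv (by norm_num)
  set H : E 4 → ℝ≥0∞ :=
    (Metric.ball 0 r).indicator (fun y => ‖g y‖ₑ + ‖fderiv ℝ g y‖ₑ) with hH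
  have hHm : Measurable H :=
    (hgc.enorm.measurable.add hdc.enorm.measurable).indicator Metric.isOpen_ball.measurableSet
  set K : E 4 → ℝ≥0∞ := (capSet k s r).indicator (fun y => ‖g y‖ₑ ^ (4 / 3 : ℝ)) with hK
  have hKm : Measurable K :=
    (hgc.enorm.measurable.pow_const _).indicator (measurableSet_capSet k s r)
  have hpt : ∀ y, K (inwardEquiv k hs y) ≤ κ⁻¹ ^ (4 / 3 : ℝ) *
      ∏ j, (∫⁻ t, H (inwardEquiv k hs (Function.update y j t))) ^ (1 / 3 : ℝ) := by
    intro y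
    by_cases hy : inwardEquiv k hs y ∈ capSet k s r
    · rw [hK, Set.indicator_of_mem hy]
      refine rpow_le_mul_prod hκ0 hκ1 fun j => ?_
      have h1 := enorm_mul_le_lintegral_line hg (norm_inward_le hs (k := k) j)
        (fun t ht0 ht => add_inward_mem_ball hs j hr hy.1 hy.2 ht0 ht)
      refine h1.trans (le_of_eq ?_)
      simp only [inwardEquiv_update]
      exact (lintegral_sub_right_eq_self
        (fun t => H (inwardEquiv k hs y + t • inward k s j)) (y j)).symm
    · rw [hK, Set.indicator_of_notMem hy]
      exact zero_le
  have hgrid := lintegral_prod_lintegral_pow_le (fun _ : Fin 4 => (volume : Measure ℝ))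
    (p := 4 / 3) (by
      rw [Real.holderConjugate_iff]; norm_num) (hHm.comp (inwardEquiv k hs).continuous.measurable)
  have hexp : (1 : ℝ) / ((Fintype.card (Fin 4) : ℝ) - 1) = 1 / 3 := by norm_num
  rw [hexp, ← volume_pi] at hgrid
  have h1 : c * ∫⁻ x, K x ≤ κ⁻¹ ^ (4 / 3 : ℝ) * (c * ∫⁻ x, H x) ^ (4 / 3 : ℝ) := by
    rw [← hcv K hKm, ← hcv H hHm]
    refine (lintegral_mono hpt).trans ?_
    rw [lintegral_const_mul' _ _ hκ2]
    exact mul_le_mul_right hgrid _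
  rw [hK, lintegral_indicator (measurableSet_capSet k s r), hH,
    lintegral_indicator Metric.isOpen_ball.measurableSet, ENNReal.mul_le_iff_le_inv hc0 hc1,
    ENNReal.mul_rpow_of_nonneg _ _ (by norm_num)] at h1
  refine h1.trans (le_of_eq ?_)
  ring

lemma ball_subset_iUnion_capSet (r : ℝ) :
    Metric.ball (0 : E 4) r ⊆ ⋃ k : Fin 4, (capSet k 1 r ∪ capSet k (-1) r) := by
  intro x hx
  have h1 : ∃ k, ‖x‖ / 2 ≤ |x k| := by
    -- Four coordinates all smaller than ‖x‖/2 in absolute value would have squares with sum less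
    -- than ‖x‖².
    by_contra! h
    have h2 : ‖x‖ ^ 2 = ∑ k, x k ^ 2 := by
      rw [EuclideanSpace.norm_sq_eq]
      simp
    have h3 : ∀ k, x k ^ 2 < ‖x‖ ^ 2 / 4 := by
      intro k
      have := h k
      rw [← sq_abs]
      nlinarith [abs_nonneg (x k)]
    rw [Fin.sum_univ_four] at h2
    linarith [h3 0, h3 1, h3 2, h3 3]
  obtain ⟨k, hk⟩ := h1
  refine Set.mem_iUnion.2 ⟨k, ?_⟩
  rcases le_total 0 (x k) with h | h
  · left
    exact ⟨hx, by rwa [abs_of_nonneg h, ← one_mul (x k)] at hk⟩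
  · right
    exact ⟨hx, by rwa [abs_of_nonpos h, neg_eq_neg_one_mul] at hk⟩

/-- The Gagliardo-Nirenberg-Sobolev inequality `W^{1,1} ⊆ L^{4/3}` on balls. -/
lemma lintegral_ball_le : ∃ C : ℝ≥0∞, C ≠ ⊤ ∧
    ∀ r : ℝ, 1 / 2 ≤ r → ∀ g : E 4 → ℝ, ContDiff ℝ 1 g →
      ∫⁻ x in Metric.ball 0 r, ‖g x‖ₑ ^ (4 / 3 : ℝ) ≤
        C * (∫⁻ x in Metric.ball 0 r, (‖g x‖ₑ + ‖fderiv ℝ g x‖ₑ)) ^ (4 / 3 : ℝ) := by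
  choose C hC hCg using fun k => lintegral_capSet_le k (s := 1) (by simp)
  choose D hD hDg using fun k => lintegral_capSet_le k (s := -1) (by simp)
  refine ⟨∑ k, (C k + D k), ?_, ?_⟩
  · exact ENNReal.sum_ne_top.2 fun k _ => ENNReal.add_ne_top.2 ⟨hC k, hD k⟩
  · intro r hr g hg
    refine (lintegral_mono_set (ball_subset_iUnion_capSet r)).trans ?_
    refine (lintegral_iUnion_le _ _).trans ?_
    rw [tsum_fintype, Finset.sum_mul]
    refine Finset.sum_le_sum fun k _ => ?_
    refine (lintegral_union_le _ _ _).trans ?_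
    rw [add_mul]
    exact add_le_add (hCg k r hr g hg) (hDg k r hr g hg)

lemma eLpNorm_four_eq {α : Type*} [MeasurableSpace α] {μ : Measure α} (f : α → ℝ) :
    eLpNorm f 4 μ = (∫⁻ x, ‖f x‖ₑ ^ 4 ∂μ) ^ (1 / 4 : ℝ) := by
  rw [eLpNorm_eq_lintegral_rpow_enorm_toReal (by norm_num) (by norm_num)]
  norm_num

lemma eLpNorm_fderiv_le (f : E 4 → ℝ) (hf : ContDiff ℝ 1 f) (μ : Measure (E 4)) :
    eLpNorm (fderiv ℝ f) 2 μ ≤ ∑ k, eLpNorm (fun x => fderiv ℝ f x (e k)) 2 μ := by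
  have hdc : ∀ k, Continuous (fun x => fderiv ℝ f x (e k)) := fun k =>
    (hf.continuous_fderiv (by norm_num)).clm_apply continuous_const
  have h1 : eLpNorm (fderiv ℝ f) 2 μ ≤ eLpNorm (∑ k, fun x => ‖fderiv ℝ f x (e k)‖) 2 μ := by
    refine eLpNorm_mono fun x => ?_
    rw [Finset.sum_apply, Real.norm_of_nonneg (Finset.sum_nonneg fun k _ => norm_nonneg _)]
    refine ContinuousLinearMap.opNorm_le_bound _ (Finset.sum_nonneg fun k _ => norm_nonneg _) ?_
    intro v
    calc ‖fderiv ℝ f x v‖ = ‖∑ k, v k * fderiv ℝ f x (e k)‖ := by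
          conv_lhs => rw [← sum_coord_smul v]
          rw [map_sum]
          simp [e]
      _ ≤ ∑ k, ‖v k * fderiv ℝ f x (e k)‖ := norm_sum_le _ _
      _ ≤ ∑ k, ‖fderiv ℝ f x (e k)‖ * ‖v‖ := by
          refine Finset.sum_le_sum fun k _ => ?_
          rw [norm_mul, mul_comm]
          exact mul_le_mul_of_nonneg_left (PiLp.norm_apply_le v k) (norm_nonneg _)
      _ = _ := by rw [Finset.sum_mul]
  refine h1.trans ((eLpNorm_sum_le (fun k _ => (hdc k).norm.aestronglyMeasurable)
    (by norm_num)).trans (le_of_eq ?_))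
  exact Finset.sum_congr rfl fun k _ => eLpNorm_norm _

/-- The Sobolev inequality `W^{1,2} ⊆ L⁴` for smooth functions on balls. -/
lemma eLpNorm_four_ball_le : ∃ C : ℝ≥0∞, C ≠ ⊤ ∧
    ∀ r : ℝ, 1 / 2 ≤ r → ∀ f : E 4 → ℝ, ContDiff ℝ 1 f →
      eLpNorm f 4 (volume.restrict (Metric.ball 0 r)) ≤
        C * (eLpNorm f 2 (volume.restrict (Metric.ball 0 r)) +
          ∑ k, eLpNorm (fun x => fderiv ℝ f x (e k)) 2 (volume.restrict (Metric.ball 0 r))) := by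
  obtain ⟨C, hC, hCg⟩ := lintegral_ball_le
  refine ⟨C ^ (3 / 4 : ℝ) * 3, ENNReal.mul_ne_top
    (ENNReal.rpow_ne_top_of_nonneg (by norm_num) hC) (by norm_num), ?_⟩
  intro r hr f hf
  set μ := (volume : Measure (E 4)).restrict (Metric.ball 0 r) with hμ
  have hfc : Continuous f := hf.continuous
  have hdc : Continuous (fderiv ℝ f) := hf.continuous_fderiv (by norm_num)
  set N := eLpNorm f 2 μ + ∑ k, eLpNorm (fun x => fderiv ℝ f x (e k)) 2 μ with hN
  set X := ∫⁻ x, ‖f x‖ₑ ^ 4 ∂μ with hX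
  have hXtop : X ≠ ⊤ := by
    obtain ⟨M, hM⟩ := (isCompact_closedBall (0 : E 4) r).exists_bound_of_continuousOn
      hfc.continuousOn
    refine ne_top_of_le_ne_top ?_ (setLIntegral_mono' (g := fun _ => ENNReal.ofReal M ^ 4)
      Metric.isOpen_ball.measurableSet fun x hx => ?_)
    · rw [setLIntegral_const]
      exact ENNReal.mul_ne_top (by finiteness) measure_ball_lt_top.ne
    · gcongr
      rw [← ofReal_norm]
      exact ENNReal.ofReal_le_ofReal (hM x (Metric.ball_subset_closedBall hx))
  -- The cube is chosen because 3 · 4/3 = 4. Its derivative 3f²∇f is bounded in L¹ by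
  -- Cauchy–Schwarz, with ∫ f⁴ reappearing to the power 1/2.
  have h1 := hCg r hr (fun x => f x ^ 3) (hf.pow 3)
  rw [← hμ] at h1
  have h2 : ∫⁻ x, ‖f x ^ 3‖ₑ ^ (4 / 3 : ℝ) ∂μ = X := by
    refine lintegral_congr fun x => ?_
    rw [enorm_pow, ← ENNReal.rpow_natCast, ← ENNReal.rpow_mul, ← ENNReal.rpow_natCast]
    norm_num
  have hder : ∀ x, ‖fderiv ℝ (fun x => f x ^ 3) x‖ₑ = ‖f x‖ₑ ^ 2 * (3 * ‖fderiv ℝ f x‖ₑ) := by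
    intro x
    rw [fderiv_fun_pow _ ((hf.differentiable (by norm_num)) x), enorm_smul]
    have h3 : ‖(3 : ℕ) • f x ^ (3 - 1)‖ₑ = 3 * ‖f x‖ₑ ^ 2 := by
      rw [nsmul_eq_mul, enorm_mul, enorm_pow]
      simp [Real.enorm_eq_ofReal_abs]
    rw [h3]
    ring
  have h3 : ∫⁻ x, (‖f x ^ 3‖ₑ + ‖fderiv ℝ (fun x => f x ^ 3) x‖ₑ) ∂μ ≤
      X ^ (1 / 2 : ℝ) * (3 * N) := by
    have e1 : ∀ x, ‖f x ^ 3‖ₑ + ‖fderiv ℝ (fun x => f x ^ 3) x‖ₑ =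
        ‖f x‖ₑ ^ 2 * ‖f x‖ₑ + 3 * (‖f x‖ₑ ^ 2 * ‖fderiv ℝ f x‖ₑ) := by
      intro x
      rw [hder, enorm_pow]
      ring
    have hold : ∀ w : E 4 → ℝ≥0∞, Measurable w → ∫⁻ x, ‖f x‖ₑ ^ 2 * w x ∂μ ≤
        X ^ (1 / 2 : ℝ) * (∫⁻ x, w x ^ 2 ∂μ) ^ (1 / 2 : ℝ) := by
      intro w hw
      have h4 := ENNReal.lintegral_mul_le_Lp_mul_Lq μ Real.HolderConjugate.two_two
        (f := fun x => ‖f x‖ₑ ^ 2) (g := w) (hfc.enorm.measurable.pow_const 2).aemeasurable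
        hw.aemeasurable
      have h5 : ∀ x, (‖f x‖ₑ ^ 2) ^ (2 : ℝ) = ‖f x‖ₑ ^ 4 := by
        intro x
        rw [ENNReal.rpow_two, ← pow_mul]
      simpa only [Pi.mul_apply, h5, ENNReal.rpow_two] using h4
    have e2 : ∀ {F : Type} [NormedAddCommGroup F] (w : E 4 → F),
        (∫⁻ x, ‖w x‖ₑ ^ 2 ∂μ) ^ (1 / 2 : ℝ) = eLpNorm w 2 μ := by
      intro F _ w
      rw [← eLpNorm_two_sq, ← ENNReal.rpow_natCast, ← ENNReal.rpow_mul]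
      norm_num
    have m1 : Measurable (fun x => ‖f x‖ₑ ^ 2 * ‖f x‖ₑ) :=
      (hfc.enorm.measurable.pow_const 2).mul hfc.enorm.measurable
    have m2 : Measurable (fun x => ‖f x‖ₑ ^ 2 * ‖fderiv ℝ f x‖ₑ) :=
      (hfc.enorm.measurable.pow_const 2).mul hdc.enorm.measurable
    simp only [e1]
    rw [lintegral_add_left m1, lintegral_const_mul _ m2]
    calc _ ≤ X ^ (1 / 2 : ℝ) * eLpNorm f 2 μ + 3 * (X ^ (1 / 2 : ℝ) * eLpNorm (fderiv ℝ f) 2 μ) := by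
          rw [← e2, ← e2]
          exact add_le_add (hold _ hfc.enorm.measurable)
            (mul_le_mul_right (hold _ hdc.enorm.measurable) _)
      _ ≤ X ^ (1 / 2 : ℝ) * (3 * eLpNorm f 2 μ) + 3 * (X ^ (1 / 2 : ℝ) *
            ∑ k, eLpNorm (fun x => fderiv ℝ f x (e k)) 2 μ) := by
          gcongr
          · exact le_mul_of_one_le_left zero_le (by norm_num)
          · exact eLpNorm_fderiv_le f hf μ
      _ = _ := by rw [hN]; ring
  rw [h2] at h1
  have h4 : X ≤ C * (X ^ (1 / 2 : ℝ) * (3 * N)) ^ (4 / 3 : ℝ) :=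
    h1.trans (mul_le_mul_right (ENNReal.rpow_le_rpow h3 (by norm_num)) _)
  rw [eLpNorm_four_eq]
  rcases eq_or_ne X 0 with h0 | h0
  · rw [← hX, h0, ENNReal.zero_rpow_of_pos (by norm_num)]
    exact zero_le
  -- The right side of the estimate contains X to the power (1/2)(4/3) = 2/3. This factor can be
  -- cancelled because X is neither zero nor infinite.
  have h5 : X ^ (2 / 3 : ℝ) * X ^ (1 / 3 : ℝ) ≤ X ^ (2 / 3 : ℝ) * (C * (3 * N) ^ (4 / 3 : ℝ)) := by
    rw [← ENNReal.rpow_add _ _ h0 hXtop]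
    norm_num only
    rw [ENNReal.rpow_one]
    refine h4.trans (le_of_eq ?_)
    rw [ENNReal.mul_rpow_of_nonneg _ _ (by norm_num), ← ENNReal.rpow_mul]
    norm_num only
    ring
  have h6 : X ^ (1 / 3 : ℝ) ≤ C * (3 * N) ^ (4 / 3 : ℝ) :=
    (ENNReal.mul_le_mul_iff_right (by simp [h0, hXtop])
      (ENNReal.rpow_ne_top_of_nonneg (by norm_num) hXtop)).1 h5
  calc X ^ (1 / 4 : ℝ) = (X ^ (1 / 3 : ℝ)) ^ (3 / 4 : ℝ) := by
        rw [← ENNReal.rpow_mul]; norm_num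
    _ ≤ (C * (3 * N) ^ (4 / 3 : ℝ)) ^ (3 / 4 : ℝ) := ENNReal.rpow_le_rpow h6 (by norm_num)
    _ = C ^ (3 / 4 : ℝ) * 3 * N := by
        rw [ENNReal.mul_rpow_of_nonneg _ _ (by norm_num), ← ENNReal.rpow_mul]
        norm_num only
        rw [ENNReal.rpow_one, mul_assoc]

/-- The Sobolev inequality `W^{1,2} ⊆ L⁴` on the unit ball. -/
lemma sobolev_four : ∃ C : ℝ≥0∞, C ≠ ⊤ ∧ ∀ (f : E 4 → ℝ) (g : Fin 4 → E 4 → ℝ), MemL2 f →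
    (∀ k, HasWeakPartial k f (g k)) → (∀ k, MemL2 (g k)) →
      eLpNorm f 4 muB ≤ C * (eLpNorm f 2 muB + ∑ k, eLpNorm (g k) 2 muB) := by
  obtain ⟨C, hC, hCf⟩ := eLpNorm_four_ball_le
  refine ⟨C, hC, fun f g hf hw hg => ?_⟩
  set N := C * (eLpNorm f 2 muB + ∑ k, eLpNorm (g k) 2 muB) with hN
  -- As the constant is uniform in r, Fatou's lemma is used twice: along an a.e. convergent
  -- subsequence of the approximations on a fixed ball, then along balls that exhaust the unit ball.
  have hball : ∀ r : ℝ, 1 / 2 ≤ r → r < 1 →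
      eLpNorm f 4 (volume.restrict (Metric.ball 0 r)) ≤ N := by
    intro r hr hr1
    set μ := (volume : Measure (E 4)).restrict (Metric.ball 0 r) with hμ
    have hle : μ ≤ muB := Measure.restrict_mono (Metric.ball_subset_ball hr1.le) le_rfl
    obtain ⟨A, hA1, hA2, hA3⟩ := exists_smooth_approx hf hw hg hr1
    have hAm : ∀ n, AEStronglyMeasurable (A n) μ := fun n =>
      (hA1 n).continuous.aestronglyMeasurable
    have hdm : ∀ n k, AEStronglyMeasurable (fun x => fderiv ℝ (A n) x (e k)) μ := fun n k =>
      (((hA1 n).continuous_fderiv (by simp)).clm_apply continuous_const).aestronglyMeasurable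
    have hlim : Tendsto (fun n => C * ((eLpNorm (fun x => A n x - f x) 2 μ + eLpNorm f 2 muB) +
        ∑ k, (eLpNorm (fun x => fderiv ℝ (A n) x (e k) - g k x) 2 μ + eLpNorm (g k) 2 muB)))
        atTop (𝓝 N) := by
      have t1 := (hA2.add_const (eLpNorm f 2 muB)).add (tendsto_finsetSum Finset.univ
        fun k _ => (hA3 k).add_const (eLpNorm (g k) 2 muB))
      simp only [zero_add] at t1
      exact ENNReal.Tendsto.const_mul t1 (Or.inr hC)
    have htri : ∀ {p q : E 4 → ℝ}, AEStronglyMeasurable p μ → MemL2 q →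
        eLpNorm p 2 μ ≤ eLpNorm (fun x => p x - q x) 2 μ + eLpNorm q 2 muB := by
      intro p q hp hq
      have hq' : AEStronglyMeasurable q μ := hq.1.mono_measure hle
      have h1 := eLpNorm_add_le (p := 2) (hp.sub hq') hq' (by norm_num)
      rw [sub_add_cancel] at h1
      exact h1.trans (add_le_add le_rfl (eLpNorm_mono_measure _ hle))
    have hbound : ∀ n, eLpNorm (A n) 4 μ ≤
        C * ((eLpNorm (fun x => A n x - f x) 2 μ + eLpNorm f 2 muB) +
        ∑ k, (eLpNorm (fun x => fderiv ℝ (A n) x (e k) - g k x) 2 μ + eLpNorm (g k) 2 muB)) := by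
      intro n
      refine (hCf r hr (A n) (contDiff_infty.1 (hA1 n) 1)).trans (mul_le_mul_right ?_ _)
      exact add_le_add (htri (hAm n) hf) (Finset.sum_le_sum fun k _ => htri (hdm n k) (hg k))
    obtain ⟨ns, hns, hae⟩ := (tendstoInMeasure_of_tendsto_eLpNorm (by norm_num) hAm
      (hf.1.mono_measure hle) hA2).exists_seq_tendsto_ae
    refine (Lp.eLpNorm_lim_le_liminf_eLpNorm (fun n => hAm (ns n)) f hae).trans ?_
    rw [← (hlim.comp hns.tendsto_atTop).liminf_eq]
    exact liminf_le_liminf (Eventually.of_forall fun n => hbound (ns n))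
  set ρ : ℕ → ℝ := fun n => 1 - 1 / ((n : ℝ) + 2) with hρ
  have hρ1 : ∀ n, 1 / 2 ≤ ρ n ∧ ρ n < 1 := by
    intro n
    have h0 : (0 : ℝ) ≤ n := Nat.cast_nonneg n
    have h1 : 1 / ((n : ℝ) + 2) ≤ 1 / 2 := one_div_le_one_div_of_le (by norm_num) (by linarith)
    have h2 : 0 < 1 / ((n : ℝ) + 2) := by positivity
    constructor <;> simp only [hρ] <;> linarith
  have hρt : Tendsto ρ atTop (𝓝 1) := by
    have h1 : Tendsto (fun n : ℕ => 1 / ((n : ℝ) + 2)) atTop (𝓝 0) := by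
      refine Tendsto.div_atTop tendsto_const_nhds ?_
      exact tendsto_atTop_add_const_right _ _ tendsto_natCast_atTop_atTop
    have h2 := h1.const_sub 1
    rwa [sub_zero] at h2
  have hmeas : ∀ n, MeasurableSet (Metric.ball (0 : E 4) (ρ n)) := fun n =>
    Metric.isOpen_ball.measurableSet
  refine (Lp.eLpNorm_lim_le_liminf_eLpNorm (f := fun n => (Metric.ball 0 (ρ n)).indicator f)
    (fun n => hf.1.indicator (hmeas n)) f ?_).trans ?_
  · refine (ae_restrict_iff' measurableSet_B4).2 (Eventually.of_forall fun x hx => ?_)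
    refine tendsto_const_nhds.congr' ?_
    have hx1 : ‖x‖ < 1 := mem_ball_zero_iff.1 hx
    filter_upwards [hρt.eventually (lt_mem_nhds hx1)] with n hn
    rw [Set.indicator_of_mem (mem_ball_zero_iff.2 hn)]
  · refine liminf_le_of_le (by isBoundedDefault) fun b hb => ?_
    obtain ⟨n, hn⟩ := hb.exists
    refine hn.trans ?_
    rw [eLpNorm_indicator_eq_eLpNorm_restrict (hmeas n), muB, Measure.restrict_restrict (hmeas n),
      Set.inter_eq_left.2 (show Metric.ball 0 (ρ n) ⊆ B4 from
        Metric.ball_subset_ball (hρ1 n).2.le)]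
    exact hball _ (hρ1 n).1 (hρ1 n).2

end Sobolev

/-! ### Smoothness of the nearest point projection -/

section NearestPoint

variable {m : ℕ}

lemma exists_isNearestPoint {N : Set (E m)} (hN : IsCompact N) (hne : N.Nonempty) (y : E m) :
    ∃ p, IsNearestPoint N y p := by
  obtain ⟨p, hp, h⟩ := hN.exists_infDist_eq_dist hne y
  exact ⟨p, hp, fun q hq => h ▸ Metric.infDist_le_dist_of_mem hq⟩

lemma isNearestPoint_self {N : Set (E m)} {p : E m} (hp : p ∈ N) : IsNearestPoint N p p :=
  ⟨hp, fun q _ => by rw [dist_self]; exact dist_nonneg⟩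

/-- The adjoint as a real linear map. -/
def adjointL (m c : ℕ) : (E m →L[ℝ] E c) →L[ℝ] (E c →L[ℝ] E m) :=
  LinearMap.toContinuousLinearMap
    { toFun := fun A => ContinuousLinearMap.adjoint A
      map_add' := fun A B => by simp
      map_smul' := fun r A => by simp }

lemma adjointL_inner {c : ℕ} (A : E m →L[ℝ] E c) (l : E c) (x : E m) :
    inner ℝ (adjointL m c A l) x = inner ℝ l (A x) :=
  ContinuousLinearMap.adjoint_inner_left A x l

/-- Lagrange multipliers for the squared distance to y on the zero set of f. The multiplier of the
distance cannot vanish: the other one would then annihilate the range of f'(q), which is everything.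
-/
lemma exists_multiplier {c : ℕ} {N U : Set (E m)} {f : E m → E c} (hU : IsOpen U)
    (hf : ContDiffOn ℝ ∞ f U) (hNU : N ∩ U = {y ∈ U | f y = 0}) {q : E m} (hqU : q ∈ U)
    (hs : Function.Surjective (fderiv ℝ f q)) {y : E m} (hq : IsNearestPoint N y q) :
    ∃ l : E c, y - q = adjointL m c (fderiv ℝ f q) l := by
  have hfq : ContDiffAt ℝ ∞ f q := hf.contDiffAt (hU.mem_nhds hqU)
  have hf0 : f q = 0 := by
    have : q ∈ N ∩ U := ⟨hq.1, hqU⟩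
    rw [hNU] at this
    exact this.2
  have hφ : HasStrictFDerivAt (fun x : E m => ‖x - y‖ ^ 2) (2 • (innerSL ℝ (q - y))) q := by
    have h1 : HasStrictFDerivAt (fun x : E m => x - y) (ContinuousLinearMap.id ℝ (E m)) q :=
      (hasStrictFDerivAt_id q).sub_const y
    have h2 := (hasStrictFDerivAt_norm_sq (q - y)).comp q h1
    exact h2
  have hext : IsLocalExtrOn (fun x : E m => ‖x - y‖ ^ 2) {x | f x = f q} q := by
    left
    filter_upwards [self_mem_nhdsWithin, nhdsWithin_le_nhds (hU.mem_nhds hqU)] with x hx hxU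
    have hxN : x ∈ N ∩ U := by
      rw [hNU]
      exact ⟨hxU, by rw [show f x = f q from hx, hf0]⟩
    have := hq.2 x hxN.1
    rw [dist_eq_norm, dist_eq_norm, norm_sub_rev y q, norm_sub_rev y x] at this
    exact pow_le_pow_left₀ (norm_nonneg _) this 2
  obtain ⟨Λ, Λ₀, hne, hsum⟩ := hext.exists_linear_map_of_hasStrictFDerivAt
    (hfq.hasStrictFDerivAt (by simp)) hφ
  have hΛ₀ : Λ₀ ≠ 0 := by
    intro h0
    refine hne ?_
    simp only [h0, zero_smul, add_zero] at hsum
    rw [h0, Prod.mk_eq_zero]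
    refine ⟨LinearMap.ext fun w => ?_, rfl⟩
    obtain ⟨x, rfl⟩ := hs w
    exact hsum x
  set l₀ : E c := (InnerProductSpace.toDual ℝ (E c)).symm (LinearMap.toContinuousLinearMap Λ)
    with hl₀
  have hl : ∀ w, inner ℝ l₀ w = Λ w := by
    intro w
    rw [hl₀, InnerProductSpace.toDual_symm_apply]
    rfl
  refine ⟨(2 * Λ₀)⁻¹ • l₀, ext_inner_right ℝ fun x => ?_⟩
  rw [adjointL_inner, inner_smul_left, hl]
  have h1 := hsum x
  simp only [smul_apply, innerSL_apply_apply, nsmul_eq_mul, Nat.cast_ofNat, smul_eq_mul] at h1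
  have h2 : inner ℝ (y - q) x = - inner ℝ (q - y) x := by
    rw [← inner_neg_left, neg_sub]
  rw [h2]
  have h3 : Λ (fderiv ℝ f q x) = - (2 * Λ₀ * inner ℝ (q - y) x) := by linarith
  rw [h3]
  simp only [map_inv₀, conj_trivial]
  field_simp

/-- The adjoint of a surjection is injective, hence bounded below; perturbing the point costs at
most ‖l‖/2, whence the factor 2. The bound keeps the multipliers of nearest points small. -/
lemma exists_adjoint_bound {c : ℕ} {f' : E m → (E m →L[ℝ] E c)} {p : E m} (hf : ContinuousAt f' p)
    (hs : Function.Surjective (f' p)) :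
    ∃ K : ℝ, 0 < K ∧ ∀ᶠ q in 𝓝 p, ∀ l : E c, ‖l‖ ≤ K * ‖adjointL m c (f' q) l‖ := by
  have hker : LinearMap.ker (adjointL m c (f' p) : E c →ₗ[ℝ] E m) = ⊥ := by
    rw [LinearMap.ker_eq_bot']
    intro l hl
    obtain ⟨x, hx⟩ := hs l
    have h1 := adjointL_inner (f' p) l x
    have h2 : adjointL m c (f' p) l = 0 := hl
    rw [h2, inner_zero_left, hx] at h1
    exact inner_self_eq_zero.1 h1.symm
  obtain ⟨K, hK0, hK⟩ := LinearMap.exists_antilipschitzWith _ hker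
  have hK0' : (0 : ℝ) < K := by exact_mod_cast hK0
  refine ⟨2 * K, by positivity, ?_⟩
  have hcont : ContinuousAt (fun q => adjointL m c (f' q)) p :=
    (adjointL m c).continuous.continuousAt.comp hf
  filter_upwards [Metric.continuousAt_iff'.1 hcont (1 / (2 * K)) (by positivity)] with q hq l
  have h1 : ‖l‖ ≤ K * ‖adjointL m c (f' p) l‖ := by
    have := hK.le_mul_dist l 0
    simpa using this
  have h2 : ‖adjointL m c (f' p) l‖ ≤ ‖adjointL m c (f' q) l‖ + 1 / (2 * K) * ‖l‖ := by
    have h3 : adjointL m c (f' p) l = adjointL m c (f' q) l -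
        (adjointL m c (f' q) - adjointL m c (f' p)) l := by
      simp
    rw [h3]
    refine (norm_sub_le _ _).trans (add_le_add le_rfl ?_)
    refine (ContinuousLinearMap.le_opNorm _ _).trans ?_
    rw [dist_eq_norm] at hq
    exact mul_le_mul_of_nonneg_right hq.le (norm_nonneg _)
  have h4 : K * (1 / (2 * K) * ‖l‖) = ‖l‖ / 2 := by field_simp
  nlinarith

/-- Near a point of a closed submanifold, the nearest point projection is smooth, and its derivative
at the point is the orthogonal projection to the tangent space. -/
lemma exists_local_projection {n : ℕ} {N : Set (E m)} (hN : IsClosedSubmanifold n N) {p : E m}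
    (hp : p ∈ N) :
    ∃ g : E m → E m, ContDiffAt ℝ ∞ g p ∧ (∀ᶠ y in 𝓝 p, ∀ q, IsNearestPoint N y q → q = g y) ∧
      (tangentSpaceAt N p).starProjection = fderiv ℝ g p := by
  obtain ⟨c, -, hloc⟩ := hN.locally_zero_set
  obtain ⟨U, f, hU, hpU, hf, hsurj, hNU⟩ := hloc p hp
  have hne : N.Nonempty := ⟨p, hp⟩
  have hfp : ContDiffAt ℝ ∞ f p := hf.contDiffAt (hU.mem_nhds hpU)
  have hf0 : f p = 0 := by
    have : p ∈ N ∩ U := ⟨hp, hpU⟩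
    rw [hNU] at this
    exact this.2
  have hf' : ContDiffAt ℝ ∞ (fderiv ℝ f) p := hfp.fderiv_right (m := ∞) (by simp)
  set A := fderiv ℝ f p with hA
  set As := adjointL m c A with hAs
  -- The equation Φ(x, l) = (y, 0) is the system of the multiplier rule, and a nearest point solves
  -- it. At (p, 0) the derivative of Φ is invertible, so the first component of the local inverse is
  -- the candidate for the projection.
  set Φ : E m × E c → E m × E c := fun z => (z.1 + adjointL m c (fderiv ℝ f z.1) z.2, f z.1) with hΦ
  have hΦs : ContDiffAt ℝ ∞ Φ (p, 0) := by
    have h1 : ContDiffAt ℝ ∞ (fun z : E m × E c => adjointL m c (fderiv ℝ f z.1)) (p, 0) :=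
      (adjointL m c).contDiff.contDiffAt.comp (p, (0 : E c)) (hf'.comp (p, (0 : E c)) contDiffAt_fst)
    exact (contDiffAt_fst.add (h1.clm_apply contDiffAt_snd)).prodMk
      (hfp.comp (p, (0 : E c)) contDiffAt_fst)
  let Φ' : E m × E c →L[ℝ] E m × E c :=
    (ContinuousLinearMap.fst ℝ (E m) (E c) + As.comp (ContinuousLinearMap.snd ℝ (E m) (E c))).prod
      (A.comp (ContinuousLinearMap.fst ℝ (E m) (E c)))
  have hΦ'a : ∀ z, Φ' z = (z.1 + As z.2, A z.1) := fun z => rfl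
  have hΦd : HasFDerivAt Φ Φ' (p, 0) := by
    have h1 : HasFDerivAt (fun z : E m × E c => adjointL m c (fderiv ℝ f z.1))
        (((adjointL m c).comp (fderiv ℝ (fderiv ℝ f) p)).comp
          (ContinuousLinearMap.fst ℝ (E m) (E c))) (p, 0) := by
      refine HasFDerivAt.comp (p, (0 : E c)) (g := fun x => adjointL m c (fderiv ℝ f x)) ?_
        hasFDerivAt_fst
      exact (adjointL m c).hasFDerivAt.comp p (hf'.differentiableAt (by simp)).hasFDerivAt
    have h2 := h1.clm_apply (hasFDerivAt_snd (𝕜 := ℝ) (p := (p, (0 : E c))))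
    have h3 := ((hasFDerivAt_fst (𝕜 := ℝ) (p := (p, (0 : E c)))).add h2).prodMk
      (HasFDerivAt.comp (p, (0 : E c)) (g := f) (hfp.differentiableAt (by simp)).hasFDerivAt
        hasFDerivAt_fst)
    refine h3.congr_fderiv ?_
    ext z <;> simp [Φ', hA, hAs]
  have hAAs : ∀ l, A (As l) = 0 → l = 0 := by
    intro l hl
    have h1 : inner ℝ (As l) (As l) = 0 := by rw [hAs, adjointL_inner, ← hAs, hl, inner_zero_right]
    obtain ⟨x, hx⟩ := hsurj p hpU l
    have h2 : inner ℝ l l = 0 := by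
      have h3 := adjointL_inner A l x
      rw [← hAs, inner_self_eq_zero.1 h1, inner_zero_left, hA, hx] at h3
      exact h3.symm
    exact inner_self_eq_zero.1 h2
  have hinj : Function.Injective Φ' := by
    rw [injective_iff_map_eq_zero]
    intro z hz
    rw [hΦ'a, Prod.mk_eq_zero] at hz
    have h1 : A (As z.2) = 0 := by
      have := congrArg A hz.1
      rwa [map_add, hz.2, zero_add, map_zero] at this
    have h2 := hAAs _ h1
    rw [h2, map_zero, add_zero] at hz
    exact Prod.ext hz.1 h2
  let Ψ : (E m × E c) ≃L[ℝ] (E m × E c) :=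
    (LinearEquiv.ofInjectiveEndo (Φ' : E m × E c →ₗ[ℝ] E m × E c) hinj).toContinuousLinearEquiv
  have hΨ : (Ψ : E m × E c →L[ℝ] E m × E c) = Φ' := by ext z <;> rfl
  have hΦd' : HasFDerivAt Φ (Ψ : E m × E c →L[ℝ] E m × E c) (p, 0) := hΨ ▸ hΦd
  have hΦp : Φ (p, 0) = (p, 0) := by simp [hΦ, hf0]
  have hstrict := hΦs.hasStrictFDerivAt' hΦd' (by simp)
  set G := hΦs.localInverse hΦd' (by simp) with hG
  have hGs : ContDiffAt ℝ ∞ G (p, 0) := hΦp ▸ hΦs.to_localInverse hΦd' (by simp)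
  have hGd : HasFDerivAt G (Ψ.symm : E m × E c →L[ℝ] E m × E c) (p, 0) :=
    hΦp ▸ hstrict.to_localInverse.hasFDerivAt
  have hGl : ∀ᶠ z in 𝓝 (p, (0 : E c)), G (Φ z) = z := hstrict.eventually_left_inverse
  set g : E m → E m := fun y => (G (y, 0)).1 with hg
  have hgs : ContDiffAt ℝ ∞ g p :=
    contDiffAt_fst.comp p (hGs.comp p (contDiffAt_id.prodMk contDiffAt_const))
  have hgd : HasFDerivAt g ((ContinuousLinearMap.fst ℝ (E m) (E c)).comp
      ((Ψ.symm : E m × E c →L[ℝ] E m × E c).comp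
        ((ContinuousLinearMap.id ℝ (E m)).prod (0 : E m →L[ℝ] E c)))) p := by
    have h1 : HasFDerivAt (fun y : E m => (y, (0 : E c)))
        ((ContinuousLinearMap.id ℝ (E m)).prod (0 : E m →L[ℝ] E c)) p :=
      (hasFDerivAt_id p).prodMk (hasFDerivAt_const 0 p)
    exact (hasFDerivAt_fst (p := G (p, 0))).comp p (hGd.comp p h1)
  -- A nearest point q of y has distance at most 2|y − p| from p, and its multiplier is bounded by
  -- K|y − q| ≤ K|y − p|. So (q, l) lies where the local inverse is a left inverse of Φ, which
  -- forces q = g(y).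
  have hproj : ∀ᶠ y in 𝓝 p, ∀ q, IsNearestPoint N y q → q = g y := by
    obtain ⟨K, hK0, hK⟩ := exists_adjoint_bound hf'.continuousAt (hsurj p hpU)
    obtain ⟨ε₁, hε₁, h1⟩ := Metric.eventually_nhds_iff.1 (hK.and (hU.mem_nhds hpU))
    obtain ⟨ε₂, hε₂, h2⟩ := Metric.eventually_nhds_iff.1 hGl
    filter_upwards [Metric.ball_mem_nhds p (show 0 < min (ε₁ / 2) (min (ε₂ / 2) (ε₂ / K)) by
      positivity)] with y hy q hq
    rw [Metric.mem_ball, lt_min_iff, lt_min_iff] at hy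
    have hyq : dist y q ≤ dist y p := hq.2 p hp
    have hqp : dist q p ≤ 2 * dist y p := by
      have := dist_triangle_left q p y
      linarith
    obtain ⟨hb, hqU⟩ := h1 (show dist q p < ε₁ by linarith)
    obtain ⟨l, hl⟩ := exists_multiplier hU hf hNU hqU (hsurj q hqU) hq
    have hlb : ‖l‖ < ε₂ := by
      have h3 := hb l
      rw [← hl, ← dist_eq_norm] at h3
      have h4 : K * dist y q ≤ K * dist y p := mul_le_mul_of_nonneg_left hyq hK0.le
      have h5 : K * dist y p < ε₂ := by
        rw [mul_comm]
        exact (lt_div_iff₀ hK0).1 hy.2.2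
      linarith
    have h3 : G (Φ (q, l)) = (q, l) := by
      refine h2 ?_
      rw [Prod.dist_eq, max_lt_iff]
      exact ⟨by simp only; linarith, by simpa [dist_eq_norm] using hlb⟩
    have hfq : f q = 0 := by
      have : q ∈ N ∩ U := ⟨hq.1, hqU⟩
      rw [hNU] at this
      exact this.2
    have h4 : Φ (q, l) = (y, 0) := by
      simp only [hΦ, ← hl, hfq]
      simp
    rw [h4] at h3
    simp only [hg, h3]
  have hgp : g p = p := (hproj.self_of_nhds p (isNearestPoint_self hp)).symm
  -- Inverting the derivative of Φ splits y into a part in the kernel of A and a part in the range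
  -- of its adjoint, which are orthogonal.
  have hker : ∀ y, A (fderiv ℝ g p y) = 0 ∧ ∃ l, y - fderiv ℝ g p y = As l := by
    intro y
    rw [hgd.fderiv]
    have h1 : Φ' (Ψ.symm (y, 0)) = (y, 0) := by
      rw [← hΨ]
      exact Ψ.apply_symm_apply _
    rw [hΦ'a, Prod.mk.injEq] at h1
    refine ⟨h1.2, (Ψ.symm (y, 0)).2, ?_⟩
    rw [sub_eq_iff_eq_add, add_comm]
    exact h1.1.symm
  have hT1 : ∀ v ∈ tangentSpaceAt N p, A v = 0 := by
    intro v hv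
    have hle : tangentSpaceAt N p ≤ LinearMap.ker (A : E m →ₗ[ℝ] E c) := by
      refine Submodule.span_le.2 ?_
      rintro v ⟨γ, hγ, hγ0, hγN, rfl⟩
      have hdγ := (hγ.differentiableAt (by simp)).hasDerivAt
      have h1 : HasDerivAt (fun t => f (γ t)) (A (deriv γ 0)) 0 := by
        refine HasFDerivAt.comp_hasDerivAt (0 : ℝ) (l := f) ?_ hdγ
        rw [hγ0]
        exact (hfp.differentiableAt (by simp)).hasFDerivAt
      have h2 : (fun t => f (γ t)) =ᶠ[𝓝 0] fun _ => 0 := by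
        have h3 : ∀ᶠ t in 𝓝 (0 : ℝ), γ t ∈ U :=
          hγ.continuousAt.eventually (by rw [hγ0]; exact hU.mem_nhds hpU)
        filter_upwards [hγN, h3] with t h4 h5
        have : γ t ∈ N ∩ U := ⟨h4, h5⟩
        rw [hNU] at this
        exact this.2
      exact h1.unique ((hasDerivAt_const (0 : ℝ) (0 : E c)).congr_of_eventuallyEq h2)
    exact hle hv
  -- The curve t ↦ g(p + ty) stays in N for small t, because nearest points exist and are given by g
  -- there.
  have hT2 : ∀ y, fderiv ℝ g p y ∈ tangentSpaceAt N p := by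
    intro y
    refine Submodule.subset_span ⟨fun t => g (p + t • y), ?_, ?_, ?_, ?_⟩
    · refine ContDiffAt.comp (0 : ℝ) (g := g) ?_ ?_
      · simpa using hgs
      · exact (contDiff_const.add (contDiff_id.smul contDiff_const)).contDiffAt
    · simpa using hgp
    · have hc : ContinuousAt (fun t : ℝ => p + t • y) 0 := by fun_prop
      have h1 : ∀ᶠ t in 𝓝 (0 : ℝ), ∀ q, IsNearestPoint N (p + t • y) q → q = g (p + t • y) :=
        hc.eventually (by simpa using hproj)
      filter_upwards [h1] with t ht
      obtain ⟨q, hq⟩ := exists_isNearestPoint hN.compact hne (p + t • y)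
      rw [← ht q hq]
      exact hq.1
    · have h1 : HasDerivAt (fun t : ℝ => p + t • y) y 0 := by
        simpa using ((hasDerivAt_id (0 : ℝ)).smul_const y).const_add p
      have h2 : HasDerivAt (fun t : ℝ => g (p + t • y)) (fderiv ℝ g p y) 0 := by
        refine HasFDerivAt.comp_hasDerivAt (0 : ℝ) (l := g) ?_ h1
        simpa using (hgs.differentiableAt (by simp)).hasFDerivAt
      exact h2.deriv
  refine ⟨g, hgs, hproj, ?_⟩
  ext1 y
  refine Submodule.eq_starProjection_of_mem_of_inner_eq_zero (hT2 y) fun w hw => ?_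
  obtain ⟨l, hl⟩ := (hker y).2
  rw [hl, hAs, adjointL_inner, hT1 w hw, inner_zero_right]

/-- The nearest point projection of a closed submanifold, cut off far from it. -/
lemma exists_projection {n : ℕ} {N : Set (E m)} (hN : IsClosedSubmanifold n N)
    (hne : N.Nonempty) :
    ∃ P : E m → E m, ContDiff ℝ 6 P ∧ HasCompactSupport P ∧
      (∃ δ : ℝ, 0 < δ ∧ ∀ p ∈ N, ∀ y, dist y p < δ → ∀ q, IsNearestPoint N y q → q = P y) ∧
      ∀ p ∈ N, (tangentSpaceAt N p).starProjection = fderiv ℝ P p := by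
  choose ν hν using exists_isNearestPoint hN.compact hne
  -- The selection ν is arbitrary far from N. The set O collects the points where it is regular and
  -- locally the only choice; a cut-off function supported there removes the rest.
  set O : Set (E m) := {y | ContDiffAt ℝ 6 ν y} ∩ interior {y | ∀ q, IsNearestPoint N y q → q = ν y}
    with hO
  have hOopen : IsOpen O := by
    refine IsOpen.inter (isOpen_iff_mem_nhds.2 fun y hy => ?_) isOpen_interior
    -- Being of class C^k at a point is an open condition for finite k, but not for k = ∞. This is
    -- why a finite order of smoothness is fixed.
    exact ContDiffAt.eventually hy (by decide)
  have hev : ∀ p ∈ N, ∃ g : E m → E m, ContDiffAt ℝ ∞ g p ∧ ν =ᶠ[𝓝 p] g ∧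
      (∀ᶠ y in 𝓝 p, ∀ q, IsNearestPoint N y q → q = ν y) ∧
      (tangentSpaceAt N p).starProjection = fderiv ℝ g p := by
    intro p hp
    obtain ⟨g, hg, hev, ht⟩ := exists_local_projection hN hp
    have h1 : ν =ᶠ[𝓝 p] g := by
      filter_upwards [hev] with y hy
      exact hy _ (hν y)
    refine ⟨g, hg, h1, ?_, ht⟩
    filter_upwards [hev, h1] with y hy hy1 q hq
    rw [hy1, hy q hq]
  have hNO : N ⊆ O := by
    intro p hp
    obtain ⟨g, hg, h1, h2, -⟩ := hev p hp
    exact ⟨(contDiffAt_infty.1 hg 6).congr_of_eventuallyEq h1, mem_interior_iff_mem_nhds.2 h2⟩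
  obtain ⟨δ, hδ, hδO⟩ := hN.compact.exists_cthickening_subset_open hOopen hNO
  set t := Metric.cthickening δ N with ht
  have htc : IsCompact t := hN.compact.cthickening
  obtain ⟨χ, hχ1, hχ0, -⟩ := exists_contMDiffMap_one_nhds_of_subset_interior
    (modelWithCornersSelf ℝ (E m)) (n := (6 : ℕ∞)) (s := N) (t := t) hN.compact.isClosed
    ((Metric.self_subset_thickening hδ N).trans
      (interior_maximal (Metric.thickening_subset_cthickening δ N) Metric.isOpen_thickening))
  have hχs : ContDiff ℝ 6 χ := χ.contMDiff.contDiff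
  refine ⟨fun y => χ y • ν y, ?_, ?_, ?_, ?_⟩
  · rw [contDiff_iff_contDiffAt]
    intro y
    by_cases hy : y ∈ t
    · exact hχs.contDiffAt.smul (hδO hy).1
    · refine contDiffAt_const (c := (0 : E m)) |>.congr_of_eventuallyEq ?_
      filter_upwards [htc.isClosed.isOpen_compl.mem_nhds hy] with z hz
      rw [hχ0 z hz, zero_smul]
  · refine HasCompactSupport.intro htc fun y hy => ?_
    rw [hχ0 y hy, zero_smul]
  · obtain ⟨V, hV, hNV, hVχ⟩ := eventually_nhdsSet_iff_exists.1 hχ1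
    obtain ⟨δ', hδ', h1⟩ := hN.compact.exists_thickening_subset_open (hV.inter hOopen)
      (Set.subset_inter hNV hNO)
    refine ⟨δ', hδ', fun p hp y hy q hq => ?_⟩
    have h2 := h1 (Metric.mem_thickening_iff.2 ⟨p, hp, hy⟩)
    simp only [hVχ y h2.1, one_smul]
    exact interior_subset h2.2.2 q hq
  · intro p hp
    obtain ⟨g, -, h1, -, h2⟩ := hev p hp
    rw [h2]
    refine Filter.EventuallyEq.fderiv_eq ?_
    have h3 : ∀ᶠ y in 𝓝 p, χ y = 1 := hχ1.filter_mono (nhds_le_nhdsSet hp)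
    filter_upwards [h1, h3] with y hy hy3
    rw [hy3, one_smul, hy]

end NearestPoint

/-! ### Maps with two weak derivatives and their compositions -/

section SecondOrder

open scoped ENNReal

instance : ENNReal.HolderTriple 4 4 2 := ⟨by
  have h : (4 : ℝ≥0∞) = 2 * 2 := by norm_num
  rw [h, ENNReal.mul_inv (by simp) (by simp), ← mul_add, ENNReal.inv_two_add_inv_two, mul_one]⟩

variable {m : ℕ} {F : Type*} [NormedAddCommGroup F] [NormedSpace ℝ F] [CompleteSpace F]

lemma memLp_pi_coord {p : ℝ≥0∞} {f : E 4 → E m} (h : ∀ i, MemLp (fun x => f x i) p muB) :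
    MemLp f p muB := by
  have h1 : MemLp (fun x => ∑ i, f x i • (EuclideanSpace.single i (1 : ℝ) : E m)) p muB := by
    refine memLp_finsetSum _ fun i _ => ?_
    exact ((ContinuousLinearMap.toSpanSingleton ℝ
      (EuclideanSpace.single i (1 : ℝ) : E m)).comp_memLp' (h i))
  simpa only [sum_coord_smul] using h1

lemma MemLp.coord {p : ℝ≥0∞} {f : E 4 → E m} (h : MemLp f p muB) (i : Fin m) :
    MemLp (fun x => f x i) p muB :=
  (EuclideanSpace.proj i : E m →L[ℝ] ℝ).comp_memLp' h

lemma memLp_four_of_weakPartial {f : E 4 → ℝ} {g : Fin 4 → E 4 → ℝ} (hf : MemL2 f)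
    (hw : ∀ k, HasWeakPartial k f (g k)) (hg : ∀ k, MemL2 (g k)) : MemLp f 4 muB := by
  obtain ⟨C, hC, h⟩ := sobolev_four
  refine ⟨hf.1, (h f g hf hw hg).trans_lt (ENNReal.mul_lt_top hC.lt_top ?_)⟩
  exact ENNReal.add_lt_top.2 ⟨hf.2, ENNReal.sum_lt_top.2 fun k _ => (hg k).2⟩

/-- `z` has weak derivatives `a k` of first order in `L⁴` and `b j k` of second order in `L²`. -/
structure HasSecondOrder (z : E 4 → E m) (a : Fin 4 → E 4 → E m) (b : Fin 4 → Fin 4 → E 4 → E m) :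
    Prop where
  mem : MemL2 z
  mem_a : ∀ k, MemLp (a k) 4 muB
  mem_b : ∀ j k, MemL2 (b j k)
  partial_z : ∀ k, HasWeakPartial k z (a k)
  partial_a : ∀ j k, HasWeakPartial j (a k) (b j k)

lemma HasSecondOrder.mem_a2 {z : E 4 → E m} {a : Fin 4 → E 4 → E m} {b : Fin 4 → Fin 4 → E 4 → E m}
    (h : HasSecondOrder z a b) (k : Fin 4) : MemL2 (a k) :=
  (h.mem_a k).mono_exponent (by norm_num)

/-- The first derivatives are in W^{1,2}, so the Sobolev embedding, applied to each coordinate, puts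
them in L⁴. -/
lemma MemW22.hasSecondOrder {z : E 4 → E m} (h : MemW22 z) :
    ∃ b, HasSecondOrder z (fun k => weakPartial k z) b := by
  have h1 : ∀ k, HasWeakPartial k z (weakPartial k z) := fun k => by
    obtain ⟨g, hg, -⟩ := h.2 k
    exact hg.weakPartial
  have h2 : ∀ k, MemL2 (weakPartial k z) ∧ ∀ j, ∃ b, HasWeakPartial j (weakPartial k z) b ∧
      MemL2 b := by
    intro k
    obtain ⟨g, hg, hg2, hg3⟩ := h.2 k
    have hae := hg.weakPartial_ae.symm
    refine ⟨MemLp.ae_eq hae hg2, fun j => ?_⟩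
    obtain ⟨b, hb, hb2⟩ := hg3 j
    exact ⟨b, hb.congr hae (ae_eq_refl _), hb2⟩
  choose b hb hb2 using fun k => (h2 k).2
  refine ⟨fun j k => b k j, h.1, fun k => ?_, fun j k => hb2 k j, h1, fun j k => hb k j⟩
  refine memLp_pi_coord fun i => ?_
  exact memLp_four_of_weakPartial (MemLp.coord (h2 k).1 i) (fun j => (hb k j).coord i)
    fun j => MemLp.coord (hb2 k j) i

lemma memLp_of_continuous_bdd {p : ℝ≥0∞} {f : E 4 → F} (hf : Continuous f)
    (hb : ∃ C, 0 ≤ C ∧ ∀ x, ‖f x‖ ≤ C) : MemLp f p muB := by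
  obtain ⟨C, -, hC⟩ := hb
  exact MemLp.of_bound hf.aestronglyMeasurable C (Eventually.of_forall hC)

lemma IsTest.hasSecondOrder {φ : E 4 → E m} (h : IsTest φ) :
    HasSecondOrder φ (fun k x => fderiv ℝ φ x (e k))
      (fun j k x => fderiv ℝ (fun y => fderiv ℝ φ y (e k)) x (e j)) where
  mem := memLp_of_continuous_bdd h.continuous h.bounded
  mem_a _ := memLp_of_continuous_bdd (h.fderiv_apply _).continuous (h.fderiv_apply _).bounded
  mem_b _ _ := memLp_of_continuous_bdd ((h.fderiv_apply _).fderiv_apply _).continuous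
    ((h.fderiv_apply _).fderiv_apply _).bounded
  partial_z k := hasWeakPartial_of_contDiff (contDiff_infty.1 h.smooth 1) k
  partial_a j _ := hasWeakPartial_of_contDiff (contDiff_infty.1 (h.fderiv_apply _).smooth 1) j

lemma HasSecondOrder.add_smul {z z' : E 4 → E m} {a a' : Fin 4 → E 4 → E m}
    {b b' : Fin 4 → Fin 4 → E 4 → E m} (h : HasSecondOrder z a b) (h' : HasSecondOrder z' a' b')
    (t : ℝ) : HasSecondOrder (fun x => z x + t • z' x) (fun k x => a k x + t • a' k x)
      (fun j k x => b j k x + t • b' j k x) where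
  mem := MemLp.add h.mem (MemLp.const_smul h'.mem t)
  mem_a k := MemLp.add (h.mem_a k) ((h'.mem_a k).const_smul t)
  mem_b j k := MemLp.add (h.mem_b j k) (MemLp.const_smul (h'.mem_b j k) t)
  partial_z k := (h.partial_z k).add ((h'.partial_z k).const_smul t)
  partial_a j k := (h.partial_a j k).add ((h'.partial_a j k).const_smul t)

lemma memLp_clm_apply {p q r : ℝ≥0∞} [ENNReal.HolderTriple p q r] {F' : Type*}
    [NormedAddCommGroup F'] [NormedSpace ℝ F'] {T : E 4 → F' →L[ℝ] F} {v : E 4 → F'}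
    (hT : MemLp T p muB) (hv : MemLp v q muB) : MemLp (fun x => T x (v x)) r muB :=
  memLp_bilin (ContinuousLinearMap.id ℝ (F' →L[ℝ] F)) hT hv

lemma memLp_top_comp {F' : Type*} [NormedAddCommGroup F'] [NormedSpace ℝ F'] {w : F' → F}
    (hw : Continuous w) (hc : HasCompactSupport w) {f : E 4 → F'}
    (hf : AEStronglyMeasurable f muB) : MemLp (fun x => w (f x)) ∞ muB := by
  obtain ⟨C, hC⟩ := hw.bounded_above_of_compact_support hc
  exact memLp_top_of_bound (hw.comp_aestronglyMeasurable hf) C (Eventually.of_forall fun x => hC _)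

section Comp

variable {z : E 4 → E m} {a : Fin 4 → E 4 → E m} {b : Fin 4 → Fin 4 → E 4 → E m}
  {g : E m → F}

lemma HasSecondOrder.comp_mem_a (h : HasSecondOrder z a b) (hg : ContDiff ℝ 3 g)
    (hc : HasCompactSupport g) (k : Fin 4) : MemLp (fun x => fderiv ℝ g (z x) (a k x)) 4 muB :=
  memLp_clm_apply (p := ∞) (memLp_top_comp (hg.continuous_fderiv (by norm_num)) (hc.fderiv ℝ)
    h.mem.1) (h.mem_a k)

lemma HasSecondOrder.comp_partial (h : HasSecondOrder z a b) (hg : ContDiff ℝ 3 g)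
    (hc : HasCompactSupport g) (k : Fin 4) :
    HasWeakPartial k (fun x => g (z x)) (fun x => fderiv ℝ g (z x) (a k x)) :=
  hasWeakPartial_comp (hg.of_le (by norm_num)) hc h.mem h.mem_a2 h.partial_z k

/-- The quadratic term in the first derivatives is square integrable precisely because these are in
L⁴. -/
lemma HasSecondOrder.comp_mem_b (h : HasSecondOrder z a b) (hg : ContDiff ℝ 3 g)
    (hc : HasCompactSupport g) (j k : Fin 4) :
    MemL2 (fun x => fderiv ℝ (fderiv ℝ g) (z x) (a j x) (a k x) + fderiv ℝ g (z x) (b j k x)) := by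
  have hd : ContDiff ℝ 2 (fderiv ℝ g) := hg.fderiv_right (by norm_num)
  refine MemLp.add ?_ ?_
  · refine memLp_clm_apply (p := 4) (q := 4) ?_ (h.mem_a k)
    exact memLp_clm_apply (p := ∞) (memLp_top_comp (hd.continuous_fderiv (by norm_num))
      ((hc.fderiv ℝ).fderiv ℝ) h.mem.1) (h.mem_a j)
  · exact memLp_clm_apply (p := ∞) (q := 2) (memLp_top_comp hd.continuous (hc.fderiv ℝ) h.mem.1)
      (h.mem_b j k)

lemma HasSecondOrder.comp_partial_partial (h : HasSecondOrder z a b) (hg : ContDiff ℝ 3 g)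
    (hc : HasCompactSupport g) (j k : Fin 4) :
    HasWeakPartial j (fun x => fderiv ℝ g (z x) (a k x))
      (fun x => fderiv ℝ (fderiv ℝ g) (z x) (a j x) (a k x) + fderiv ℝ g (z x) (b j k x)) := by
  have hd : ContDiff ℝ 2 (fderiv ℝ g) := hg.fderiv_right (by norm_num)
  refine hasWeakPartial_bilin (ContinuousLinearMap.id ℝ (E m →L[ℝ] F))
    (a := fun x => fderiv ℝ g (z x)) (b := a k)
    (a' := fun j x => fderiv ℝ (fderiv ℝ g) (z x) (a j x)) (b' := fun j x => b j k x)
    (memL2_comp hd.continuous (hc.fderiv ℝ) h.mem) (h.mem_a2 k) (fun j => ?_)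
    (fun j => h.mem_b j k) (fun j => ?_) (fun j => h.partial_a j k) j
  · exact memLp_clm_apply (p := ∞) (q := 2) (memLp_top_comp (hd.continuous_fderiv (by norm_num))
      ((hc.fderiv ℝ).fderiv ℝ) h.mem.1) (h.mem_a2 j)
  · exact hasWeakPartial_comp hd (hc.fderiv ℝ) h.mem h.mem_a2 h.partial_z j

lemma HasSecondOrder.comp_laplacian (h : HasSecondOrder z a b) (hg : ContDiff ℝ 3 g)
    (hc : HasCompactSupport g) :
    HasWeakLaplacian (fun x => g (z x)) (fun x => fderiv ℝ g (z x) (∑ k, b k k x) +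
      ∑ k, fderiv ℝ (fderiv ℝ g) (z x) (a k x) (a k x)) := by
  refine (hasWeakLaplacian_of_partials (h.comp_partial hg hc)
    fun k => h.comp_partial_partial hg hc k k).congr (ae_eq_refl _)
    (Eventually.of_forall fun x => ?_)
  simp only [map_sum, Finset.sum_add_distrib]
  rw [add_comm]

end Comp

end SecondOrder

/-! ### Pointwise identities for the projection on N -/

section Projection

variable {m : ℕ}

/-- `Q` is, near the set `N`, the nearest point projection to `N`; it is of class `C⁶`, and its
derivatives at the points of `N` are the orthogonal projections to the tangent spaces. -/
structure IsProjection (N : Set (E m)) (Q : E m → E m) : Prop where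
  contDiff : ContDiff ℝ 6 Q
  compact : HasCompactSupport Q
  near : ∃ δ : ℝ, 0 < δ ∧ ∀ p ∈ N, ∀ y, dist y p < δ → ∀ q, IsNearestPoint N y q → q = Q y
  proj : ∀ p ∈ N, (tangentSpaceAt N p).starProjection = fderiv ℝ Q p
  isCompact : IsCompact N

variable {N : Set (E m)} {Q : E m → E m}

lemma IsProjection.apply_self (h : IsProjection N Q) {p : E m} (hp : p ∈ N) : Q p = p := by
  obtain ⟨δ, hδ, h1⟩ := h.near
  exact (h1 p hp p (by simpa using hδ) p (isNearestPoint_self hp)).symm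

lemma IsProjection.eventually_mem (h : IsProjection N Q) {p : E m} (hp : p ∈ N) :
    ∀ᶠ y in 𝓝 p, Q y ∈ N := by
  obtain ⟨δ, hδ, h1⟩ := h.near
  filter_upwards [Metric.ball_mem_nhds p hδ] with y hy
  obtain ⟨q, hq⟩ := exists_isNearestPoint h.isCompact ⟨p, hp⟩ y
  rw [← h1 p hp y hy q hq]
  exact hq.1

lemma IsProjection.contDiff_fderiv (h : IsProjection N Q) : ContDiff ℝ 5 (fderiv ℝ Q) :=
  h.contDiff.fderiv_right (by norm_num)

lemma IsProjection.idem (h : IsProjection N Q) {p : E m} (hp : p ∈ N) :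
    fderiv ℝ Q p * fderiv ℝ Q p = fderiv ℝ Q p := by
  rw [← h.proj p hp]
  exact (Submodule.isIdempotentElem_starProjection _)

lemma IsProjection.inner_symm (h : IsProjection N Q) {p : E m} (hp : p ∈ N) (v w : E m) :
    inner ℝ (fderiv ℝ Q p v) w = inner ℝ v (fderiv ℝ Q p w) := by
  rw [← h.proj p hp]
  exact Submodule.inner_starProjection_left_eq_right _ v w

/-- Idempotency of the derivative of `Q` is known only on N. Since `Q` maps a neighbourhood of p to
N, the identity holds for y ↦ dQ(Q(y)) near p and can be differentiated there; the chain rule leaves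
only the tangential direction dQ(p)v. -/
lemma IsProjection.fderiv_tangent (h : IsProjection N Q) {p : E m} (hp : p ∈ N) (v : E m) :
    fderiv ℝ (fderiv ℝ Q) p (fderiv ℝ Q p v) =
      fderiv ℝ (fderiv ℝ Q) p (fderiv ℝ Q p v) * fderiv ℝ Q p +
        fderiv ℝ Q p * fderiv ℝ (fderiv ℝ Q) p (fderiv ℝ Q p v) := by
  set D := (fderiv ℝ (fderiv ℝ Q) p).comp (fderiv ℝ Q p) with hD
  have h1 : HasFDerivAt (fun y => fderiv ℝ Q (Q y)) D p := by
    refine HasFDerivAt.comp p (g := fderiv ℝ Q) ?_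
      ((h.contDiff.differentiable (by norm_num)) p).hasFDerivAt
    rw [h.apply_self hp]
    exact ((h.contDiff_fderiv.differentiable (by norm_num)) p).hasFDerivAt
  have h2 := h1.mul' h1
  have h3 : (fun y => fderiv ℝ Q (Q y) * fderiv ℝ Q (Q y)) =ᶠ[𝓝 p] fun y => fderiv ℝ Q (Q y) := by
    filter_upwards [h.eventually_mem hp] with y hy
    exact h.idem hy
  have h4 := (h2.congr_of_eventuallyEq h3.symm).unique h1
  have h5 := congrArg (fun T => T v) h4
  simp only [add_apply, smul_apply, h.apply_self hp] at h5
  have h6 : D v = fderiv ℝ (fderiv ℝ Q) p (fderiv ℝ Q p v) := rfl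
  rw [← h6]
  conv_lhs => rw [← h5]
  rw [add_comm]
  rfl

end Projection

/-! ### The constraint identities, differentiated almost everywhere -/

section Constraint

open scoped ENNReal

variable {m : ℕ} {N : Set (E m)} {Q : E m → E m} {u : E 4 → E m} {a : Fin 4 → E 4 → E m}
  {b : Fin 4 → Fin 4 → E 4 → E m}

/-- The second derivative `∂_j ∂_k` of the composition of `u` with the projections `fderiv Q`. -/
def hessProj (Q : E m → E m) (u : E 4 → E m) (a : Fin 4 → E 4 → E m)
    (b : Fin 4 → Fin 4 → E 4 → E m) (j k : Fin 4) (x : E 4) : E m →L[ℝ] E m :=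
  fderiv ℝ (fderiv ℝ (fderiv ℝ Q)) (u x) (a j x) (a k x) +
    fderiv ℝ (fderiv ℝ Q) (u x) (b j k x)

/-- The chain rule for Q(u), compared with Q(u) = u by uniqueness of weak derivatives. -/
lemma IsProjection.tangent_ae (h : IsProjection N Q) (hu : HasSecondOrder u a b)
    (huN : ∀ᵐ x ∂muB, u x ∈ N) (k : Fin 4) : ∀ᵐ x ∂muB, fderiv ℝ Q (u x) (a k x) = a k x := by
  have h1 := hu.comp_partial (h.contDiff.of_le (by norm_num)) h.compact k
  have h2 : (fun x => Q (u x)) =ᵐ[muB] u := by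
    filter_upwards [huN] with x hx
    exact h.apply_self hx
  exact (h1.congr h2 (ae_eq_refl _)).unique (hu.partial_z k)

lemma IsProjection.tangent_second_ae (h : IsProjection N Q) (hu : HasSecondOrder u a b)
    (huN : ∀ᵐ x ∂muB, u x ∈ N) (j k : Fin 4) : ∀ᵐ x ∂muB,
      fderiv ℝ (fderiv ℝ Q) (u x) (a j x) (a k x) + fderiv ℝ Q (u x) (b j k x) = b j k x := by
  have h1 := hu.comp_partial_partial (h.contDiff.of_le (by norm_num)) h.compact j k
  exact (h1.congr (h.tangent_ae hu huN k) (ae_eq_refl _)).unique (hu.partial_a j k)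

/-- P² = P along u, differentiated twice by the weak product rule: both P and its first derivatives
have square integrable weak derivatives. The trace over j = k is the source of the commutator
structure. -/
lemma IsProjection.idem_ae (h : IsProjection N Q) (hu : HasSecondOrder u a b)
    (huN : ∀ᵐ x ∂muB, u x ∈ N) (j k : Fin 4) : ∀ᵐ x ∂muB,
      hessProj Q u a b j k x = hessProj Q u a b j k x * fderiv ℝ Q (u x) +
        fderiv ℝ Q (u x) * hessProj Q u a b j k x +
        (fderiv ℝ (fderiv ℝ Q) (u x) (a k x) * fderiv ℝ (fderiv ℝ Q) (u x) (a j x) +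
          fderiv ℝ (fderiv ℝ Q) (u x) (a j x) * fderiv ℝ (fderiv ℝ Q) (u x) (a k x)) := by
  have hP : ContDiff ℝ 3 (fderiv ℝ Q) := h.contDiff_fderiv.of_le (by norm_num)
  have hPc : HasCompactSupport (fderiv ℝ Q) := h.compact.fderiv ℝ
  have m0 : MemL2 (fun x => fderiv ℝ Q (u x)) := memL2_comp hP.continuous hPc hu.mem
  have m1 : ∀ k, MemL2 (fun x => fderiv ℝ (fderiv ℝ Q) (u x) (a k x)) := fun k =>
    (hu.comp_mem_a hP hPc k).mono_exponent (by norm_num)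
  have m2 : ∀ j k, MemL2 (hessProj Q u a b j k) := fun j k => hu.comp_mem_b hP hPc j k
  have d0 := hu.comp_partial hP hPc
  have d1 : ∀ j k, HasWeakPartial j (fun x => fderiv ℝ (fderiv ℝ Q) (u x) (a k x))
    (hessProj Q u a b j k) := fun j k => hu.comp_partial_partial hP hPc j k
  let B := ContinuousLinearMap.compL ℝ (E m) (E m) (E m)
  have e0 : ∀ k, (fun x => B (fderiv ℝ (fderiv ℝ Q) (u x) (a k x)) (fderiv ℝ Q (u x)) +
      B (fderiv ℝ Q (u x)) (fderiv ℝ (fderiv ℝ Q) (u x) (a k x))) =ᵐ[muB]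
        fun x => fderiv ℝ (fderiv ℝ Q) (u x) (a k x) := by
    intro k
    have h1 := hasWeakPartial_bilin B m0 m0 m1 m1 d0 d0 k
    refine (h1.congr ?_ (ae_eq_refl _)).unique (d0 k)
    filter_upwards [huN] with x hx
    exact h.idem hx
  have h1 := (hasWeakPartial_bilin B (m1 k) m0 (fun j => m2 j k) m1 (fun j => d1 j k) d0 j).add
    (hasWeakPartial_bilin B m0 (m1 k) m1 (fun j => m2 j k) d0 (fun j => d1 j k) j)
  have h2 := (h1.congr (e0 k) (ae_eq_refl _)).unique (d1 j k)
  filter_upwards [h2] with x hx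
  refine hx.symm.trans ?_
  change hessProj Q u a b j k x * fderiv ℝ Q (u x) +
    fderiv ℝ (fderiv ℝ Q) (u x) (a k x) * fderiv ℝ (fderiv ℝ Q) (u x) (a j x) +
    (fderiv ℝ (fderiv ℝ Q) (u x) (a j x) * fderiv ℝ (fderiv ℝ Q) (u x) (a k x) +
      fderiv ℝ Q (u x) * hessProj Q u a b j k x) = _
  abel

/-- Taking adjoints is a bounded linear map, so it commutes with weak derivatives, and the
derivatives of P along u inherit its symmetry. -/
lemma IsProjection.adjointL_ae (h : IsProjection N Q) (hu : HasSecondOrder u a b)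
    (huN : ∀ᵐ x ∂muB, u x ∈ N) (k : Fin 4) :
    (fun x => adjointL m m (fderiv ℝ (fderiv ℝ Q) (u x) (a k x))) =ᵐ[muB]
      fun x => fderiv ℝ (fderiv ℝ Q) (u x) (a k x) := by
  have d0 := hu.comp_partial (h.contDiff_fderiv.of_le (by norm_num)) (h.compact.fderiv ℝ)
  have e0 : (fun x => adjointL m m (fderiv ℝ Q (u x))) =ᵐ[muB] fun x => fderiv ℝ Q (u x) := by
    filter_upwards [huN] with x hx
    refine ContinuousLinearMap.ext fun v => ext_inner_right ℝ fun w => ?_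
    rw [adjointL_inner, h.inner_symm hx]
  exact (((d0 k).clm (adjointL m m)).congr e0 (ae_eq_refl _)).unique (d0 k)

lemma IsProjection.symm_fderiv_ae (h : IsProjection N Q) (hu : HasSecondOrder u a b)
    (huN : ∀ᵐ x ∂muB, u x ∈ N) (k : Fin 4) : ∀ᵐ x ∂muB, ∀ v w,
      inner ℝ (fderiv ℝ (fderiv ℝ Q) (u x) (a k x) v) w =
        inner ℝ v (fderiv ℝ (fderiv ℝ Q) (u x) (a k x) w) := by
  filter_upwards [h.adjointL_ae hu huN k] with x hx v w
  conv_lhs => rw [← hx]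
  rw [adjointL_inner]

lemma IsProjection.symm_ae (h : IsProjection N Q) (hu : HasSecondOrder u a b)
    (huN : ∀ᵐ x ∂muB, u x ∈ N) (j k : Fin 4) : ∀ᵐ x ∂muB, ∀ v w,
      inner ℝ (hessProj Q u a b j k x v) w = inner ℝ v (hessProj Q u a b j k x w) := by
  have d1 : HasWeakPartial j (fun x => fderiv ℝ (fderiv ℝ Q) (u x) (a k x))
      (hessProj Q u a b j k) := hu.comp_partial_partial
    (h.contDiff_fderiv.of_le (by norm_num)) (h.compact.fderiv ℝ) j k
  have e2 := ((d1.clm (adjointL m m)).congr (h.adjointL_ae hu huN k) (ae_eq_refl _)).unique d1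
  filter_upwards [e2] with x hx v w
  conv_lhs => rw [← hx]
  rw [adjointL_inner]

end Constraint

/-! ### Differentiating the energies under the integral -/

section Quadratic

set_option maxSynthPendingDepth 3

open scoped ENNReal

variable {H : Type*} [NormedAddCommGroup H] [InnerProductSpace ℝ H] [CompleteSpace H]

/-- A map of the type of the Laplacian of a composition: linear in `l`, quadratic in `a`. -/
def quad (S : H → H →L[ℝ] H) (T : H → H →L[ℝ] H →L[ℝ] H) (y l : H)
    (a : Fin 4 → H) : H :=
  S y l + ∑ k, T y (a k) (a k)

/-- The derivative of `quad S T` at `(y, l, a)` in the direction `(y', l', a')`. -/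
def quadDeriv (S : H → H →L[ℝ] H) (T : H → H →L[ℝ] H →L[ℝ] H) (y l : H)
    (a : Fin 4 → H) (y' l' : H) (a' : Fin 4 → H) : H :=
  fderiv ℝ S y y' l + S y l' +
    ∑ k, (fderiv ℝ T y y' (a k) (a k) + T y (a' k) (a k) + T y (a k) (a' k))

variable {S : H → H →L[ℝ] H} {T : H → H →L[ℝ] H →L[ℝ] H}

lemma hasDerivAt_quad (hS : ContDiff ℝ 1 S) (hT : ContDiff ℝ 1 T) (y l y' l' : H)
    (a a' : Fin 4 → H) (t : ℝ) :
    HasDerivAt (fun t : ℝ => quad S T (y + t • y') (l + t • l') (fun k => a k + t • a' k))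
      (quadDeriv S T (y + t • y') (l + t • l') (fun k => a k + t • a' k) y' l' a') t := by
  have hlin : ∀ p q : H, HasDerivAt (fun t : ℝ => p + t • q) q t := fun p q => by
    simpa using ((hasDerivAt_id t).smul_const q).const_add p
  have h1 : HasDerivAt (fun t : ℝ => S (y + t • y')) (fderiv ℝ S (y + t • y') y') t :=
    ((hS.differentiable one_ne_zero _).hasFDerivAt).comp_hasDerivAt t (hlin y y')
  have h2 : HasDerivAt (fun t : ℝ => T (y + t • y')) (fderiv ℝ T (y + t • y') y') t :=
    ((hT.differentiable one_ne_zero _).hasFDerivAt).comp_hasDerivAt t (hlin y y')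
  refine (h1.clm_apply (hlin l l')).add (HasDerivAt.fun_sum fun k _ => ?_)
  exact ((h2.clm_apply (hlin (a k) (a' k))).clm_apply (hlin (a k) (a' k))).congr_deriv
    (by simp only [add_apply])

lemma norm_quad_le {C : ℝ} {y l : H} {a : Fin 4 → H} (hS : ‖S y‖ ≤ C) (hT : ‖T y‖ ≤ C) :
    ‖quad S T y l a‖ ≤ C * (1 + ‖l‖ + ∑ k, ‖a k‖ ^ 2) := by
  have hC : 0 ≤ C := (norm_nonneg _).trans hS
  have h1 : ‖S y l‖ ≤ C * ‖l‖ := (S y).le_of_opNorm_le hS l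
  have h2 : ‖∑ k, T y (a k) (a k)‖ ≤ ∑ k, C * ‖a k‖ ^ 2 := by
    refine norm_sum_le_of_le _ fun k _ => ?_
    calc ‖T y (a k) (a k)‖ ≤ ‖T y‖ * ‖a k‖ * ‖a k‖ := (T y).le_opNorm₂ _ _
      _ ≤ C * ‖a k‖ * ‖a k‖ := by gcongr
      _ = C * ‖a k‖ ^ 2 := by ring
  rw [← Finset.mul_sum] at h2
  calc ‖quad S T y l a‖ ≤ ‖S y l‖ + ‖∑ k, T y (a k) (a k)‖ := norm_add_le _ _
    _ ≤ C * ‖l‖ + C * ∑ k, ‖a k‖ ^ 2 := add_le_add h1 h2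
    _ ≤ C * (1 + ‖l‖ + ∑ k, ‖a k‖ ^ 2) := by linarith

/-- The variation is bounded, so terms linear in a_k are absorbed through 2‖a_k‖ ≤ ‖a_k‖² + 1, and
the weight that controls `quad` also controls its derivative. -/
lemma norm_quadDeriv_le {C : ℝ} {y l y' l' : H} {a a' : Fin 4 → H} (hS : ‖S y‖ ≤ C)
    (hT : ‖T y‖ ≤ C) (hS' : ‖fderiv ℝ S y‖ ≤ C) (hT' : ‖fderiv ℝ T y‖ ≤ C) (hy' : ‖y'‖ ≤ C)
    (hl' : ‖l'‖ ≤ C) (ha' : ∀ k, ‖a' k‖ ≤ C) :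
    ‖quadDeriv S T y l a y' l' a'‖ ≤ 9 * C ^ 2 * (1 + ‖l‖ + ∑ k, ‖a k‖ ^ 2) := by
  have hC : 0 ≤ C := (norm_nonneg _).trans hS
  have h1 : ‖fderiv ℝ S y y' l‖ ≤ C ^ 2 * ‖l‖ := by
    calc ‖fderiv ℝ S y y' l‖ ≤ ‖fderiv ℝ S y‖ * ‖y'‖ * ‖l‖ := (fderiv ℝ S y).le_opNorm₂ _ _
      _ ≤ C * C * ‖l‖ := by gcongr
      _ = C ^ 2 * ‖l‖ := by ring
  have h2 : ‖S y l'‖ ≤ C ^ 2 := by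
    calc ‖S y l'‖ ≤ ‖S y‖ * ‖l'‖ := (S y).le_opNorm l'
      _ ≤ C * C := by gcongr
      _ = C ^ 2 := by ring
  have h3 : ‖∑ k, (fderiv ℝ T y y' (a k) (a k) + T y (a' k) (a k) + T y (a k) (a' k))‖ ≤
      ∑ k, C ^ 2 * (2 * ‖a k‖ ^ 2 + 1) := by
    refine norm_sum_le_of_le _ fun k _ => ?_
    have e1 : ‖fderiv ℝ T y y' (a k) (a k)‖ ≤ C * C * ‖a k‖ * ‖a k‖ := by
      calc ‖fderiv ℝ T y y' (a k) (a k)‖ ≤ ‖fderiv ℝ T y y'‖ * ‖a k‖ * ‖a k‖ :=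
            (fderiv ℝ T y y').le_opNorm₂ _ _
        _ ≤ C * C * ‖a k‖ * ‖a k‖ := by
          gcongr
          exact ((fderiv ℝ T y).le_opNorm y').trans (by gcongr)
    have e2 : ‖T y (a' k) (a k)‖ ≤ C * C * ‖a k‖ :=
      ((T y).le_opNorm₂ _ _).trans (by gcongr; exact ha' k)
    have e3 : ‖T y (a k) (a' k)‖ ≤ C * ‖a k‖ * C :=
      ((T y).le_opNorm₂ _ _).trans (by gcongr; exact ha' k)
    calc _ ≤ ‖fderiv ℝ T y y' (a k) (a k)‖ + ‖T y (a' k) (a k)‖ + ‖T y (a k) (a' k)‖ :=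
          norm_add₃_le
      _ ≤ C * C * ‖a k‖ * ‖a k‖ + C * C * ‖a k‖ + C * ‖a k‖ * C := by gcongr
      _ ≤ C ^ 2 * (2 * ‖a k‖ ^ 2 + 1) := by
        nlinarith [mul_nonneg (sq_nonneg C) (sq_nonneg (‖a k‖ - 1))]
  have h4 : ∑ k : Fin 4, C ^ 2 * (2 * ‖a k‖ ^ 2 + 1) = C ^ 2 * (2 * ∑ k, ‖a k‖ ^ 2 + 4) := by
    rw [← Finset.mul_sum, Finset.sum_add_distrib, ← Finset.mul_sum]
    simp
  have h5 : 0 ≤ ∑ k, ‖a k‖ ^ 2 := by positivity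
  calc ‖quadDeriv S T y l a y' l' a'‖ ≤ ‖fderiv ℝ S y y' l‖ + ‖S y l'‖ +
      ‖∑ k, (fderiv ℝ T y y' (a k) (a k) + T y (a' k) (a k) + T y (a k) (a' k))‖ := norm_add₃_le
    _ ≤ C ^ 2 * ‖l‖ + C ^ 2 + C ^ 2 * (2 * ∑ k, ‖a k‖ ^ 2 + 4) := by
      rw [h4] at h3
      gcongr
    _ ≤ 9 * C ^ 2 * (1 + ‖l‖ + ∑ k, ‖a k‖ ^ 2) := by
      nlinarith [mul_nonneg (sq_nonneg C) (norm_nonneg l), mul_nonneg (sq_nonneg C) h5,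
        sq_nonneg C]

lemma quad_weight_le {C t : ℝ} {l l' : H} {a a' : Fin 4 → H} (ht : |t| ≤ 1) (hl' : ‖l'‖ ≤ C)
    (ha' : ∀ k, ‖a' k‖ ≤ C) :
    1 + ‖l + t • l'‖ + ∑ k, ‖a k + t • a' k‖ ^ 2 ≤
      (2 + C + 8 * C ^ 2) * (1 + ‖l‖ + ∑ k, ‖a k‖ ^ 2) := by
  have hC : 0 ≤ C := (norm_nonneg _).trans hl'
  have h0 : ∀ {v w : H}, ‖w‖ ≤ C → ‖v + t • w‖ ≤ ‖v‖ + C := fun {v w} hw => by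
    refine (norm_add_le _ _).trans ?_
    rw [norm_smul, Real.norm_eq_abs]
    nlinarith [norm_nonneg w]
  have h1 := h0 (v := l) hl'
  have h2 : ∑ k, ‖a k + t • a' k‖ ^ 2 ≤ ∑ k, (2 * ‖a k‖ ^ 2 + 2 * C ^ 2) := by
    refine Finset.sum_le_sum fun k _ => ?_
    have := h0 (v := a k) (ha' k)
    nlinarith [norm_nonneg (a k + t • a' k), sq_nonneg (‖a k‖ - C)]
  rw [Finset.sum_add_distrib, ← Finset.mul_sum] at h2
  simp only [Finset.sum_const, Finset.card_univ, Fintype.card_fin, nsmul_eq_mul] at h2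
  have h5 : 0 ≤ ∑ k, ‖a k‖ ^ 2 := by positivity
  push_cast at h2
  nlinarith [norm_nonneg l, mul_nonneg hC (norm_nonneg l), mul_nonneg hC h5,
    mul_nonneg (sq_nonneg C) (norm_nonneg l), mul_nonneg (sq_nonneg C) h5]

/-- The class `quad` is stable under a field of linear maps, so the projected Laplacian of the
intrinsic energy is differentiated by the same lemma as the full Laplacian. -/
lemma quad_comp (M : H → H →L[ℝ] H) (y l : H) (a : Fin 4 → H) :
    quad (fun y => (M y).comp (S y)) (fun y => (ContinuousLinearMap.compL ℝ H H H (M y)).comp (T y))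
      y l a = M y (quad S T y l a) := by
  simp only [quad, map_add, map_sum]
  rfl

/-- Both sides are derivatives of one and the same curve at t = 0; uniqueness of the derivative
replaces an expansion of the formula. -/
lemma quadDeriv_comp {M : H → H →L[ℝ] H} (hS : ContDiff ℝ 1 S) (hT : ContDiff ℝ 1 T)
    (hM : ContDiff ℝ 1 M) (y l y' l' : H) (a a' : Fin 4 → H) :
    quadDeriv (fun y => (M y).comp (S y))
      (fun y => (ContinuousLinearMap.compL ℝ H H H (M y)).comp (T y)) y l a y' l' a' =
      fderiv ℝ M y y' (quad S T y l a) + M y (quadDeriv S T y l a y' l' a') := by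
  have hT' : ContDiff ℝ 1 fun y => (ContinuousLinearMap.compL ℝ H H H (M y)).comp (T y) := by
    have h1 : ContDiff ℝ 1 fun y => ContinuousLinearMap.compL ℝ H H H (M y) :=
      (ContinuousLinearMap.compL ℝ H H H).contDiff.comp hM
    exact h1.clm_comp hT
  have h1 := hasDerivAt_quad (hM.clm_comp hS) hT' y l y' l' a a' 0
  have h2 := hasDerivAt_quad hS hT y l y' l' a a' 0
  have hline : HasDerivAt (fun t : ℝ => y + t • y') y' 0 := by
    simpa using ((hasDerivAt_id (0 : ℝ)).smul_const y').const_add y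
  have h3 : HasDerivAt (fun t : ℝ => M (y + t • y')) (fderiv ℝ M (y + (0 : ℝ) • y') y') 0 :=
    (hM.differentiable one_ne_zero (y + (0 : ℝ) • y')).hasFDerivAt.comp_hasDerivAt (0 : ℝ) hline
  have h4 := h3.clm_apply h2
  simp only [quad_comp] at h1
  have h5 := h1.unique h4
  simpa only [zero_smul, add_zero] using h5

variable {u l η l' : E 4 → H} {a a' : Fin 4 → E 4 → H}

lemma aesm_quad (hS : Continuous S) (hT : Continuous T) (hu : AEStronglyMeasurable u muB)
    (hl : AEStronglyMeasurable l muB) (ha : ∀ k, AEStronglyMeasurable (a k) muB) :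
    AEStronglyMeasurable (fun x => quad S T (u x) (l x) (fun k => a k x)) muB := by
  have app : ∀ {A : E 4 → H →L[ℝ] H} {v : E 4 → H}, AEStronglyMeasurable A muB →
      AEStronglyMeasurable v muB → AEStronglyMeasurable (fun x => A x (v x)) muB :=
    fun hA hv => aesm_bilin (ContinuousLinearMap.id ℝ (H →L[ℝ] H)) hA hv
  have app2 : ∀ {A : E 4 → H →L[ℝ] H →L[ℝ] H} {v : E 4 → H},
      AEStronglyMeasurable A muB → AEStronglyMeasurable v muB →
      AEStronglyMeasurable (fun x => A x (v x)) muB :=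
    fun hA hv => aesm_bilin (ContinuousLinearMap.id ℝ (H →L[ℝ] H →L[ℝ] H)) hA hv
  refine (app (hS.comp_aestronglyMeasurable hu) hl).add
    (Finset.aestronglyMeasurable_fun_sum _ fun k _ => ?_)
  exact app (app2 (hT.comp_aestronglyMeasurable hu) (ha k)) (ha k)

lemma aesm_quadDeriv (hS : ContDiff ℝ 1 S) (hT : ContDiff ℝ 1 T)
    (hu : AEStronglyMeasurable u muB)
    (hl : AEStronglyMeasurable l muB) (ha : ∀ k, AEStronglyMeasurable (a k) muB)
    (hη : AEStronglyMeasurable η muB)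
    (hl' : AEStronglyMeasurable l' muB) (ha' : ∀ k, AEStronglyMeasurable (a' k) muB) :
    AEStronglyMeasurable (fun x => quadDeriv S T (u x) (l x) (fun k => a k x) (η x) (l' x)
      (fun k => a' k x)) muB := by
  have app : ∀ {A : E 4 → H →L[ℝ] H} {v : E 4 → H}, AEStronglyMeasurable A muB →
      AEStronglyMeasurable v muB → AEStronglyMeasurable (fun x => A x (v x)) muB :=
    fun hA hv => aesm_bilin (ContinuousLinearMap.id ℝ (H →L[ℝ] H)) hA hv
  have app2 : ∀ {A : E 4 → H →L[ℝ] H →L[ℝ] H} {v : E 4 → H},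
      AEStronglyMeasurable A muB → AEStronglyMeasurable v muB →
      AEStronglyMeasurable (fun x => A x (v x)) muB :=
    fun hA hv => aesm_bilin (ContinuousLinearMap.id ℝ (H →L[ℝ] H →L[ℝ] H)) hA hv
  have app3 : ∀ {A : E 4 → H →L[ℝ] H →L[ℝ] H →L[ℝ] H} {v : E 4 → H},
      AEStronglyMeasurable A muB → AEStronglyMeasurable v muB →
      AEStronglyMeasurable (fun x => A x (v x)) muB :=
    fun hA hv => aesm_bilin (ContinuousLinearMap.id ℝ (H →L[ℝ] H →L[ℝ] H →L[ℝ] H)) hA hv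
  have hT0 := hT.continuous.comp_aestronglyMeasurable hu
  have hT1 := app3 ((hT.continuous_fderiv one_ne_zero).comp_aestronglyMeasurable hu) hη
  refine ((app (app2 ((hS.continuous_fderiv one_ne_zero).comp_aestronglyMeasurable hu) hη) hl).add
    (app (hS.continuous.comp_aestronglyMeasurable hu) hl')).add
    (Finset.aestronglyMeasurable_fun_sum _ fun k _ => ?_)
  exact ((app (app2 hT1 (ha k)) (ha k)).add (app (app2 hT0 (ha' k)) (ha k))).add
    (app (app2 hT0 (ha k)) (ha' k))

/-- Here the L⁴ bound on the first derivatives enters. The square of this weight, up to a constant,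
is the integrable majorant of the differentiated energy density. -/
lemma memL2_quad_weight (hl : MemL2 l) (ha : ∀ k, MemLp (a k) 4 muB) :
    MemL2 (fun x => 1 + ‖l x‖ + ∑ k, ‖a k x‖ ^ 2) := by
  refine MemLp.add (MemLp.add (memLp_const 1) hl.norm) (memLp_finsetSum _ fun k _ => ?_)
  simp only [pow_two]
  exact memLp_bilin (ContinuousLinearMap.mul ℝ ℝ) (p := 4) (q := 4) (ha k).norm (ha k).norm

/-- Differentiation under the integral for the energies. -/
lemma hasDerivAt_integral_quad (hS : ContDiff ℝ 1 S) (hSc : HasCompactSupport S)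
    (hT : ContDiff ℝ 1 T) (hTc : HasCompactSupport T) (hu : AEStronglyMeasurable u muB)
    (hl : MemL2 l) (ha : ∀ k, MemLp (a k) 4 muB) (hη : AEStronglyMeasurable η muB)
    (hl' : AEStronglyMeasurable l' muB) (ha' : ∀ k, AEStronglyMeasurable (a' k) muB) {C : ℝ}
    (hηC : ∀ x, ‖η x‖ ≤ C) (hlC : ∀ x, ‖l' x‖ ≤ C) (haC : ∀ k x, ‖a' k x‖ ≤ C) :
    HasDerivAt (fun t : ℝ => ∫ x, ‖quad S T (u x + t • η x) (l x + t • l' x)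
        (fun k => a k x + t • a' k x)‖ ^ 2 ∂muB)
      (∫ x, 2 * inner ℝ (quad S T (u x) (l x) (fun k => a k x))
        (quadDeriv S T (u x) (l x) (fun k => a k x) (η x) (l' x) (fun k => a' k x)) ∂muB) 0 := by
  obtain ⟨C1, hC1⟩ := hS.continuous.bounded_above_of_compact_support hSc
  obtain ⟨C2, hC2⟩ := hT.continuous.bounded_above_of_compact_support hTc
  obtain ⟨C3, hC3⟩ := (hS.continuous_fderiv one_ne_zero).bounded_above_of_compact_support
    (hSc.fderiv ℝ)
  obtain ⟨C4, hC4⟩ := (hT.continuous_fderiv one_ne_zero).bounded_above_of_compact_support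
    (hTc.fderiv ℝ)
  obtain ⟨D, hD, hD1, hD2, hD3, hD4⟩ : ∃ D, C ≤ D ∧ C1 ≤ D ∧ C2 ≤ D ∧ C3 ≤ D ∧ C4 ≤ D :=
    ⟨max C (max C1 (max C2 (max C3 C4))), by simp⟩
  have hD0 : 0 ≤ D := (norm_nonneg (η 0)).trans ((hηC 0).trans hD)
  set ρ : E 4 → ℝ := fun x => 1 + ‖l x‖ + ∑ k, ‖a k x‖ ^ 2 with hρ
  set A : ℝ := 2 + D + 8 * D ^ 2
  have hρ2 : MemL2 ρ := memL2_quad_weight hl ha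
  have hρi : Integrable (fun x => 2 * (D * A) * (9 * D ^ 2 * A) * (ρ x * ρ x)) muB :=
    (integrable_bilin (ContinuousLinearMap.mul ℝ ℝ) hρ2 hρ2).const_mul _
  set K : ℝ → E 4 → H := fun t x => quad S T (u x + t • η x) (l x + t • l' x)
    (fun k => a k x + t • a' k x)
  set K' : ℝ → E 4 → H := fun t x => quadDeriv S T (u x + t • η x) (l x + t • l' x)
    (fun k => a k x + t • a' k x) (η x) (l' x) (fun k => a' k x)
  have hKm : ∀ t, AEStronglyMeasurable (K t) muB := fun t =>
    aesm_quad hS.continuous hT.continuous (hu.add (hη.const_smul t)) (hl.1.add (hl'.const_smul t))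
      fun k => (ha k).1.add ((ha' k).const_smul t)
  have hK'm : ∀ t, AEStronglyMeasurable (K' t) muB := fun t =>
    aesm_quadDeriv hS hT (hu.add (hη.const_smul t)) (hl.1.add (hl'.const_smul t))
      (fun k => (ha k).1.add ((ha' k).const_smul t)) hη hl' ha'
  have hw : ∀ t : ℝ, |t| ≤ 1 → ∀ x, 1 + ‖l x + t • l' x‖ + ∑ k, ‖a k x + t • a' k x‖ ^ 2 ≤
      A * ρ x := fun t ht x =>
    quad_weight_le ht ((hlC x).trans hD) fun k => (haC k x).trans hD
  have hKb : ∀ t : ℝ, |t| ≤ 1 → ∀ x, ‖K t x‖ ≤ D * A * ρ x := fun t ht x => by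
    refine (norm_quad_le ((hC1 _).trans hD1) ((hC2 _).trans hD2)).trans ?_
    rw [mul_assoc]
    exact mul_le_mul_of_nonneg_left (hw t ht x) hD0
  have hK'b : ∀ t : ℝ, |t| ≤ 1 → ∀ x, ‖K' t x‖ ≤ 9 * D ^ 2 * A * ρ x := fun t ht x => by
    refine (norm_quadDeriv_le ((hC1 _).trans hD1) ((hC2 _).trans hD2) ((hC3 _).trans hD3)
      ((hC4 _).trans hD4) ((hηC x).trans hD) ((hlC x).trans hD)
      fun k => (haC k x).trans hD).trans ?_
    exact (mul_le_mul_of_nonneg_left (hw t ht x) (by positivity)).trans_eq (by ring)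
  have hK0 : MemL2 (K 0) := by
    refine MemLp.of_le_mul hρ2 (hKm 0) (c := D * A) (Eventually.of_forall fun x => ?_)
    refine (hKb 0 (by simp) x).trans ?_
    gcongr
    exact le_abs_self _
  have key := hasDerivAt_integral_of_dominated_loc_of_deriv_le (μ := muB) (x₀ := (0 : ℝ))
    (F := fun t x => ‖K t x‖ ^ 2) (F' := fun t x => 2 * inner ℝ (K t x) (K' t x))
    (bound := fun x => 2 * (D * A) * (9 * D ^ 2 * A) * (ρ x * ρ x))
    (Metric.ball_mem_nhds 0 one_pos) (Eventually.of_forall fun t => (hKm t).norm.pow 2)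
    hK0.integrable_norm_pow' (((hKm 0).inner (hK'm 0)).const_mul 2) ?_ hρi ?_
  · have := key.2
    simpa only [K, K', zero_smul, add_zero] using this
  · refine Eventually.of_forall fun x t ht => ?_
    have ht' : |t| ≤ 1 := by simpa using (Metric.mem_ball.1 ht).le
    have h1 := hKb t ht' x
    have h2 := hK'b t ht' x
    rw [norm_mul, Real.norm_two]
    calc 2 * ‖(inner ℝ (K t x) (K' t x) : ℝ)‖ ≤ 2 * (‖K t x‖ * ‖K' t x‖) := by
          gcongr
          exact norm_inner_le_norm _ _
      _ ≤ 2 * ((D * A * ρ x) * (9 * D ^ 2 * A * ρ x)) := by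
          gcongr
      _ = _ := by ring
  · exact Eventually.of_forall fun x t _ => (hasDerivAt_quad hS hT _ _ _ _ _ _ t).norm_sq

end Quadratic

/-! ### First variations and Euler–Lagrange equations -/

section Variation

set_option maxSynthPendingDepth 3

variable {m : ℕ} {N : Set (E m)} {Q : E m → E m} {u : E 4 → E m} {a : Fin 4 → E 4 → E m}
  {b : Fin 4 → Fin 4 → E 4 → E m} {φ : E 4 → E m}

lemma IsProjection.fderiv_fderiv_symm (h : IsProjection N Q) (y v w : E m) :
    fderiv ℝ (fderiv ℝ Q) y v w = fderiv ℝ (fderiv ℝ Q) y w v :=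
  (h.contDiff.contDiffAt.isSymmSndFDerivAt (by simp; norm_num)).eq v w

lemma IsProjection.third_fderiv_symm (h : IsProjection N Q) (y v w x : E m) :
    fderiv ℝ (fderiv ℝ (fderiv ℝ Q)) y v w x = fderiv ℝ (fderiv ℝ (fderiv ℝ Q)) y w v x := by
  rw [(h.contDiff_fderiv.contDiffAt.isSymmSndFDerivAt (by simp; norm_num)).eq v w]

lemma IsProjection.third_fderiv_symm_right (h : IsProjection N Q) (y v w x : E m) :
    fderiv ℝ (fderiv ℝ (fderiv ℝ Q)) y v w x = fderiv ℝ (fderiv ℝ (fderiv ℝ Q)) y v x w := by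
  have h2 : ContDiff ℝ 4 (fderiv ℝ (fderiv ℝ Q)) := h.contDiff_fderiv.fderiv_right (by norm_num)
  have h3 := ((h2.differentiable (by norm_num)) y).hasFDerivAt
  have ev : ∀ w x : E m, HasFDerivAt (fun y => fderiv ℝ (fderiv ℝ Q) y w x)
      (((ContinuousLinearMap.apply ℝ (E m) x).comp
        (ContinuousLinearMap.apply ℝ (E m →L[ℝ] E m) w)).comp
          (fderiv ℝ (fderiv ℝ (fderiv ℝ Q)) y)) y := fun w x =>
    ((ContinuousLinearMap.apply ℝ (E m) x).comp
        (ContinuousLinearMap.apply ℝ (E m →L[ℝ] E m) w)).hasFDerivAt.comp y h3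
  have h4 := (ev w x).unique
    ((ev x w).congr_of_eventuallyEq (Eventually.of_forall fun y => h.fderiv_fderiv_symm y w x))
  exact congrArg (fun D => D v) h4

lemma nonempty_of_ae_mem (huN : ∀ᵐ x ∂muB, u x ∈ N) : N.Nonempty := by
  have h0 : muB ≠ 0 := by
    intro h
    have h1 : volume B4 = 0 := Measure.restrict_eq_zero.1 h
    exact (Metric.measure_ball_pos volume (0 : E 4) one_pos).ne' h1
  have : NeBot (ae muB) := ae_neBot.2 h0
  obtain ⟨x, hx⟩ := huN.exists
  exact ⟨_, hx⟩

/-- The nearest point projection in the definition of a critical point may be replaced by `Q`. -/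
lemma IsCriticalPoint.hasDerivAt_of_isProjection {J : (E 4 → E m) → ℝ}
    (hc : IsCriticalPoint N J u) (h : IsProjection N Q) (huN : ∀ᵐ x ∂muB, u x ∈ N)
    (hφ : IsTest φ) {j : ℝ → ℝ}
    (hj : ∀ t v, (v =ᵐ[muB] fun x => Q (u x + t • φ x)) → (∀ᵐ x ∂muB, Q (u x + t • φ x) ∈ N) →
      J v = j t) : HasDerivAt j 0 0 := by
  have hn := fun y => exists_isNearestPoint h.isCompact (nonempty_of_ae_mem huN) y
  choose q hq using hn
  -- The selection q need not be measurable. For small t it agrees a.e. with `Q`, and the derivative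
  -- at zero depends on small t only.
  have h1 := hc φ hφ (fun t x => q (u x + t • φ x)) fun t => Eventually.of_forall fun x => hq _
  refine h1.congr_of_eventuallyEq ?_
  obtain ⟨δ, hδ, hnear⟩ := h.near
  obtain ⟨C, hC0, hC⟩ := hφ.bounded
  have ht : ∀ᶠ t : ℝ in 𝓝 0, |t| * C < δ := by
    have : Tendsto (fun t : ℝ => |t| * C) (𝓝 0) (𝓝 (|0| * C)) :=
      (continuous_abs.mul continuous_const).tendsto 0
    rw [abs_zero, zero_mul] at this
    exact this.eventually (gt_mem_nhds hδ)
  filter_upwards [ht] with t ht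
  have h2 : ∀ᵐ x ∂muB, q (u x + t • φ x) = Q (u x + t • φ x) := by
    filter_upwards [huN] with x hx
    refine hnear _ hx _ ?_ _ (hq _)
    rw [dist_eq_norm, add_sub_cancel_left, norm_smul, Real.norm_eq_abs]
    exact (mul_le_mul_of_nonneg_left (hC x) (abs_nonneg t)).trans_lt ht
  refine (hj t _ h2 ?_).symm
  filter_upwards [h2] with x hx
  rw [← hx]
  exact (hq _).1

/-- The Laplacian of the variation `Q (u + t φ)`. -/
lemma IsProjection.hasWeakLaplacian_variation (h : IsProjection N Q) (hu : HasSecondOrder u a b)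
    (hφ : IsTest φ) (t : ℝ) : HasWeakLaplacian (fun x => Q (u x + t • φ x))
      (fun x => quad (fderiv ℝ Q) (fderiv ℝ (fderiv ℝ Q)) (u x + t • φ x)
        ((∑ k, b k k x) + t • ∑ k, fderiv ℝ (fun y => fderiv ℝ φ y (e k)) x (e k))
        (fun k => a k x + t • fderiv ℝ φ x (e k))) := by
  have h1 := (hu.add_smul hφ.hasSecondOrder t).comp_laplacian
    (h.contDiff.of_le (by norm_num)) h.compact
  refine h1.congr (ae_eq_refl _) (Eventually.of_forall fun x => ?_)
  simp only [quad, Finset.sum_add_distrib, Finset.smul_sum]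

/-- The first variation of the Laplacian of `Q (u + t φ)`. -/
def lapVariation (Q : E m → E m) (u : E 4 → E m) (a : Fin 4 → E 4 → E m)
    (b : Fin 4 → Fin 4 → E 4 → E m) (φ : E 4 → E m) (x : E 4) : E m :=
  quadDeriv (fderiv ℝ Q) (fderiv ℝ (fderiv ℝ Q)) (u x) (∑ k, b k k x) (fun k => a k x) (φ x)
    (∑ k, fderiv ℝ (fun y => fderiv ℝ φ y (e k)) x (e k)) (fun k => fderiv ℝ φ x (e k))

/-- The Laplacian of the composition of `u` with the projections `fderiv Q`. -/
def lapProj (Q : E m → E m) (u : E 4 → E m) (a : Fin 4 → E 4 → E m)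
    (b : Fin 4 → Fin 4 → E 4 → E m) (x : E 4) : E m →L[ℝ] E m :=
  ∑ k, hessProj Q u a b k k x

/-- Symmetry of the second and third derivatives of `Q` regroups the variation as Δ(Pφ) = (ΔP)φ +
PΔφ + 2 Σ ∂_kP ∂_kφ. -/
lemma IsProjection.lapVariation_eq (h : IsProjection N Q) (x : E 4) :
    lapVariation Q u a b φ x = lapProj Q u a b x (φ x) +
      fderiv ℝ Q (u x) (∑ k, fderiv ℝ (fun y => fderiv ℝ φ y (e k)) x (e k)) +
      (2 : ℝ) • ∑ k, fderiv ℝ (fderiv ℝ Q) (u x) (a k x) (fderiv ℝ φ x (e k)) := by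
  have h1 : ∀ k, fderiv ℝ (fderiv ℝ (fderiv ℝ Q)) (u x) (φ x) (a k x) (a k x) =
      fderiv ℝ (fderiv ℝ (fderiv ℝ Q)) (u x) (a k x) (a k x) (φ x) := fun k => by
    rw [h.third_fderiv_symm, h.third_fderiv_symm_right]
  have h2 : ∀ k, fderiv ℝ (fderiv ℝ Q) (u x) (fderiv ℝ φ x (e k)) (a k x) =
      fderiv ℝ (fderiv ℝ Q) (u x) (a k x) (fderiv ℝ φ x (e k)) := fun k =>
    h.fderiv_fderiv_symm _ _ _
  simp only [lapVariation, lapProj, quadDeriv, h1, h2, h.fderiv_fderiv_symm (u x) (φ x), hessProj,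
    map_sum, sum_apply, add_apply, Finset.sum_add_distrib, two_smul]
  abel

/-- The Laplacian of `u`, decomposed into its tangential and normal parts. -/
lemma IsProjection.quad_ae (h : IsProjection N Q) (hu : HasSecondOrder u a b)
    (huN : ∀ᵐ x ∂muB, u x ∈ N) : ∀ᵐ x ∂muB,
      quad (fderiv ℝ Q) (fderiv ℝ (fderiv ℝ Q)) (u x) (∑ k, b k k x) (fun k => a k x) =
        ∑ k, b k k x := by
  filter_upwards [ae_all_iff.2 fun k => h.tangent_second_ae hu huN k k] with x hx
  rw [quad, map_sum, ← Finset.sum_add_distrib]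
  refine Finset.sum_congr rfl fun k _ => ?_
  rw [add_comm]
  exact hx k

/-- A stationary energy of the form `∫ |quad S T|²` has a vanishing first variation. -/
lemma integral_quad_eq_zero {S : E m → E m →L[ℝ] E m} {T : E m → E m →L[ℝ] E m →L[ℝ] E m}
    (hS : ContDiff ℝ 1 S) (hSc : HasCompactSupport S) (hT : ContDiff ℝ 1 T)
    (hTc : HasCompactSupport T) (hu : HasSecondOrder u a b) (hφ : IsTest φ)
    (h1 : HasDerivAt (fun t : ℝ => ∫ x, ‖quad S T (u x + t • φ x)
      ((∑ k, b k k x) + t • ∑ k, fderiv ℝ (fun y => fderiv ℝ φ y (e k)) x (e k))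
      (fun k => a k x + t • fderiv ℝ φ x (e k))‖ ^ 2 ∂muB) 0 0) :
    ∫ x, inner ℝ (quad S T (u x) (∑ k, b k k x) (fun k => a k x))
      (quadDeriv S T (u x) (∑ k, b k k x) (fun k => a k x) (φ x)
        (∑ k, fderiv ℝ (fun y => fderiv ℝ φ y (e k)) x (e k))
        (fun k => fderiv ℝ φ x (e k))) ∂muB = 0 := by
  have hl : MemL2 fun x => ∑ k, b k k x := memLp_finsetSum _ fun k _ => hu.mem_b k k
  have hφ1 := fun k => hφ.fderiv_apply (e k)
  have hφ2 := fun k => (hφ1 k).fderiv_apply (e k)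
  obtain ⟨C1, h01, hC1⟩ := hφ.bounded
  choose C2 h02 hC2 using fun k => (hφ2 k).bounded
  choose C3 h03 hC3 using fun k => (hφ1 k).bounded
  have h02' : 0 ≤ ∑ k, C2 k := Finset.sum_nonneg fun k _ => h02 k
  have h03' : 0 ≤ ∑ k, C3 k := Finset.sum_nonneg fun k _ => h03 k
  have h2 := hasDerivAt_integral_quad hS hSc hT hTc hu.mem.1 hl
    hu.mem_a hφ.continuous.aestronglyMeasurable
    (continuous_finsetSum Finset.univ fun k _ => (hφ2 k).continuous).aestronglyMeasurable
    (fun k => (hφ1 k).continuous.aestronglyMeasurable) (C := C1 + ∑ k, C2 k + ∑ k, C3 k)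
    (fun x => (hC1 x).trans (by linarith))
    (fun x => (norm_sum_le_of_le _ fun k _ => hC2 k x).trans (by linarith))
    (fun k x => (hC3 k x).trans ((Finset.single_le_sum (f := C3) (fun k _ => h03 k)
      (Finset.mem_univ k)).trans (by linarith)))
  have h3 := h2.unique h1
  rw [integral_const_mul] at h3
  exact (mul_eq_zero.1 h3).resolve_left two_ne_zero

/-- The Euler-Lagrange equation of the extrinsic energy. -/
lemma IsCriticalPoint.ext_eq (hc : IsCriticalPoint N extEnergy u) (h : IsProjection N Q)
    (hu : HasSecondOrder u a b) (huN : ∀ᵐ x ∂muB, u x ∈ N) (hφ : IsTest φ) :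
    ∫ x, inner ℝ (∑ k, b k k x) (lapVariation Q u a b φ x) ∂muB = 0 := by
  rw [← integral_quad_eq_zero (S := fderiv ℝ Q) (T := fderiv ℝ (fderiv ℝ Q))
    (h.contDiff_fderiv.of_le (by norm_num)) (h.compact.fderiv ℝ)
    (h.contDiff_fderiv.fderiv_right (by norm_num)) ((h.compact.fderiv ℝ).fderiv ℝ) hu hφ]
  · refine integral_congr_ae ?_
    filter_upwards [h.quad_ae hu huN] with x hx
    rw [hx, lapVariation]
  · refine hc.hasDerivAt_of_isProjection h huN hφ fun t v hv _ => integral_congr_ae ?_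
    filter_upwards [((h.hasWeakLaplacian_variation hu hφ t).congr hv.symm
      (ae_eq_refl _)).weakLaplacian_ae] with x hx
    rw [hx]

/-- The Euler-Lagrange equation of the intrinsic energy. -/
lemma IsCriticalPoint.int_eq (hc : IsCriticalPoint N (intEnergy N) u) (h : IsProjection N Q)
    (hu : HasSecondOrder u a b) (huN : ∀ᵐ x ∂muB, u x ∈ N) (hφ : IsTest φ) :
    ∫ x, (inner ℝ (∑ k, b k k x - ∑ k, fderiv ℝ (fderiv ℝ Q) (u x) (a k x) (a k x))
        (lapVariation Q u a b φ x) +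
      inner ℝ (∑ k, b k k x) (fderiv ℝ (fderiv ℝ Q) (u x) (fderiv ℝ Q (u x) (φ x))
        (∑ k, fderiv ℝ (fderiv ℝ Q) (u x) (a k x) (a k x)))) ∂muB = 0 := by
  have hP := h.contDiff_fderiv
  have hPQ : ContDiff ℝ 1 fun y => fderiv ℝ Q (Q y) :=
    (hP.of_le (by norm_num)).comp (h.contDiff.of_le (by norm_num))
  have hPc := h.compact.fderiv ℝ
  -- The tangential projection has to be taken at the varied point Q(y) with y = u + tφ, hence the
  -- outer factor dQ(Q(y)).
  rw [← integral_quad_eq_zero (S := fun y => (fderiv ℝ Q (Q y)).comp (fderiv ℝ Q y))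
    (T := fun y => (ContinuousLinearMap.compL ℝ _ _ _ (fderiv ℝ Q (Q y))).comp
        (fderiv ℝ (fderiv ℝ Q) y)) (hPQ.clm_comp (hP.of_le (by norm_num))) ?_
    (((ContinuousLinearMap.compL ℝ (E m) (E m) (E m)).contDiff.comp hPQ).clm_comp
      (hP.fderiv_right (by norm_num)))
    ?_ hu hφ ?_]
  · refine integral_congr_ae ?_
    filter_upwards [h.quad_ae hu huN, huN] with x hx hxN
    have e1 : fderiv ℝ Q (u x) (∑ k, b k k x) = ∑ k, b k k x -
        ∑ k, fderiv ℝ (fderiv ℝ Q) (u x) (a k x) (a k x) := eq_sub_of_add_eq hx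
    -- With D = D²Q(u), the variation of the outer projection contributes ⟨PL, D(Pφ)L⟩ = ⟨L, P
    -- D(Pφ)L⟩. The differentiated idempotency turns P D(Pφ)L into D(Pφ)(L − PL) = D(Pφ)H, which is
    -- the extra term of the intrinsic equation.
    have e2 : fderiv ℝ (fderiv ℝ Q) (u x) (fderiv ℝ Q (u x) (φ x)) (∑ k, b k k x) =
        fderiv ℝ (fderiv ℝ Q) (u x) (fderiv ℝ Q (u x) (φ x)) (fderiv ℝ Q (u x) (∑ k, b k k x)) +
        fderiv ℝ Q (u x) (fderiv ℝ (fderiv ℝ Q) (u x) (fderiv ℝ Q (u x) (φ x)) (∑ k, b k k x)) :=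
      congrArg (fun A => A (∑ k, b k k x)) (h.fderiv_tangent hxN (φ x))
    have e4 : fderiv ℝ (fun y => fderiv ℝ Q (Q y)) (u x) (φ x) =
        fderiv ℝ (fderiv ℝ Q) (u x) (fderiv ℝ Q (u x) (φ x)) := by
      have h1 := (hP.differentiable (by norm_num) (Q (u x))).hasFDerivAt.comp (u x)
        (h.contDiff.differentiable (by norm_num) (u x)).hasFDerivAt
      rw [h.apply_self hxN] at h1
      exact congrArg (fun A => A (φ x)) h1.fderiv
    have e3 : ∀ v, fderiv ℝ Q (u x) (fderiv ℝ Q (u x) v) = fderiv ℝ Q (u x) v := fun v =>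
      congrArg (fun A => A v) (h.idem hxN)
    rw [quadDeriv_comp (hP.of_le (by norm_num)) (hP.fderiv_right (by norm_num)) hPQ, e4,
      quad_comp (M := fun y => fderiv ℝ Q (Q y)), hx, h.apply_self hxN, inner_add_right,
      h.inner_symm hxN, eq_sub_of_add_eq' e2.symm, h.inner_symm hxN _ (fderiv ℝ Q (u x) _), e3,
      ← h.inner_symm hxN, ← map_sub, e1, sub_sub_cancel, add_comm]
    rfl
  · refine hPc.mono fun y hy h0 => hy ?_
    simp only [h0, ContinuousLinearMap.comp_zero]
  · refine (hPc.fderiv ℝ).mono fun y hy h0 => hy ?_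
    simp only [h0, ContinuousLinearMap.comp_zero]
  · refine hc.hasDerivAt_of_isProjection h huN hφ fun t v hv hvN => integral_congr_ae ?_
    filter_upwards [hv, hvN, ((h.hasWeakLaplacian_variation hu hφ t).congr hv.symm
      (ae_eq_refl _)).weakLaplacian_ae] with x hx hxN hxL
    rw [hxL, show (tangentSpaceAt N (v x)).starProjection = fderiv ℝ Q (v x) from
      h.proj _ (hx ▸ hxN), hx]
    rw [quad_comp (M := fun y => fderiv ℝ Q (Q y))]

end Variation

/-! ### The space L²·W^{1,2} and the dual of W_0^{1,2} -/

section Dual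

open scoped ENNReal

variable {f g : E 4 → ℝ}

lemma MemW12.hasWeakPartial (h : MemW12 f) (k : Fin 4) : HasWeakPartial k f (weakPartial k f) := by
  obtain ⟨g, hg, -⟩ := h.2 k
  exact hg.weakPartial

lemma MemW12.memL2_weakPartial (h : MemW12 f) (k : Fin 4) : MemL2 (weakPartial k f) := by
  obtain ⟨g, hg, hg2⟩ := h.2 k
  exact MemLp.ae_eq hg.weakPartial_ae.symm hg2

lemma toReal_eLpNorm_le_normW12 (f : E 4 → ℝ) (k : Fin 4) :
    (eLpNorm (weakPartial k f) 2 muB).toReal ≤ normW12 f := by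
  have h := Finset.single_le_sum (f := fun k => (eLpNorm (weakPartial k f) 2 muB).toReal)
    (fun k _ => ENNReal.toReal_nonneg) (Finset.mem_univ k)
  exact h.trans (le_add_of_nonneg_left ENNReal.toReal_nonneg)

lemma MemW12.memLp_four (h : MemW12 f) : MemLp f 4 muB :=
  memLp_four_of_weakPartial h.1 h.hasWeakPartial h.memL2_weakPartial

/-- The Sobolev embedding of `W^{1,2}` to `L⁴`. -/
lemma exists_eLpNorm_four_le : ∃ C : ℝ, 0 ≤ C ∧ ∀ f, MemW12 f →
    (eLpNorm f 4 muB).toReal ≤ C * normW12 f := by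
  obtain ⟨C, hC, h⟩ := sobolev_four
  refine ⟨C.toReal, ENNReal.toReal_nonneg, fun f hf => ?_⟩
  have hfin : eLpNorm f 2 muB + ∑ k, eLpNorm (weakPartial k f) 2 muB ≠ ⊤ :=
    ENNReal.add_ne_top.2 ⟨hf.1.2.ne, ENNReal.sum_ne_top.2 fun k _ => (hf.memL2_weakPartial k).2.ne⟩
  refine (ENNReal.toReal_mono (ENNReal.mul_ne_top hC hfin)
    (h f _ hf.1 hf.hasWeakPartial hf.memL2_weakPartial)).trans_eq ?_
  rw [ENNReal.toReal_mul, ENNReal.toReal_add hf.1.2.ne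
    (ENNReal.sum_ne_top.2 fun k _ => (hf.memL2_weakPartial k).2.ne),
    ENNReal.toReal_sum fun k _ => (hf.memL2_weakPartial k).2.ne, normW12]

lemma eLpNorm_mul_le_mul {p q r : ℝ≥0∞} [ENNReal.HolderTriple p q r] (hf : MemLp f p muB)
    (hg : MemLp g q muB) :
    eLpNorm (fun x => f x * g x) r muB ≤ eLpNorm f p muB * eLpNorm g q muB :=
  eLpNorm_smul_le_mul_eLpNorm (p := p) (q := q) (r := r) (f := g) (φ := f) hg.1 hf.1

lemma abs_integral_mul_le (hf : MemL2 f) (hg : MemL2 g) :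
    |∫ x, f x * g x ∂muB| ≤ (eLpNorm f 2 muB).toReal * (eLpNorm g 2 muB).toReal := by
  have h1 : ‖∫ x, f x * g x ∂muB‖ₑ ≤ eLpNorm f 2 muB * eLpNorm g 2 muB := by
    refine (enorm_integral_le_lintegral_enorm _).trans ?_
    rw [← eLpNorm_one_eq_lintegral_enorm]
    exact eLpNorm_mul_le_mul (r := 1) hf hg
  rw [← ENNReal.toReal_mul, ← Real.norm_eq_abs, ← toReal_enorm]
  exact ENNReal.toReal_mono (ENNReal.mul_ne_top hf.2.ne hg.2.ne) h1

lemma toReal_eLpNorm_mul_le (hf : MemLp f 4 muB) (hg : MemLp g 4 muB) :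
    (eLpNorm (fun x => f x * g x) 2 muB).toReal ≤
      (eLpNorm f 4 muB).toReal * (eLpNorm g 4 muB).toReal := by
  rw [← ENNReal.toReal_mul]
  exact ENNReal.toReal_mono (ENNReal.mul_ne_top hf.2.ne hg.2.ne)
    (eLpNorm_mul_le_mul (r := 2) hf hg)

lemma memL2_mul (hf : MemLp f 4 muB) (hg : MemLp g 4 muB) : MemL2 (fun x => f x * g x) :=
  memLp_bilin (ContinuousLinearMap.mul ℝ ℝ) hf hg

/-- Functions of `L² · W^{1,2}` act continuously on `W^{1,2}`. -/
lemma MemL2W12.exists_bound {F : E 4 → ℝ} (hF : MemL2W12 F) :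
    ∃ C : ℝ, 0 ≤ C ∧ ∀ f, MemW12 f → Integrable (fun x => F x * f x) muB ∧
      |∫ x, F x * f x ∂muB| ≤ C * normW12 f := by
  obtain ⟨r, a, b, ha, hb, hab⟩ := hF
  obtain ⟨C, hC0, hC⟩ := exists_eLpNorm_four_le
  refine ⟨∑ l, (eLpNorm (a l) 2 muB).toReal * ((eLpNorm (b l) 4 muB).toReal * C), by positivity,
    fun f hf => ?_⟩
  -- Hölder with exponents 2, 4, 4: the two W^{1,2} factors are in L⁴, so their product pairs with
  -- the L² factor.
  have hl : ∀ l, MemL2 fun x => b l x * f x := fun l => memL2_mul (hb l).memLp_four hf.memLp_four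
  have hi : ∀ l, Integrable (fun x => a l x * (b l x * f x)) muB := fun l =>
    integrable_bilin (ContinuousLinearMap.mul ℝ ℝ) (ha l) (hl l)
  have hae : (fun x => ∑ l, a l x * (b l x * f x)) =ᵐ[muB] fun x => F x * f x := by
    filter_upwards [hab] with x hx
    rw [hx, Finset.sum_mul]
    simp only [mul_assoc]
  refine ⟨(integrable_finsetSum _ fun l _ => hi l).congr hae, ?_⟩
  rw [← integral_congr_ae hae, integral_finsetSum _ fun l _ => hi l, Finset.sum_mul]
  refine (Finset.abs_sum_le_sum_abs _ _).trans (Finset.sum_le_sum fun l _ => ?_)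
  refine (abs_integral_mul_le (ha l) (hl l)).trans ?_
  rw [mul_assoc, mul_assoc]
  gcongr
  exact (toReal_eLpNorm_mul_le (hb l).memLp_four hf.memLp_four).trans (by gcongr; exact hC f hf)

/-- The distribution `∂_k om + F` is in the dual of `W_0^{1,2}`. -/
lemma memWneg12_of_memL2 {om F : E 4 → ℝ} (hom : MemL2 om) (hF : MemL2W12 F) (k : Fin 4) :
    MemWneg12 fun f => - ∫ x, om x * weakPartial k f x ∂muB + ∫ x, F x * f x ∂muB := by
  obtain ⟨C, hC0, hC⟩ := hF.exists_bound
  have hi : ∀ f, MemW12 f → Integrable (fun x => om x * weakPartial k f x) muB := fun f hf =>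
    integrable_bilin (ContinuousLinearMap.mul ℝ ℝ) hom (hf.memL2_weakPartial k)
  refine ⟨fun f g hf hg => ?_, fun c f hf => ?_, ⟨(eLpNorm om 2 muB).toReal + C, fun f hf => ?_⟩⟩
  · have h1 : (fun x => om x * weakPartial k (f + g) x) =ᵐ[muB]
        fun x => om x * weakPartial k f x + om x * weakPartial k g x := by
      filter_upwards [((hf.1.hasWeakPartial k).add (hg.1.hasWeakPartial k)).weakPartial_ae]
        with x hx
      rw [← mul_add]
      exact congrArg _ hx
    have h2 : ∀ x, F x * (f + g) x = F x * f x + F x * g x := fun x => mul_add _ _ _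
    simp only [h2]
    rw [integral_congr_ae h1, integral_add (hi f hf.1) (hi g hg.1),
      integral_add (hC f hf.1).1 (hC g hg.1).1]
    ring
  · have h1 : (fun x => om x * weakPartial k (c • f) x) =ᵐ[muB]
        fun x => c * (om x * weakPartial k f x) := by
      filter_upwards [((hf.1.hasWeakPartial k).const_smul c).weakPartial_ae] with x hx
      rw [mul_left_comm]
      exact congrArg _ hx
    have h2 : ∀ x, F x * (c • f) x = c * (F x * f x) := fun x => mul_left_comm _ _ _
    simp only [h2]
    rw [integral_congr_ae h1, integral_const_mul, integral_const_mul]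
    ring
  · rw [add_mul]
    refine (abs_add_le _ _).trans (add_le_add ?_ (hC f hf.1).2)
    rw [abs_neg]
    refine (abs_integral_mul_le hom (hf.1.memL2_weakPartial k)).trans ?_
    gcongr
    exact toReal_eLpNorm_le_normW12 f k

lemma memL2W12_inner {m : ℕ} {c d : E 4 → E m} (hc : MemL2 c) (hd : ∀ l, MemW12 fun x => d x l) :
    MemL2W12 fun x => inner ℝ (c x) (d x) := by
  refine ⟨m, fun l x => c x l, fun l x => d x l, fun l => MemLp.coord hc l, hd,
    Eventually.of_forall fun x => ?_⟩
  simp only [PiLp.inner_apply]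
  exact Finset.sum_congr rfl fun l _ => mul_comm _ _

lemma MemL2W12.add {F F' : E 4 → ℝ} (hF : MemL2W12 F) (hF' : MemL2W12 F') :
    MemL2W12 fun x => F x + F' x := by
  obtain ⟨r, a, b, ha, hb, hab⟩ := hF
  obtain ⟨r', a', b', ha', hb', hab'⟩ := hF'
  refine ⟨r + r', Fin.append a a', Fin.append b b', fun l => ?_, fun l => ?_, ?_⟩
  · refine Fin.addCases (fun l => ?_) (fun l => ?_) l
    · simpa using ha l
    · simpa using ha' l
  · refine Fin.addCases (fun l => ?_) (fun l => ?_) l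
    · simpa using hb l
    · simpa using hb' l
  · filter_upwards [hab, hab'] with x hx hx'
    rw [hx, hx', Fin.sum_univ_add]
    simp

end Dual

/-! ### Pointwise algebra of the Euler–Lagrange equation -/

section Algebra

variable {m : ℕ}

lemma inner_single (v : E m) (i : Fin m) : inner ℝ v (EuclideanSpace.single i (1 : ℝ)) = v i := by
  simp [EuclideanSpace.inner_single_right]

lemma sum_clm_single (f : E m →L[ℝ] ℝ) (v : E m) :
    ∑ j, f (EuclideanSpace.single j 1) * v j = f v := by
  conv_rhs => rw [← sum_coord_smul v]
  simp only [map_sum, map_smul, smul_eq_mul, mul_comm]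

/-- The entries of the commutator of `R` and `P`. -/
def commEntry (P R : E m →L[ℝ] E m) (i j : Fin m) : ℝ :=
  (R (P (EuclideanSpace.single j 1)) - P (R (EuclideanSpace.single j 1))) i

/-- The entries of the coefficient `w` (in terms of `G` and `D`, with the commutator added). -/
def divEntry (D : E m →L[ℝ] E m →L[ℝ] E m) (G : E m) (i j : Fin m) : ℝ :=
  2 * inner ℝ G (D (EuclideanSpace.single j 1) (EuclideanSpace.single i 1))

/-- The vectors by which the first part of the coefficient `F` is represented. -/
def multVec (σ : ℝ) (P R : E m →L[ℝ] E m) (D : E m →L[ℝ] E m →L[ℝ] E m) (L : E m) (i : Fin m) :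
    E m :=
  (σ - 2) • R (EuclideanSpace.single i 1) -
    σ • adjointL m m (D (P (EuclideanSpace.single i 1))) L

/-- The entries of the coefficient `F`. -/
def multEntry (σ : ℝ) (P R : E m →L[ℝ] E m) (D : E m →L[ℝ] E m →L[ℝ] E m) (L : E m)
    (A : E m →L[ℝ] E m) (i j : Fin m) : ℝ :=
  inner ℝ (multVec σ P R D L i) (A (EuclideanSpace.single j 1)) +
    inner ℝ ((2 : ℝ) • D (EuclideanSpace.single j 1) L) (A (EuclideanSpace.single i 1))

lemma sum_commEntry (P R : E m →L[ℝ] E m) (i : Fin m) (v : E m) :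
    ∑ j, commEntry P R i j * v j = (R (P v) - P (R v)) i :=
  sum_clm_single ((EuclideanSpace.proj i : E m →L[ℝ] ℝ).comp (R.comp P - P.comp R)) v

lemma sum_divEntry (D : E m →L[ℝ] E m →L[ℝ] E m) (G : E m) (i : Fin m) (v : E m) :
    ∑ j, divEntry D G i j * v j = 2 * inner ℝ G (D v (EuclideanSpace.single i 1)) :=
  sum_clm_single ((2 : ℝ) • (innerSL ℝ G).comp
    ((ContinuousLinearMap.apply ℝ (E m) (EuclideanSpace.single i (1 : ℝ) : E m)).comp D)) v

/-- For v = ∂_k u and A = D(v) symmetric, the last term is the i-th component of 2A²L. Of its two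
factors A, one is written as D(v) and supplies the gradient of u, while the other is kept as the
W^{1,2} factor. -/
lemma sum_multEntry (σ : ℝ) (P R : E m →L[ℝ] E m) (D : E m →L[ℝ] E m →L[ℝ] E m) (L : E m)
    (A : E m →L[ℝ] E m) (i : Fin m) (v : E m) :
    ∑ j, multEntry σ P R D L A i j * v j = inner ℝ (multVec σ P R D L i) (A v) +
      2 * inner ℝ (D v L) (A (EuclideanSpace.single i 1)) := by
  have h1 := sum_clm_single ((innerSL ℝ (multVec σ P R D L i)).comp A +
    (2 : ℝ) • (innerSL ℝ (A (EuclideanSpace.single i (1 : ℝ) : E m))).comp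
    ((ContinuousLinearMap.apply ℝ (E m) L).comp D)) v
  have h2 : ∀ v, ((innerSL ℝ (multVec σ P R D L i)).comp A +
    (2 : ℝ) • (innerSL ℝ (A (EuclideanSpace.single i (1 : ℝ) : E m))).comp
    ((ContinuousLinearMap.apply ℝ (E m) L).comp D)) v = inner ℝ (multVec σ P R D L i) (A v) +
      2 * inner ℝ (D v L) (A (EuclideanSpace.single i 1)) := fun v => by
    rw [real_inner_comm (A _) (D v L)]
    rfl
  rw [h2] at h1
  rw [← h1]
  refine Finset.sum_congr rfl fun j _ => ?_
  rw [h2, multEntry, real_inner_smul_left]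

/-- The algebra which turns the Euler-Lagrange equation into the fourth order system. -/
lemma euler_lagrange_algebra {σ : ℝ} {P R : E m →L[ℝ] E m} {D : E m →L[ℝ] E m →L[ℝ] E m}
    {a b : Fin 4 → E m} {L H : E m} (hL : L = ∑ k, b k) (hH : H = ∑ k, D (a k) (a k))
    (hP : ∀ v w, inner ℝ (P v) w = inner ℝ v (P w))
    (hPP : ∀ v, P (P v) = P v) (hR : ∀ v w, inner ℝ (R v) w = inner ℝ v (R w))
    (hA : ∀ k v w, inner ℝ (D (a k) v) w = inner ℝ v (D (a k) w)) (hLH : P L = L - H)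
    (hRP : ∀ v, R v = R (P v) + P (R v) + (2 : ℝ) • ∑ k, D (a k) (D (a k) v))
    (i : Fin m) (ϕ lap : ℝ) (dϕ : Fin 4 → ℝ) :
    inner ℝ (L - σ • H) (ϕ • R (EuclideanSpace.single i 1) + lap • P (EuclideanSpace.single i 1) +
        (2 : ℝ) • ∑ k, dϕ k • D (a k) (EuclideanSpace.single i 1)) +
      σ * inner ℝ L (D (P (ϕ • EuclideanSpace.single i 1)) H) =
    L i * lap - ((∑ k, ∑ j, D (a k) (EuclideanSpace.single j 1) i * a k j) * lap -
      ∑ k, (∑ j, (divEntry D (L - σ • H) i j - commEntry P R i j) * a k j) * dϕ k +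
      ∑ k, ∑ j, (-(commEntry P R i j * (dϕ k * a k j + ϕ * b k j)) +
        multEntry σ P R D L (D (a k)) i j * (ϕ * a k j))) := by
  have s1 : ∀ k, ∑ j, D (a k) (EuclideanSpace.single j 1) i * a k j = D (a k) (a k) i := fun k =>
    sum_clm_single ((EuclideanSpace.proj i : E m →L[ℝ] ℝ).comp (D (a k))) (a k)
  have s2 : ∀ k, ∑ j, (divEntry D (L - σ • H) i j - commEntry P R i j) * a k j =
      2 * inner ℝ (L - σ • H) (D (a k) (EuclideanSpace.single i 1)) -
        ∑ j, commEntry P R i j * a k j := fun k => by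
    rw [← sum_divEntry, ← Finset.sum_sub_distrib]
    exact Finset.sum_congr rfl fun j _ => sub_mul _ _ _
  have s3 : ∀ k, ∑ j, (-(commEntry P R i j * (dϕ k * a k j + ϕ * b k j)) +
        multEntry σ P R D L (D (a k)) i j * (ϕ * a k j)) =
      -(dϕ k * ∑ j, commEntry P R i j * a k j) - ϕ * ∑ j, commEntry P R i j * b k j +
        ϕ * (inner ℝ (multVec σ P R D L i) (D (a k) (a k)) +
          2 * inner ℝ (D (a k) (D (a k) L)) (EuclideanSpace.single i 1)) := fun k => by
    rw [hA k (D (a k) L), ← sum_multEntry, Finset.mul_sum, Finset.mul_sum, Finset.mul_sum,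
      ← Finset.sum_neg_distrib, ← Finset.sum_sub_distrib, ← Finset.sum_add_distrib]
    exact Finset.sum_congr rfl fun j _ => by ring
  have s4 : ∑ k, ∑ j, commEntry P R i j * b k j = (R (P L) - P (R L)) i := by
    rw [← sum_commEntry, Finset.sum_comm, hL]
    refine Finset.sum_congr rfl fun j _ => ?_
    rw [← Finset.mul_sum]
    simp
  have hPH : P H = 0 := by
    have h1 := congrArg P hLH
    rw [hPP, map_sub] at h1
    exact sub_eq_self.1 h1.symm
  have s5 : ∑ k, inner ℝ (multVec σ P R D L i) (D (a k) (a k)) = inner ℝ (multVec σ P R D L i) H := by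
    rw [hH, inner_sum]
  have s6 : inner ℝ (multVec σ P R D L i) H = (σ - 2) * inner ℝ (R H) (EuclideanSpace.single i 1) -
      σ * inner ℝ L (D (P (EuclideanSpace.single i 1)) H) := by
    rw [multVec, inner_sub_left, real_inner_smul_left, real_inner_smul_left, adjointL_inner, hR,
      real_inner_comm, hR, real_inner_comm]
  -- The twice differentiated idempotency, applied to L. Together with RPL = RL − RH it gives RL =
  -- [R,P]L + 2RH − 2 Σ A_k² L, where A_k = D(a_k).
  have s7 : 2 * ∑ k, inner ℝ (D (a k) (D (a k) L)) (EuclideanSpace.single i (1 : ℝ)) =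
      R L i - R (P L) i - P (R L) i := by
    have h1 := congrArg (fun v : E m => v i) (hRP L)
    simp only [inner_single]
    simp only [PiLp.add_apply, PiLp.smul_apply, smul_eq_mul] at h1
    have h2 : (∑ k, D (a k) (D (a k) L)) i = ∑ k, D (a k) (D (a k) L) i := by simp
    rw [h2] at h1
    linarith
  have s8 : R (P L) i = R L i - R H i := by
    rw [hLH, map_sub]
    rfl
  have s9 : ∑ k, D (a k) (a k) i = H i := by
    rw [hH]
    simp
  have e1 : inner ℝ (L - σ • H) (R (EuclideanSpace.single i 1)) = R L i - σ * R H i := by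
    rw [← hR, inner_single, map_sub, map_smul]
    rfl
  have e2 : inner ℝ (L - σ • H) (P (EuclideanSpace.single i 1)) = L i - H i := by
    rw [← hP, inner_single, map_sub, map_smul, hPH, hLH, smul_zero, sub_zero]
    rfl
  have e3 : inner ℝ (L - σ • H) (∑ k, dϕ k • D (a k) (EuclideanSpace.single i 1)) =
      ∑ k, dϕ k * inner ℝ (L - σ • H) (D (a k) (EuclideanSpace.single i 1)) := by
    rw [inner_sum]
    exact Finset.sum_congr rfl fun k _ => real_inner_smul_right _ _ _
  simp only [s1, s2, s3, s9]
  rw [inner_add_right, inner_add_right, real_inner_smul_right, real_inner_smul_right,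
    real_inner_smul_right, e1, e2, e3, map_smul, map_smul, smul_apply, real_inner_smul_right]
  simp only [Finset.sum_add_distrib, Finset.sum_sub_distrib, Finset.sum_neg_distrib,
    ← Finset.mul_sum, sub_mul, s4, s5]
  rw [s7, s6, s8, inner_single]
  have e4 : ∑ k, 2 * inner ℝ (L - σ • H) (D (a k) (EuclideanSpace.single i 1)) * dϕ k =
      2 * ∑ k, dϕ k * inner ℝ (L - σ • H) (D (a k) (EuclideanSpace.single i 1)) := by
    rw [Finset.mul_sum]
    exact Finset.sum_congr rfl fun k _ => by ring
  have e5 : ∑ k, (∑ j, commEntry P R i j * a k j) * dϕ k =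
      ∑ k, dϕ k * ∑ j, commEntry P R i j * a k j :=
    Finset.sum_congr rfl fun k _ => mul_comm _ _
  have e6 : (R (P L) - P (R L)) i = R L i - R H i - P (R L) i := by
    rw [← s8]
    rfl
  rw [e4, e5, e6]
  ring

end Algebra

/-! ### Integrability of the coefficients and the equation for them -/

section System

set_option maxSynthPendingDepth 3

open scoped ENNReal

variable {m : ℕ} {N : Set (E m)} {Q : E m → E m} {u : E 4 → E m} {a : Fin 4 → E 4 → E m}
  {b : Fin 4 → Fin 4 → E 4 → E m}

/-- The Laplacian of `u`. -/
def lap (b : Fin 4 → Fin 4 → E 4 → E m) (x : E 4) : E m := ∑ k, b k k x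

/-- The normal part of the Laplacian of `u`. -/
def normalLap (Q : E m → E m) (u : E 4 → E m) (a : Fin 4 → E 4 → E m) (x : E 4) : E m :=
  ∑ k, fderiv ℝ (fderiv ℝ Q) (u x) (a k x) (a k x)

lemma IsTest.smul_single {ϕ : E 4 → ℝ} (hϕ : IsTest ϕ) (v : E m) : IsTest fun x => ϕ x • v :=
  hϕ.of_support_subset (hϕ.smooth.smul contDiff_const) fun x hx =>
    subset_tsupport ϕ fun h0 => hx (by simp [h0])

lemma fderiv_smul_single {ϕ : E 4 → ℝ} (hϕ : IsTest ϕ) (v : E m) (k : Fin 4) (x : E 4) :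
    fderiv ℝ (fun x => ϕ x • v) x (e k) = partialD k ϕ x • v := by
  rw [fderiv_smul_const hϕ.differentiable.differentiableAt]
  rfl

lemma laplacian_smul_single {ϕ : E 4 → ℝ} (hϕ : IsTest ϕ) (v : E m) (x : E 4) :
    ∑ k, fderiv ℝ (fun y => fderiv ℝ (fun x => ϕ x • v) y (e k)) x (e k) = (Δ ϕ) x • v := by
  simp only [fderiv_smul_single hϕ, fderiv_smul_single (hϕ.partialD _)]
  rw [← Finset.sum_smul, laplacian_eq_sum (contDiff_infty.1 hϕ.smooth 2)]

/-- The Euler-Lagrange equations of both energies: `σ = 0` for the extrinsic one, `σ = 1` for the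
intrinsic one. -/
lemma exists_euler_lagrange (h : IsProjection N Q) (hu : HasSecondOrder u a b)
    (huN : ∀ᵐ x ∂muB, u x ∈ N)
    (hcrit : IsCriticalPoint N extEnergy u ∨ IsCriticalPoint N (intEnergy N) u) :
    ∃ σ : ℝ, ∀ φ : E 4 → E m, IsTest φ →
      ∫ x, (inner ℝ (lap b x - σ • normalLap Q u a x) (lapVariation Q u a b φ x) +
        σ * inner ℝ (lap b x) (fderiv ℝ (fderiv ℝ Q) (u x) (fderiv ℝ Q (u x) (φ x))
          (normalLap Q u a x))) ∂muB = 0 := by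
  rcases hcrit with hc | hc
  · refine ⟨0, fun φ hφ => ?_⟩
    simpa only [zero_smul, zero_mul, sub_zero, add_zero, lap] using hc.ext_eq h hu huN hφ
  · refine ⟨1, fun φ hφ => ?_⟩
    simpa only [one_smul, one_mul, lap, normalLap] using hc.int_eq h hu huN hφ

lemma HasSecondOrder.memL2_lap (hu : HasSecondOrder u a b) : MemL2 (lap b) :=
  memLp_finsetSum _ fun k _ => hu.mem_b k k

variable (h : IsProjection N Q) (hu : HasSecondOrder u a b)
include h hu

lemma IsProjection.memLp_grad (k : Fin 4) :
    MemLp (fun x => fderiv ℝ (fderiv ℝ Q) (u x) (a k x)) 4 muB :=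
  hu.comp_mem_a (h.contDiff_fderiv.of_le (by norm_num)) (h.compact.fderiv ℝ) k

lemma IsProjection.memL2_normalLap : MemL2 (normalLap Q u a) :=
  memLp_finsetSum _ fun k _ =>
    memLp_clm_apply (p := 4) (q := 4) (r := 2) (h.memLp_grad hu k) (hu.mem_a k)

lemma IsProjection.memL2_lapProj : MemL2 (lapProj Q u a b) :=
  memLp_finsetSum _ fun k _ =>
    hu.comp_mem_b (h.contDiff_fderiv.of_le (by norm_num)) (h.compact.fderiv ℝ) k k

/-- The weak derivatives of ∂_kP are D³Q(u)(∂_j u, ∂_k u) + D²Q(u)(∂_j∂_k u), in L² by the L⁴ bound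
on ∇u. This serves both V and the W^{1,2} factors of F. -/
lemma IsProjection.memW12_grad_entry (k : Fin 4) (v : E m) (l : Fin m) :
    MemW12 fun x => fderiv ℝ (fderiv ℝ Q) (u x) (a k x) v l := by
  let ev : (E m →L[ℝ] E m) →L[ℝ] ℝ :=
    (EuclideanSpace.proj l : E m →L[ℝ] ℝ).comp (ContinuousLinearMap.apply ℝ (E m) v)
  have hP : ContDiff ℝ 3 (fderiv ℝ Q) := h.contDiff_fderiv.of_le (by norm_num)
  refine ⟨ev.comp_memLp' ((h.memLp_grad hu k).mono_exponent (by norm_num)), fun j => ⟨_,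
    (hu.comp_partial_partial hP (h.compact.fderiv ℝ) j k).clm ev,
    ev.comp_memLp' (hu.comp_mem_b hP (h.compact.fderiv ℝ) j k)⟩⟩

lemma IsProjection.memL2_apply_lapProj (v : E m) : MemL2 fun x => lapProj Q u a b x v :=
  (ContinuousLinearMap.apply ℝ (E m) v).comp_memLp' (h.memL2_lapProj hu)

lemma IsProjection.memL2_commEntry (i j : Fin m) :
    MemL2 fun x => commEntry (fderiv ℝ Q (u x)) (lapProj Q u a b x) i j := by
  have hP : MemLp (fun x => fderiv ℝ Q (u x)) ∞ muB :=
    memLp_top_comp h.contDiff_fderiv.continuous (h.compact.fderiv ℝ) hu.mem.1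
  have h1 : MemLp (fun x => fderiv ℝ Q (u x) (EuclideanSpace.single j 1)) ∞ muB :=
    (ContinuousLinearMap.apply ℝ (E m) (EuclideanSpace.single j (1 : ℝ) : E m)).comp_memLp' hP
  exact MemLp.coord ((memLp_clm_apply (p := 2) (q := ∞) (r := 2) (h.memL2_lapProj hu) h1).sub
    (memLp_clm_apply (p := ∞) (q := 2) (r := 2) hP (h.memL2_apply_lapProj hu _))) i

lemma IsProjection.memLp_top_second (v : E m) :
    MemLp (fun x => fderiv ℝ (fderiv ℝ Q) (u x) v) ∞ muB := by
  refine memLp_top_comp (w := fun y => fderiv ℝ (fderiv ℝ Q) y v)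
    ((h.contDiff_fderiv.continuous_fderiv (by norm_num)).clm_apply continuous_const) ?_ hu.mem.1
  refine ((h.compact.fderiv ℝ).fderiv ℝ).mono fun y hy h0 => hy ?_
  simp only [h0, zero_apply]

lemma IsProjection.memL2_divEntry (σ : ℝ) (i j : Fin m) :
    MemL2 fun x => divEntry (fderiv ℝ (fderiv ℝ Q) (u x)) (lap b x - σ • normalLap Q u a x) i j := by
  have h1 : MemL2 fun x => lap b x - σ • normalLap Q u a x :=
    MemLp.sub hu.memL2_lap (MemLp.const_smul (h.memL2_normalLap hu) σ)
  have h2 := (ContinuousLinearMap.apply ℝ (E m) (EuclideanSpace.single i (1 : ℝ) : E m)).comp_memLp'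
    (h.memLp_top_second hu (EuclideanSpace.single j (1 : ℝ) : E m))
  exact MemLp.const_mul (memLp_bilin (innerSL ℝ) (p := 2) (q := ∞) (r := 2) h1 h2) 2

/-- Each summand pairs an L² vector, built from ΔP or Δu with bounded coefficients, with ∂_kP
applied to a fixed basis vector, whose entries are in W^{1,2}. -/
lemma IsProjection.memL2W12_multEntry (σ : ℝ) (k : Fin 4) (i j : Fin m) :
    MemL2W12 fun x => multEntry σ (fderiv ℝ Q (u x)) (lapProj Q u a b x)
      (fderiv ℝ (fderiv ℝ Q) (u x)) (lap b x) (fderiv ℝ (fderiv ℝ Q) (u x) (a k x)) i j := by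
  refine (memL2W12_inner ?_ fun l => h.memW12_grad_entry hu k _ l).add
    (memL2W12_inner ?_ fun l => h.memW12_grad_entry hu k _ l)
  · have h1 : MemL2 fun x => (σ - 2) • lapProj Q u a b x (EuclideanSpace.single i 1) :=
      MemLp.const_smul (h.memL2_apply_lapProj hu (EuclideanSpace.single i 1)) (σ - 2)
    have h2 : MemL2 fun x => adjointL m m (fderiv ℝ (fderiv ℝ Q) (u x)
        (fderiv ℝ Q (u x) (EuclideanSpace.single i 1))) (lap b x) := by
      refine memLp_clm_apply (p := ∞) (q := 2) (r := 2) ((adjointL m m).comp_memLp' ?_) hu.memL2_lap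
      refine memLp_top_comp
        (w := fun y => fderiv ℝ (fderiv ℝ Q) y (fderiv ℝ Q y (EuclideanSpace.single i 1)))
        ((h.contDiff_fderiv.continuous_fderiv (by norm_num)).clm_apply
          (h.contDiff_fderiv.continuous.clm_apply continuous_const)) ?_ hu.mem.1
      refine ((h.compact.fderiv ℝ).fderiv ℝ).mono fun y hy h0 => hy ?_
      simp only [h0, zero_apply]
    exact MemLp.sub h1 (MemLp.const_smul h2 σ)
  · have h1 : MemL2 fun x => fderiv ℝ (fderiv ℝ Q) (u x) (EuclideanSpace.single j 1) (lap b x) :=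
      memLp_clm_apply (p := ∞) (q := 2) (r := 2) (h.memLp_top_second hu _) hu.memL2_lap
    exact MemLp.const_smul h1 (2 : ℝ)

lemma IsProjection.lapProj_symm_ae (huN : ∀ᵐ x ∂muB, u x ∈ N) : ∀ᵐ x ∂muB, ∀ v w,
    inner ℝ (lapProj Q u a b x v) w = inner ℝ v (lapProj Q u a b x w) := by
  filter_upwards [ae_all_iff.2 fun k => h.symm_ae hu huN k k] with x hR v w
  simp only [lapProj, sum_apply, sum_inner, inner_sum, hR]

lemma IsProjection.lapProj_idem_ae (huN : ∀ᵐ x ∂muB, u x ∈ N) : ∀ᵐ x ∂muB, ∀ v,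
    lapProj Q u a b x v = lapProj Q u a b x (fderiv ℝ Q (u x) v) +
      fderiv ℝ Q (u x) (lapProj Q u a b x v) + (2 : ℝ) • ∑ k, fderiv ℝ (fderiv ℝ Q) (u x) (a k x)
        (fderiv ℝ (fderiv ℝ Q) (u x) (a k x) v) := by
  filter_upwards [ae_all_iff.2 fun k => h.idem_ae hu huN k k] with x hR v
  have h1 : ∀ k, hessProj Q u a b k k x v = hessProj Q u a b k k x (fderiv ℝ Q (u x) v) +
      fderiv ℝ Q (u x) (hessProj Q u a b k k x v) +
      (2 : ℝ) • fderiv ℝ (fderiv ℝ Q) (u x) (a k x)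
        (fderiv ℝ (fderiv ℝ Q) (u x) (a k x) v) := fun k => by
    rw [two_smul]
    exact congrArg (fun A => A v) (hR k)
  simp only [lapProj, sum_apply, map_sum, Finset.smul_sum, ← Finset.sum_add_distrib]
  exact Finset.sum_congr rfl fun k _ => h1 k

/-- The commutator of two symmetric maps is antisymmetric. -/
lemma IsProjection.commEntry_antisymm (huN : ∀ᵐ x ∂muB, u x ∈ N) : ∀ᵐ x ∂muB, ∀ i j,
    commEntry (fderiv ℝ Q (u x)) (lapProj Q u a b x) j i =
      - commEntry (fderiv ℝ Q (u x)) (lapProj Q u a b x) i j := by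
  filter_upwards [huN, h.lapProj_symm_ae hu huN] with x hx hR i j
  have h1 : ∀ v w, inner ℝ (lapProj Q u a b x (fderiv ℝ Q (u x) v) -
      fderiv ℝ Q (u x) (lapProj Q u a b x v)) w = - inner ℝ (lapProj Q u a b x
        (fderiv ℝ Q (u x) w) - fderiv ℝ Q (u x) (lapProj Q u a b x w)) v := fun v w => by
    rw [real_inner_comm v, inner_sub_left, inner_sub_right, hR, h.inner_symm hx, h.inner_symm hx,
      hR, neg_sub]
  have h2 := h1 (EuclideanSpace.single i 1) (EuclideanSpace.single j 1)
  rwa [inner_single, inner_single] at h2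

/-- The integrand of the Euler-Lagrange equation in terms of the coefficients of the system. -/
lemma IsProjection.first_variation_ae (huN : ∀ᵐ x ∂muB, u x ∈ N) {ϕ : E 4 → ℝ} (hϕ : IsTest ϕ)
    (σ : ℝ) (i : Fin m) : ∀ᵐ x ∂muB,
    inner ℝ (lap b x - σ • normalLap Q u a x)
        (lapVariation Q u a b (fun x => ϕ x • EuclideanSpace.single i 1) x) +
      σ * inner ℝ (lap b x) (fderiv ℝ (fderiv ℝ Q) (u x) (fderiv ℝ Q (u x)
        (ϕ x • EuclideanSpace.single i 1)) (normalLap Q u a x)) =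
    lap b x i * (Δ ϕ) x -
      ((∑ k, ∑ j, fderiv ℝ (fderiv ℝ Q) (u x) (a k x) (EuclideanSpace.single j 1) i * a k x j) *
        (Δ ϕ) x -
      ∑ k, (∑ j, (divEntry (fderiv ℝ (fderiv ℝ Q) (u x)) (lap b x - σ • normalLap Q u a x) i j -
        commEntry (fderiv ℝ Q (u x)) (lapProj Q u a b x) i j) * a k x j) * partialD k ϕ x +
      ∑ k, ∑ j, (-(commEntry (fderiv ℝ Q (u x)) (lapProj Q u a b x) i j *
          (partialD k ϕ x * a k x j + ϕ x * b k k x j)) +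
        multEntry σ (fderiv ℝ Q (u x)) (lapProj Q u a b x) (fderiv ℝ (fderiv ℝ Q) (u x)) (lap b x)
          (fderiv ℝ (fderiv ℝ Q) (u x) (a k x)) i j * (ϕ x * a k x j))) := by
  filter_upwards [huN, h.lapProj_symm_ae hu huN, h.lapProj_idem_ae hu huN, h.quad_ae hu huN,
    ae_all_iff.2 fun k => h.symm_fderiv_ae hu huN k] with x hx hR hRP hq hA
  rw [h.lapVariation_eq, laplacian_smul_single hϕ]
  simp only [fderiv_smul_single hϕ, map_smul (fderiv ℝ (fderiv ℝ Q) (u x) _),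
    map_smul (lapProj Q u a b x)]
  have h1 : fderiv ℝ Q (u x) ((Δ ϕ) x • EuclideanSpace.single i 1) =
      (Δ ϕ) x • fderiv ℝ Q (u x) (EuclideanSpace.single i 1) := map_smul _ _ _
  rw [h1]
  have hPP : ∀ v, fderiv ℝ Q (u x) (fderiv ℝ Q (u x) v) = fderiv ℝ Q (u x) v := fun v =>
    congrArg (fun A => A v) (h.idem hx)
  have hLH : fderiv ℝ Q (u x) (lap b x) = lap b x - normalLap Q u a x := eq_sub_of_add_eq hq
  have key := euler_lagrange_algebra (σ := σ) (P := fderiv ℝ Q (u x)) (R := lapProj Q u a b x)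
    (D := fderiv ℝ (fderiv ℝ Q) (u x)) (a := fun k => a k x) (b := fun k => b k k x)
    (L := lap b x) (H := normalLap Q u a x) rfl rfl (h.inner_symm hx) hPP hR hA hLH hRP i (ϕ x)
    ((Δ ϕ) x) fun k => partialD k ϕ x
  convert key using 2

end System

/-! ### The coefficients of the system and the weak equation -/

section Coefficients

variable {m : ℕ} {N : Set (E m)} {Q : E m → E m} {u : E 4 → E m}
  {b : Fin 4 → Fin 4 → E 4 → E m}

/-- The coefficient `V` of the system. -/
def coeffV (Q : E m → E m) (u : E 4 → E m) (k : Fin 4) (x : E 4) : Matrix (Fin m) (Fin m) ℝ :=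
  Matrix.of fun i j =>
    fderiv ℝ (fderiv ℝ Q) (u x) (weakPartial k u x) (EuclideanSpace.single j 1) i

/-- The antisymmetric coefficient `ω` of the system. -/
def coeffOm (Q : E m → E m) (u : E 4 → E m) (b : Fin 4 → Fin 4 → E 4 → E m) (x : E 4) :
    Matrix (Fin m) (Fin m) ℝ :=
  Matrix.of fun i j =>
    commEntry (fderiv ℝ Q (u x)) (lapProj Q u (fun k => weakPartial k u) b x) i j

/-- The coefficient `w` of the system. -/
def coeffw (σ : ℝ) (Q : E m → E m) (u : E 4 → E m) (b : Fin 4 → Fin 4 → E 4 → E m) (x : E 4) :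
    Matrix (Fin m) (Fin m) ℝ :=
  Matrix.of fun i j => divEntry (fderiv ℝ (fderiv ℝ Q) (u x))
    (lap b x - σ • normalLap Q u (fun k => weakPartial k u) x) i j -
      commEntry (fderiv ℝ Q (u x)) (lapProj Q u (fun k => weakPartial k u) b x) i j

/-- The coefficient `F` of the system. -/
def coeffF (σ : ℝ) (Q : E m → E m) (u : E 4 → E m) (b : Fin 4 → Fin 4 → E 4 → E m) (k : Fin 4)
    (x : E 4) : Matrix (Fin m) (Fin m) ℝ :=
  Matrix.of fun i j => multEntry σ (fderiv ℝ Q (u x)) (lapProj Q u (fun k => weakPartial k u) b x)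
    (fderiv ℝ (fderiv ℝ Q) (u x)) (lap b x)
    (fderiv ℝ (fderiv ℝ Q) (u x) (weakPartial k u x)) i j

/-- The coefficient `W = ∇ ω + F` of the system. -/
def coeffW (σ : ℝ) (Q : E m → E m) (u : E 4 → E m) (b : Fin 4 → Fin 4 → E 4 → E m) (k : Fin 4)
    (i j : Fin m) (f : E 4 → ℝ) : ℝ :=
  - ∫ x, coeffOm Q u b x i j * weakPartial k f x ∂muB + ∫ x, coeffF σ Q u b k x i j * f x ∂muB

variable (h : IsProjection N Q) (hu : HasSecondOrder u (fun k => weakPartial k u) b)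
  (huN : ∀ᵐ x ∂muB, u x ∈ N)
include h hu huN

lemma IsProjection.isAdmissible (σ : ℝ) :
    IsAdmissible (coeffV Q u) (coeffw σ Q u b) (coeffW σ Q u b) where
  memV k i j := h.memW12_grad_entry hu k _ i
  mem_w i j := MemLp.sub (h.memL2_divEntry hu σ i j) (h.memL2_commEntry hu i j)
  memW k i j := memWneg12_of_memL2 (h.memL2_commEntry hu i j) (h.memL2W12_multEntry hu σ k i j) k
  decomp := by
    refine ⟨coeffOm Q u b, coeffF σ Q u b, fun i j => h.memL2_commEntry hu i j, ?_,
      fun k i j => h.memL2W12_multEntry hu σ k i j, fun k i j φ hφ => ?_⟩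
    · filter_upwards [h.commEntry_antisymm hu huN] with x hx
      ext i j
      exact hx i j
    -- The functional is defined through weak derivatives so that it acts on all of W_0^{1,2}; on
    -- test functions these agree a.e. with the classical ones.
    · have h1 : (fun x => coeffOm Q u b x i j * weakPartial k φ x) =ᵐ[muB]
          fun x => coeffOm Q u b x i j * partialD k φ x := by
        filter_upwards [(hasWeakPartial_of_contDiff (contDiff_infty.1 hφ.smooth 1) k).weakPartial_ae]
          with x hx
        rw [hx, partialD]
      rw [coeffW, integral_congr_ae h1]

lemma IsProjection.isSolution {σ : ℝ} (hσ : ∀ φ : E 4 → E m, IsTest φ →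
      ∫ x, (inner ℝ (lap b x - σ • normalLap Q u (fun k => weakPartial k u) x)
          (lapVariation Q u (fun k => weakPartial k u) b φ x) +
        σ * inner ℝ (lap b x) (fderiv ℝ (fderiv ℝ Q) (u x) (fderiv ℝ Q (u x) (φ x))
          (normalLap Q u (fun k => weakPartial k u) x))) ∂muB = 0) :
    IsSolution (coeffV Q u) (coeffw σ Q u b) (coeffW σ Q u b) u := by
  intro i ϕ hϕ
  have hmul : ∀ {f g : E 4 → ℝ}, MemL2 f → MemL2 g → Integrable (fun x => f x * g x) muB :=
    fun hf hg => integrable_bilin (ContinuousLinearMap.mul ℝ ℝ) hf hg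
  have htest : ∀ {f ψ : E 4 → ℝ}, Integrable f muB → IsTest ψ →
      Integrable (fun x => f x * ψ x) muB := fun hf hψ => by
    obtain ⟨C, -, hC⟩ := hψ.bounded
    exact hf.mul_bdd hψ.continuous.aestronglyMeasurable (Eventually.of_forall hC)
  have hbdd : ∀ {f ψ : E 4 → ℝ}, MemL2 f → IsTest ψ → MemL2 fun x => ψ x * f x :=
    fun hf hψ => by
    obtain ⟨C, -, hC⟩ := hψ.bounded
    exact MemLp.bdd_smul hψ.continuous.aestronglyMeasurable hC hf
  have ha : ∀ k j, MemL2 fun x => weakPartial k u x j := fun k j => MemLp.coord (hu.mem_a2 k) j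
  have hb : ∀ l k j, MemL2 fun x => b l k x j := fun l k j => MemLp.coord (hu.mem_b l k) j
  have hw : ∀ l k j, HasWeakPartial l (fun x => ϕ x * weakPartial k u x j)
      (fun x => partialD l ϕ x * weakPartial k u x j + ϕ x * b l k x j) := fun l k j =>
    ((hu.partial_a l k).coord j).test_smul hϕ.smooth
  have hw2 : ∀ l k j, MemL2 fun x => partialD l ϕ x * weakPartial k u x j + ϕ x * b l k x j :=
    fun l k j => MemLp.add (hbdd (ha k j) (hϕ.partialD l)) (hbdd (hb l k j) hϕ)
  have hW : ∀ k j, MemW12 fun x => ϕ x * weakPartial k u x j := fun k j =>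
    ⟨hbdd (ha k j) hϕ, fun l => ⟨_, hw l k j, hw2 l k j⟩⟩
  -- The product rule splits the pairing of ∇ω with ϕ∂_k u. The part with ∂_kϕ is cancelled by the
  -- summand −ω of w, and the part with ϕ leaves −ωΔu.
  have hY : ∀ k j, ∫ x, coeffOm Q u b x i j * weakPartial k (fun x => ϕ x * weakPartial k u x j) x
      ∂muB = ∫ x, coeffOm Q u b x i j *
        (partialD k ϕ x * weakPartial k u x j + ϕ x * b k k x j) ∂muB := fun k j => by
    refine integral_congr_ae ?_
    filter_upwards [(hw k k j).weakPartial_ae] with x hx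
    rw [hx]
  have iL : Integrable (fun x => lap b x i * (Δ ϕ) x) muB :=
    htest ((MemLp.coord hu.memL2_lap i).integrable one_le_two) hϕ.laplacian
  have i1 : Integrable (fun x => (∑ k, ∑ j, coeffV Q u k x i j * weakPartial k u x j) * (Δ ϕ) x)
      muB := by
    refine htest (integrable_finsetSum _ fun k _ => integrable_finsetSum _ fun j _ => ?_)
      hϕ.laplacian
    exact hmul (h.memW12_grad_entry hu k _ i).1 (ha k j)
  have i2 : Integrable (fun x => ∑ k, (∑ j, coeffw σ Q u b x i j * weakPartial k u x j) *
      partialD k ϕ x) muB := by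
    refine integrable_finsetSum _ fun k _ =>
      htest (integrable_finsetSum _ fun j _ => ?_) (hϕ.partialD k)
    exact hmul (MemLp.sub (h.memL2_divEntry hu σ i j) (h.memL2_commEntry hu i j)) (ha k j)
  have i3 : ∀ k j, Integrable (fun x => coeffOm Q u b x i j *
      (partialD k ϕ x * weakPartial k u x j + ϕ x * b k k x j)) muB := fun k j =>
    hmul (h.memL2_commEntry hu i j) (hw2 k k j)
  have i4 : ∀ k j, Integrable (fun x => coeffF σ Q u b k x i j * (ϕ x * weakPartial k u x j))
      muB := fun k j => by
    obtain ⟨C, -, hC⟩ := (h.memL2W12_multEntry hu σ k i j).exists_bound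
    exact (hC _ (hW k j)).1
  have i34 : ∀ k j, Integrable (fun x => -(coeffOm Q u b x i j *
      (partialD k ϕ x * weakPartial k u x j + ϕ x * b k k x j)) +
        coeffF σ Q u b k x i j * (ϕ x * weakPartial k u x j)) muB := fun k j =>
    (i3 k j).neg.add (i4 k j)
  have i5 : Integrable (fun x => ∑ k, ∑ j, (-(coeffOm Q u b x i j *
      (partialD k ϕ x * weakPartial k u x j + ϕ x * b k k x j)) +
        coeffF σ Q u b k x i j * (ϕ x * weakPartial k u x j))) muB :=
    integrable_finsetSum _ fun k _ => integrable_finsetSum _ fun j _ => i34 k j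
  have hlhs : ∫ x, u x i * (Δ (Δ ϕ)) x ∂muB = ∫ x, lap b x i * (Δ ϕ) x ∂muB := by
    have h1 := (hasWeakLaplacian_of_partials (fun k => (hu.partial_z k).coord i)
      (fun k => (hu.partial_a k k).coord i)).eq (Δ ϕ) hϕ.laplacian
    simp only [smul_eq_mul] at h1
    simp only [mul_comm _ ((Δ (Δ ϕ)) _), mul_comm _ ((Δ ϕ) _)]
    rw [h1]
    refine integral_congr_ae (Eventually.of_forall fun x => ?_)
    simp [lap]
  -- The vector-valued variation ϕ e_i extracts the i-th equation of the system.
  have hmain := hσ _ (hϕ.smul_single (EuclideanSpace.single i (1 : ℝ) : E m))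
  rw [integral_congr_ae (h.first_variation_ae hu huN hϕ σ i)] at hmain
  have hsplit := integral_sub iL ((i1.sub i2).add i5)
  have hsum := integral_add (i1.sub i2) i5
  have hdiff := integral_sub i1 i2
  have hzero : ∫ x, (lap b x i * (Δ ϕ) x -
      ((∑ k, ∑ j, coeffV Q u k x i j * weakPartial k u x j) * (Δ ϕ) x -
        ∑ k, (∑ j, coeffw σ Q u b x i j * weakPartial k u x j) * partialD k ϕ x +
        ∑ k, ∑ j, (-(coeffOm Q u b x i j *
      (partialD k ϕ x * weakPartial k u x j + ϕ x * b k k x j)) +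
        coeffF σ Q u b k x i j * (ϕ x * weakPartial k u x j)))) ∂muB = 0 := hmain
  have hlast : ∫ x, ∑ k, ∑ j, (-(coeffOm Q u b x i j *
      (partialD k ϕ x * weakPartial k u x j + ϕ x * b k k x j)) +
        coeffF σ Q u b k x i j * (ϕ x * weakPartial k u x j)) ∂muB =
      ∑ k, ∑ j, coeffW σ Q u b k i j (fun x => ϕ x * weakPartial k u x j) := by
    rw [integral_finsetSum _ fun k _ => integrable_finsetSum _ fun j _ => i34 k j]
    refine Finset.sum_congr rfl fun k _ => ?_
    rw [integral_finsetSum _ fun j _ => i34 k j]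
    refine Finset.sum_congr rfl fun j _ => ?_
    refine (integral_add (i3 k j).neg (i4 k j)).trans ?_
    rw [coeffW, hY k j]
    exact congrArg (· + _) (integral_neg _)
  rw [hlhs, ← hlast]
  simp only [Pi.sub_apply, Pi.add_apply] at hsplit hsum hdiff
  linarith

end Coefficients

end Biharmonic

end

theorem theorem1p4 (m n : ℕ) (N : Set (Biharmonic.E m)) (hN : Biharmonic.IsClosedSubmanifold n N)
    (u : Biharmonic.E 4 → Biharmonic.E m) (hu : Biharmonic.MemW22Into N u)
    (hcrit : Biharmonic.IsCriticalPoint N Biharmonic.extEnergy u ∨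
      Biharmonic.IsCriticalPoint N (Biharmonic.intEnergy N) u) :
    ∃ (V : Fin 4 → Biharmonic.E 4 → Matrix (Fin m) (Fin m) ℝ)
      (w : Biharmonic.E 4 → Matrix (Fin m) (Fin m) ℝ)
      (W : Fin 4 → Fin m → Fin m → (Biharmonic.E 4 → ℝ) → ℝ),
      Biharmonic.IsAdmissible V w W ∧ Biharmonic.IsSolution V w W u := by
  obtain ⟨Q, h1, h2, h3, h4⟩ := Biharmonic.exists_projection hN
    (Biharmonic.nonempty_of_ae_mem hu.2)
  have h : Biharmonic.IsProjection N Q := ⟨h1, h2, h3, h4, hN.compact⟩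
  obtain ⟨b, hb⟩ := hu.1.hasSecondOrder
  obtain ⟨σ, hσ⟩ := Biharmonic.exists_euler_lagrange h hb hu.2 hcrit
  exact ⟨_, _, _, h.isAdmissible hb hu.2 σ, h.isSolution hb hu.2 hσ⟩
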